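/- Let $n\ge 1$ be an integer, $s\in(0,1)$, $p>1$ and $\Lambda\ge 1$. There exist constants $\alpha\in(0,1)$ and $C\ge 1$, depending only on $n,s,p,\Lambda$, such that the following holds. Let $\Omega\subset\mathbb R^n$ be a bounded open set. Let $K:\mathbb R^n\times\mathbb R^n\to[0,\infty)$ be measurable with $K(x,y)=K(y,x)$ and $$\frac{1}{\Lambda|x-y|^{n+sp}}\le K(x,y)\le\frac{\Lambda}{|x-y|^{n+sp}}\qquad\text{for a.e. }(x,y)\in\mathbb R^n\times\mathbb R^n .$$ Let $F_0\ge 0$ and let $F:\Omega\times\mathbb R\to\mathbb R$ satisfy $|F(x,t)|\le F_0$ for a.e. $x\in\Omega$ and every $t\in\mathbb R$, and be such that $x\mapsto F(x,v(x))$ is measurable on $\Omega$ for every measurable $v$ (for instance, $F$ is a Carathéodory function, or $F$ is Borel measurable and possibly discontinuous). For measurable $u:\mathbb R^n\to\mathbb R$ set $$\mathcal E(u;\Omega)=\frac1{2p}\iint_{\mathcal C_\Omega}|u(x)-u(y)|^pK(x,y)\,dx\,dy+\int_\Omega F(x,u(x))\,dx,\qquad \mathcal C_\Omega=\mathbb R^{2n}\setminus(\mathbb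 R^n\setminus\Omega)^2 .$$ Denote by $\mathbb W^{s,p}(\Omega)$ the set of measurable $u:\mathbb R^n\to\mathbb R$ with $u|_\Omega\in L^p(\Omega)$ and $\iint_{\mathcal C_\Omega}\frac{|u(x)-u(y)|^p}{|x-y|^{n+sp}}\,dx\,dy<\infty$, and by $L^{p-1}_s(\mathbb R^n)$ the set of measurable $u$ with $\int_{\mathbb R^n}\frac{|u(x)|^{p-1}}{(1+|x|)^{n+sp}}\,dx<\infty$. Let $u\in L^{p-1}_s(\mathbb R^n)\cap\mathbb W^{s,p}(\Omega)$ be a minimizer of $\mathcal E$ in $\Omega$, that is, $\mathcal E(u;\Omega)\le\mathcal E(u+\varphi;\Omega)$ for every measurable $\varphi:\mathbb R^n\to\mathbb R$ whose support $\overline{\{\varphi\ne0\}}$ is contained in $\Omega$. Then, after modification on a null set, $u\in C^\alpha_{\rm loc}(\Omega)$, and $$\|u\|_{L^\infty(B_R(x_0))}+R^\alpha[u]_{C^\alpha(B_R(x_0))}\le C\left(R^{-n/p}\|u\|_{L^p(B_{2R}(x_0))}+\operatorname{Tail}_{s,p}(u;x_0,R)+R^sF_0^{1/p}\right)$$ for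 every $x_0\in\Omega$ and $0<R<\operatorname{dist}(x_0,\partial\Omega)/2$, where $[u]_{C^\alpha(B)}=\sup_{x\ne y\in B}\frac{|u(x)-u(y)|}{|x-y|^\alpha}$ and $$\operatorname{Tail}_{s,p}(u;x_0,R)=\left(R^{sp}\int_{\mathbb R^n\setminus B_R(x_0)}\frac{|u(x)|^{p-1}}{|x-x_0|^{n+sp}}\,dx\right)^{\frac1{p-1}} .$$ -/

import Mathlib

open MeasureTheory Set
open scoped ENNReal

/-- The Euclidean space `ℝⁿ`. Functions on it are called measurable in the sense of Lebesgue,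
that is, `AEMeasurable` with respect to `volume`. -/
abbrev Rn (n : ℕ) : Type := EuclideanSpace ℝ (Fin n)

namespace NonlocalEnergy

/-- `u ∈ L^{p-1}_s(ℝⁿ)`: `u` is measurable and `∫ |u(x)|^{p-1} / (1 + |x|)^{n+sp} dx < ∞`. -/
def MemWeightedL (n : ℕ) (s p : ℝ) (u : Rn n → ℝ) : Prop :=
  AEMeasurable u ∧
    ∫⁻ x, ENNReal.ofReal (|u x| ^ (p - 1) / (1 + ‖x‖) ^ ((n : ℝ) + s * p)) < ∞

/-- `Tail_{s,p}(u; x₀, R) = (R^{sp} ∫_{ℝⁿ ∖ B_R(x₀)} |u(x)|^{p-1} / |x - x₀|^{n+sp} dx)^{1/(p-1)}`,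
as an element of `[0, ∞]`; it is finite for `u ∈ L^{p-1}_s(ℝⁿ)`. -/
noncomputable def tail (n : ℕ) (s p : ℝ) (u : Rn n → ℝ) (x₀ : Rn n) (R : ℝ) : ℝ≥0∞ :=
  (ENNReal.ofReal (R ^ (s * p)) *
    ∫⁻ x in (Metric.ball x₀ R)ᶜ,
      ENNReal.ofReal (|u x| ^ (p - 1) / ‖x - x₀‖ ^ ((n : ℝ) + s * p))) ^ (1 / (p - 1))

/-- `𝒞_Ω = ℝ²ⁿ ∖ (ℝⁿ ∖ Ω)²`. -/
def crossSet {n : ℕ} (Ω : Set (Rn n)) : Set (Rn n × Rn n) :=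
  (Ωᶜ ×ˢ Ωᶜ)ᶜ

/-- `u ∈ 𝕎^{s,p}(Ω)`: `u : ℝⁿ → ℝ` is measurable, `u|_Ω ∈ L^p(Ω)`, and
`∬_{𝒞_Ω} |u(x) - u(y)|^p / |x - y|^{n+sp} dx dy < ∞`. -/
def MemW (n : ℕ) (s p : ℝ) (Ω : Set (Rn n)) (u : Rn n → ℝ) : Prop :=
  AEMeasurable u ∧
  MemLp u (ENNReal.ofReal p) (volume.restrict Ω) ∧
    ∫⁻ z in crossSet Ω,
      ENNReal.ofReal (|u z.1 - u z.2| ^ p / ‖z.1 - z.2‖ ^ ((n : ℝ) + s * p)) < ∞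

/-- The structural assumptions on the interaction kernel `K`. -/
structure IsAdmissibleKernel (n : ℕ) (s p Λ : ℝ) (K : Rn n → Rn n → ℝ) : Prop where
  aemeasurable : AEMeasurable (fun z : Rn n × Rn n => K z.1 z.2)
  nonneg : ∀ x y, 0 ≤ K x y
  symm : ∀ᵐ z : Rn n × Rn n, K z.1 z.2 = K z.2 z.1
  lower : ∀ᵐ z : Rn n × Rn n, 1 / (Λ * ‖z.1 - z.2‖ ^ ((n : ℝ) + s * p)) ≤ K z.1 z.2
  upper : ∀ᵐ z : Rn n × Rn n, K z.1 z.2 ≤ Λ / ‖z.1 - z.2‖ ^ ((n : ℝ) + s * p)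

/-- `x ↦ F(x, v(x))` is measurable on `Ω` for every measurable `v`. This is what makes the potential
term of the energy meaningful. Carathéodory integrands have this property
(`SuperpositionMeasurable.of_caratheodory`), and so have Borel ones, which may be discontinuous in
the second variable, such as `F(x, t) = χ_{(0,∞)}(t)`. -/
def SuperpositionMeasurable {n : ℕ} (Ω : Set (Rn n)) (F : Rn n → ℝ → ℝ) : Prop :=
  ∀ v : Rn n → ℝ, Measurable v → AEMeasurable (fun x => F x (v x)) (volume.restrict Ω)

/-- Carathéodory integrands: measurable in `x ∈ Ω` for every `t`, continuous in `t` for a.e.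
`x ∈ Ω`. -/
theorem SuperpositionMeasurable.of_caratheodory {n : ℕ} {Ω : Set (Rn n)} {F : Rn n → ℝ → ℝ}
    (hmeas : ∀ t, AEMeasurable (fun x => F x t) (volume.restrict Ω))
    (hcont : ∀ᵐ x ∂(volume.restrict Ω), Continuous (F x)) : SuperpositionMeasurable Ω F := by
  intro v hv
  obtain ⟨f, hf⟩ : ∃ f : ℕ → SimpleFunc (Rn n) ℝ,
      ∀ x, Filter.Tendsto (fun k => f k x) Filter.atTop (nhds (v x)) :=
    ⟨hv.stronglyMeasurable.approx, hv.stronglyMeasurable.tendsto_approx⟩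
  refine aemeasurable_of_tendsto_metrizable_ae Filter.atTop (f := fun k x => F x (f k x)) ?_ ?_
  · intro k
    have h : (fun x => F x (f k x)) =
        fun x => ∑ t ∈ (f k).range, (f k ⁻¹' {t}).indicator (fun x => F x t) x := by
      funext x
      rw [Finset.sum_eq_single (f k x)]
      · simp
      · intro t _ ht
        exact Set.indicator_of_notMem (fun hx => ht (by simpa using hx.symm)) _
      · intro hx
        exact absurd (SimpleFunc.mem_range_self _ x) hx
    rw [h]
    exact Finset.aemeasurable_fun_sum _ fun t _ =>
      (hmeas t).indicator ((f k).measurableSet_fiber t)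
  · filter_upwards [hcont] with x hx
    exact (hx.tendsto _).comp (hf x)

/-- Borel integrands. -/
theorem SuperpositionMeasurable.of_measurable {n : ℕ} {Ω : Set (Rn n)} {F : Rn n → ℝ → ℝ}
    (hF : Measurable (Function.uncurry F)) : SuperpositionMeasurable Ω F :=
  fun _ hv => (hF.comp (measurable_id.prodMk hv)).aemeasurable

/-- The energy
`ℰ(u; Ω) = 1/(2p) ∬_{𝒞_Ω} |u(x) - u(y)|^p K(x, y) dx dy + ∫_Ω F(x, u(x)) dx`.
The interaction term is a number in `[0, ∞]`. The potential term is a real number, an integral of a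
bounded measurable function over a bounded set in all cases of interest. The sum is infinite exactly
when the interaction term is. -/
noncomputable def energy {n : ℕ} (p : ℝ) (K : Rn n → Rn n → ℝ) (F : Rn n → ℝ → ℝ)
    (Ω : Set (Rn n)) (u : Rn n → ℝ) : EReal :=
  ((ENNReal.ofReal (1 / (2 * p)) *
      ∫⁻ z in crossSet Ω, ENNReal.ofReal (|u z.1 - u z.2| ^ p * K z.1 z.2) : ℝ≥0∞) : EReal) +
    ((∫ x in Ω, F x (u x) : ℝ) : EReal)

/-- `u` is a minimizer of `ℰ` in `Ω`: `u ∈ 𝕎^{s,p}(Ω)` and `ℰ(u; Ω) ≤ ℰ(u + φ; Ω)` for every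
measurable `φ : ℝⁿ → ℝ` whose support (the closure of `{φ ≠ 0}`) lies in `Ω`. A function that is
minimal among all perturbations vanishing outside `Ω` is in particular a minimizer in this sense. -/
def IsMinimizer {n : ℕ} (s p : ℝ) (K : Rn n → Rn n → ℝ) (F : Rn n → ℝ → ℝ)
    (Ω : Set (Rn n)) (u : Rn n → ℝ) : Prop :=
  MemW n s p Ω u ∧
    ∀ φ : Rn n → ℝ, AEMeasurable φ → tsupport φ ⊆ Ω →
      energy p K F Ω u ≤ energy p K F Ω (fun x => u x + φ x)

/-- `[v]_{C^α(S)} = sup_{x, y ∈ S, x ≠ y} |v(x) - v(y)| / |x - y|^α`, in `[0, ∞]`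
(the pairs with `x = y` contribute `0 / 0 = 0`). -/
noncomputable def holderSeminorm {n : ℕ} (α : ℝ) (v : Rn n → ℝ) (S : Set (Rn n)) : ℝ≥0∞ :=
  ⨆ x ∈ S, ⨆ y ∈ S, edist (v x) (v y) / edist x y ^ α

/-- `v ∈ C^α_loc(Ω)`: `v` is `α`-Hölder continuous on every compact subset of `Ω`. -/
def MemHolderLoc {n : ℕ} (α : ℝ) (v : Rn n → ℝ) (Ω : Set (Rn n)) : Prop :=
  ∀ Q : Set (Rn n), IsCompact Q → Q ⊆ Ω → holderSeminorm α v Q < ∞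

end NonlocalEnergy

/-! The potential is merely bounded and may jump in `u`, so no Euler-Lagrange equation is available;
regularity comes from energy comparison alone, in the manner of De Giorgi. The competitor is `u -
ζ^p (u - k)₊` with `ζ` a cutoff in a ball. The potential then changes by at most `2 F₀` times the
measure of `{u > k}` in the ball. The interaction energy changes by errors carrying the slope of `ζ`
and a tail, minus a gain: the interaction of `{u > k}` with `{u ≤ k}`, of density `(u(x) - k)
max(u(x) - k, k - u(y))^(p-1) / |x - y|^(n+sp)`. The resulting Caccioppoli inequality is
`IsDeGiorgi`, obtained in `IsMinimizer.isDeGiorgi`; it holds for `-u` too, which is a minimizer for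
`F(x, -t)`.

Only the gain is kept on the left-hand side, and it serves twice. If `{u > k}` has small measure,
half of every small ball lies below `k`, and the first entry of the maximum bounds `ρ^(-sp) ∫ (u -
k)₊^p`. This takes the place of a Sobolev inequality (`lintegral_gain_ge_of_volume_le`) and drives
the iteration `IsDeGiorgi.exists_sup_le`: small excess over `k` in a ball gives `u ≤ k + M` in the
half ball. If instead `u ≤ c` on half of a ball, the second entry bounds `∫ (u - k)₊` for `k` close
to the upper bound `c + ω` (`IsDeGiorgi.excess_mul_le`), so that the excess over `k` is small on the
scale of `c + ω - k`. This takes the place of De Giorgi's isoperimetric inequality, and with the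
iteration it lowers the upper bound (`IsDeGiorgi.exists_upper_reduction`).

Since `u` or `-u` always qualifies, the oscillation shrinks by `1 - δ` when the radius shrinks by
`L`, where `L` is so large that the tail reproduces its own bound
(`IsDeGiorgi.exists_oscBound_step`). Iterating gives Hölder decay about every point, and the
limiting values form the Hölder continuous representative. -/

namespace NonlocalEnergy

/-! ### Integrals of powers of the distance, inside and outside balls. -/

theorem volume_ball_eq (n : ℕ) (x : Rn n) {r : ℝ} (hr : 0 < r) :
    volume (Metric.ball x r) =
      ENNReal.ofReal (r ^ (n : ℝ) * (volume (Metric.ball (0 : Rn n) 1)).toReal) := by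
  rw [Measure.addHaar_ball_of_pos _ _ hr, ENNReal.ofReal_mul (by positivity),
    ENNReal.ofReal_toReal measure_ball_lt_top.ne]
  simp

theorem unitBall_pos (n : ℕ) : 0 < (volume (Metric.ball (0 : Rn n) 1)).toReal :=
  ENNReal.toReal_pos (Metric.measure_ball_pos _ _ one_pos).ne' measure_ball_lt_top.ne

theorem enorm_rpow_eq {n : ℕ} {y : Rn n} (hy : 0 < ‖y‖) (a : ℝ) :
    ‖y‖ₑ ^ a = ENNReal.ofReal (‖y‖ ^ a) := by
  rw [← ofReal_norm, ENNReal.ofReal_rpow_of_pos hy]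

theorem rpow_le_of_mem_shell {a t r : ℝ} (ht : 0 < t) (h1 : t ≤ r) (h2 : r ≤ 2 * t) :
    r ^ a ≤ 2 ^ |a| * t ^ a := by
  rcases le_total 0 a with ha | ha
  · rw [abs_of_nonneg ha, ← Real.mul_rpow (by norm_num) ht.le]
    exact Real.rpow_le_rpow (by linarith) h2 ha
  · calc r ^ a ≤ t ^ a := Real.rpow_le_rpow_of_nonpos ht h1 ha
      _ ≤ 2 ^ |a| * t ^ a := by
        refine le_mul_of_one_le_left (by positivity) (Real.one_le_rpow (by norm_num) (abs_nonneg a))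

/-- The integral of a power of the distance over a dyadic shell. -/
theorem lintegral_shell_le (n : ℕ) (a : ℝ) (x : Rn n) {t : ℝ} (ht : 0 < t) :
    ∫⁻ y in Metric.ball x (2 * t) \ Metric.ball x t, ‖y - x‖ₑ ^ a ≤
      ENNReal.ofReal (2 ^ |a| * 2 ^ (n : ℝ) * (volume (Metric.ball (0 : Rn n) 1)).toReal *
        t ^ (a + n)) := by
  calc ∫⁻ y in Metric.ball x (2 * t) \ Metric.ball x t, ‖y - x‖ₑ ^ a
      ≤ ∫⁻ _ in Metric.ball x (2 * t) \ Metric.ball x t, ENNReal.ofReal (2 ^ |a| * t ^ a) := by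
        refine setLIntegral_mono' (measurableSet_ball.diff measurableSet_ball) fun y hy => ?_
        have h1 : ‖y - x‖ < 2 * t := by simpa [dist_eq_norm] using hy.1
        have h2 : t ≤ ‖y - x‖ := by simpa [dist_eq_norm] using hy.2
        rw [enorm_rpow_eq (ht.trans_le h2)]
        exact ENNReal.ofReal_le_ofReal (rpow_le_of_mem_shell ht h2 h1.le)
    _ ≤ ENNReal.ofReal (2 ^ |a| * t ^ a) * volume (Metric.ball x (2 * t)) := by
        rw [setLIntegral_const]
        gcongr
        exact sdiff_subset
    _ = _ := by
        rw [volume_ball_eq n x (by positivity), ← ENNReal.ofReal_mul (by positivity)]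
        congr 1
        rw [Real.mul_rpow (by norm_num) ht.le, Real.rpow_add ht]
        ring

theorem tsum_ofReal_geometric {c q : ℝ} (hc : 0 ≤ c) (hq : 0 ≤ q) (hq1 : q < 1) :
    ∑' j : ℕ, ENNReal.ofReal (c * q ^ j) = ENNReal.ofReal (c * (1 - q)⁻¹) := by
  rw [← ENNReal.ofReal_tsum_of_nonneg (fun j => by positivity)
    ((summable_geometric_of_lt_one hq hq1).mul_left c), tsum_mul_left,
    tsum_geometric_of_lt_one hq hq1]

/-- A family of dyadic shells of radii `ρ λ^j` with `λ^b < 1` has a geometric series of integrals. -/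
theorem lintegral_iUnion_shell_le (n : ℕ) (a : ℝ) (x : Rn n) {ρ l : ℝ} (hρ : 0 < ρ) (hl : 0 < l)
    (hq : l ^ (a + n) < 1) :
    ∫⁻ y in ⋃ j : ℕ, Metric.ball x (2 * (ρ * l ^ j)) \ Metric.ball x (ρ * l ^ j), ‖y - x‖ₑ ^ a ≤
      ENNReal.ofReal (2 ^ |a| * 2 ^ (n : ℝ) * (volume (Metric.ball (0 : Rn n) 1)).toReal *
        (1 - l ^ (a + n))⁻¹ * ρ ^ (a + n)) := by
  refine (lintegral_iUnion_le _ _).trans ?_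
  have hω := unitBall_pos n
  calc _ ≤ ∑' j : ℕ, ENNReal.ofReal ((2 ^ |a| * 2 ^ (n : ℝ) *
        (volume (Metric.ball (0 : Rn n) 1)).toReal * ρ ^ (a + n)) * (l ^ (a + n)) ^ j) := by
        refine ENNReal.tsum_le_tsum fun j => (lintegral_shell_le n a x (by positivity)).trans_eq ?_
        congr 1
        rw [Real.mul_rpow hρ.le (by positivity), ← Real.rpow_natCast, ← Real.rpow_natCast,
          ← Real.rpow_mul hl.le, ← Real.rpow_mul hl.le, mul_comm (j : ℝ)]
        ring
    _ = _ := by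
        rw [tsum_ofReal_geometric (by positivity) (by positivity) hq]
        congr 1
        ring

/-- Shells going outwards, with ratio `l = 2`: the series converges because `a + n = -sp < 0`. -/
theorem exists_lintegral_compl_ball_le (n : ℕ) {s p : ℝ} (hs : 0 < s) (hp : 0 < p) :
    ∃ C : ℝ, 0 < C ∧ ∀ (x : Rn n) (ρ : ℝ), 0 < ρ →
      ∫⁻ y in (Metric.ball x ρ)ᶜ, ‖y - x‖ₑ ^ (-((n : ℝ) + s * p)) ≤
        ENNReal.ofReal (C * ρ ^ (-(s * p))) := by
  have hsp : 0 < s * p := mul_pos hs hp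
  set a : ℝ := -((n : ℝ) + s * p) with ha
  have han : a + n = -(s * p) := by rw [ha]; ring
  have hq : (2 : ℝ) ^ (a + n) < 1 := by
    rw [han]; exact Real.rpow_lt_one_of_one_lt_of_neg (by norm_num) (by linarith)
  have hω := unitBall_pos n
  have hq' : 0 < 1 - (2 : ℝ) ^ (a + n) := by linarith
  refine ⟨2 ^ |a| * 2 ^ (n : ℝ) * (volume (Metric.ball (0 : Rn n) 1)).toReal *
    (1 - 2 ^ (a + n))⁻¹, ?_, fun x ρ hρ => ?_⟩
  · positivity
  · rw [← han]
    refine le_trans (lintegral_mono_set ?_) (lintegral_iUnion_shell_le n a x hρ two_pos hq)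
    intro y hy
    have h2 : ρ ≤ dist y x := by simpa using hy
    obtain ⟨j, hj1, hj2⟩ := exists_nat_pow_near (x := dist y x / ρ) (y := 2)
      ((one_le_div hρ).2 h2) (by norm_num)
    rw [le_div_iff₀ hρ] at hj1
    rw [div_lt_iff₀ hρ, pow_succ] at hj2
    refine mem_iUnion.2 ⟨j, ?_, ?_⟩
    · rw [Metric.mem_ball]; linarith
    · rw [Metric.mem_ball]; linarith

/-- Shells going inwards, with ratio `l = 1/2`: the series converges because `a + n > 0`. -/
theorem exists_lintegral_ball_le (n : ℕ) (hn : 1 ≤ n) {a : ℝ} (ha : 0 < a + n) :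
    ∃ C : ℝ, 0 < C ∧ ∀ (x : Rn n) (ρ : ℝ), 0 < ρ →
      ∫⁻ y in Metric.ball x ρ, ‖y - x‖ₑ ^ a ≤ ENNReal.ofReal (C * ρ ^ (a + n)) := by
  have hq : (1 / 2 : ℝ) ^ (a + n) < 1 :=
    Real.rpow_lt_one (by norm_num) (by norm_num) ha
  have hω := unitBall_pos n
  have hq' : 0 < 1 - (1 / 2 : ℝ) ^ (a + n) := by linarith
  have : Nonempty (Fin n) := ⟨⟨0, hn⟩⟩
  refine ⟨2 ^ |a| * 2 ^ (n : ℝ) * (volume (Metric.ball (0 : Rn n) 1)).toReal *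
    (1 - (1 / 2) ^ (a + n))⁻¹, by positivity, fun x ρ hρ => ?_⟩
  · have key : ∫⁻ y in Metric.ball x ρ, ‖y - x‖ₑ ^ a ≤ ∫⁻ y in ⋃ j : ℕ,
        Metric.ball x (2 * (ρ * (1 / 2) ^ j)) \ Metric.ball x (ρ * (1 / 2) ^ j), ‖y - x‖ₑ ^ a := by
      refine lintegral_mono_set' ?_
      -- No shell contains the centre, which is a null set because `n ≥ 1`.
      have : ∀ᵐ y : Rn n, y ≠ x := by simp [ae_iff]
      filter_upwards [this] with y hyx hy
      have h2 : dist y x < ρ := hy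
      have h0 : 0 < dist y x := dist_pos.2 hyx
      obtain ⟨j, hj1, hj2⟩ := exists_nat_pow_near_of_lt_one (x := dist y x / ρ) (y := 1 / 2)
        (by positivity) ((div_le_one hρ).2 h2.le) (by norm_num) (by norm_num)
      rw [lt_div_iff₀ hρ] at hj1
      rw [div_le_iff₀ hρ] at hj2
      -- Shells contain their inner sphere but not their outer one, so a point at distance exactly
      -- `ρ / 2^j` belongs to shell `j`, the others to shell `j + 1`.
      rcases eq_or_lt_of_le hj2 with h | h
      · refine mem_iUnion.2 ⟨j, ?_, ?_⟩
        · rw [Metric.mem_ball]; linarith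
        · rw [Metric.mem_ball]; linarith
      · refine mem_iUnion.2 ⟨j + 1, ?_, ?_⟩
        · rw [Metric.mem_ball, pow_succ]; linarith
        · rw [Metric.mem_ball]; linarith
    exact key.trans (lintegral_iUnion_shell_le n a x hρ (by norm_num) hq)

/-! ### Nonlocal tails. -/

/-- The nonlocal tail, raised to the power `p - 1`, of a nonnegative function. -/
noncomputable def weightedTail (n : ℕ) (s p : ℝ) (f : Rn n → ℝ≥0∞) (x₀ : Rn n) (R : ℝ) : ℝ≥0∞ :=
  ENNReal.ofReal (R ^ (s * p)) *
    ∫⁻ y in (Metric.ball x₀ R)ᶜ, f y ^ (p - 1) * ‖y - x₀‖ₑ ^ (-((n : ℝ) + s * p))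

/-- `C` bounds the tails of the constant function `1`. -/
def IsTailConst (n : ℕ) (s p C : ℝ) : Prop :=
  0 < C ∧ ∀ (x : Rn n) (ρ : ℝ), 0 < ρ →
      ∫⁻ y in (Metric.ball x ρ)ᶜ, ‖y - x‖ₑ ^ (-((n : ℝ) + s * p)) ≤
        ENNReal.ofReal (C * ρ ^ (-(s * p)))

theorem ofReal_rpow_mul_ofReal_rpow_neg {ρ : ℝ} (hρ : 0 < ρ) (C a : ℝ) :
    ENNReal.ofReal (ρ ^ a) * ENNReal.ofReal (C * ρ ^ (-a)) = ENNReal.ofReal C := by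
  rw [← ENNReal.ofReal_mul (by positivity), Real.rpow_neg hρ.le]
  congr 1
  have : ρ ^ a ≠ 0 := by positivity
  field_simp

section Tail

variable {n : ℕ} {s p : ℝ}

theorem weightedTail_mono (hp : 1 < p) {f g : Rn n → ℝ≥0∞} {x₀ : Rn n} {R : ℝ}
    (h : ∀ᵐ y ∂(volume.restrict (Metric.ball x₀ R)ᶜ), f y ≤ g y) :
    weightedTail n s p f x₀ R ≤ weightedTail n s p g x₀ R := by
  refine mul_le_mul' le_rfl (lintegral_mono_ae ?_)
  filter_upwards [h] with y hy
  have : 0 ≤ p - 1 := by linarith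
  gcongr

theorem weightedTail_const_le {C : ℝ} (hC : IsTailConst n s p C) {x₀ : Rn n} {R : ℝ}
    (hR : 0 < R) (c : ℝ≥0∞) :
    weightedTail n s p (fun _ => c) x₀ R ≤ ENNReal.ofReal C * c ^ (p - 1) := by
  unfold weightedTail
  rw [lintegral_const_mul _ (by fun_prop)]
  calc _ ≤ ENNReal.ofReal (R ^ (s * p)) * (c ^ (p - 1) * ENNReal.ofReal (C * R ^ (-(s * p)))) := by
        gcongr
        exact hC.2 x₀ R hR
    _ = (ENNReal.ofReal (R ^ (s * p)) * ENNReal.ofReal (C * R ^ (-(s * p)))) * c ^ (p - 1) := by ring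
    _ = _ := by rw [ofReal_rpow_mul_ofReal_rpow_neg hR]

/-- Change of centre and radius in a tail. -/
theorem weightedTail_le_of_le (hp : 1 < p) (hs : 0 < s) {C : ℝ} (hC : IsTailConst n s p C)
    {f : Rn n → ℝ≥0∞}
    {x₀ x₁ : Rn n} {R ρ κ : ℝ} (hR : 0 < R) (hρ : 0 < ρ) (hκ : 0 < κ) {c : ℝ≥0∞}
    (hκ' : ∀ y, R ≤ ‖y - x₀‖ → ρ ≤ ‖y - x₁‖ → ‖y - x₀‖ ≤ κ * ‖y - x₁‖)
    (hf : ∀ᵐ y ∂(volume.restrict (Metric.ball x₀ R)), f y ≤ c) :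
    weightedTail n s p f x₁ ρ ≤ ENNReal.ofReal C * c ^ (p - 1) +
      ENNReal.ofReal (κ ^ ((n : ℝ) + s * p) * (ρ / R) ^ (s * p)) * weightedTail n s p f x₀ R := by
  set E : ℝ := (n : ℝ) + s * p with hE
  have hp1 : 0 ≤ p - 1 := by linarith
  have hE0 : 0 < E := by
    have : 0 < s * p := by positivity
    positivity
  -- The exterior of the new ball is split by the old one: inside the old ball `f ≤ c`, outside it
  -- the two kernels are comparable with constant `κ ^ E`.
  have h1 : ∫⁻ y in (Metric.ball x₁ ρ)ᶜ, f y ^ (p - 1) * ‖y - x₁‖ₑ ^ (-E) ≤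
      (∫⁻ y in (Metric.ball x₁ ρ)ᶜ ∩ Metric.ball x₀ R, f y ^ (p - 1) * ‖y - x₁‖ₑ ^ (-E)) +
      ∫⁻ y in (Metric.ball x₁ ρ)ᶜ ∩ (Metric.ball x₀ R)ᶜ, f y ^ (p - 1) * ‖y - x₁‖ₑ ^ (-E) := by
    refine (lintegral_mono_set ?_).trans (lintegral_union_le _ _ _)
    intro y hy
    by_cases h : y ∈ Metric.ball x₀ R
    · exact Or.inl ⟨hy, h⟩
    · exact Or.inr ⟨hy, h⟩
  have h2 : ∫⁻ y in (Metric.ball x₁ ρ)ᶜ ∩ Metric.ball x₀ R, f y ^ (p - 1) * ‖y - x₁‖ₑ ^ (-E) ≤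
      ∫⁻ y in (Metric.ball x₁ ρ)ᶜ, c ^ (p - 1) * ‖y - x₁‖ₑ ^ (-E) := by
    rw [inter_comm, ← Measure.restrict_restrict measurableSet_ball]
    refine le_trans ?_ (lintegral_mono_set (s := Metric.ball x₀ R ∩ (Metric.ball x₁ ρ)ᶜ)
      inter_subset_right)
    rw [Measure.restrict_restrict measurableSet_ball]
    refine lintegral_mono_ae ?_
    filter_upwards [ae_restrict_of_ae_restrict_of_subset inter_subset_left hf] with y hy
    gcongr
  have h3 : ∫⁻ y in (Metric.ball x₁ ρ)ᶜ ∩ (Metric.ball x₀ R)ᶜ, f y ^ (p - 1) * ‖y - x₁‖ₑ ^ (-E) ≤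
      ENNReal.ofReal (κ ^ E) *
        ∫⁻ y in (Metric.ball x₀ R)ᶜ, f y ^ (p - 1) * ‖y - x₀‖ₑ ^ (-E) := by
    rw [← lintegral_const_mul' _ _ ENNReal.ofReal_ne_top]
    refine le_trans (setLIntegral_mono' (measurableSet_ball.compl.inter measurableSet_ball.compl)
      fun y hy => ?_) (lintegral_mono_set inter_subset_right)
    have hy0 : R ≤ ‖y - x₀‖ := by simpa [dist_eq_norm] using hy.2
    have hy1 := hκ' y hy0 (by simpa [dist_eq_norm] using hy.1)
    have hpos : 0 < ‖y - x₀‖ := hR.trans_le hy0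
    have hpos1 : 0 < ‖y - x₁‖ := by
      by_contra h
      have := mul_nonpos_of_nonneg_of_nonpos hκ.le (not_lt.1 h)
      linarith
    rw [enorm_rpow_eq hpos, enorm_rpow_eq hpos1, mul_left_comm, ← ENNReal.ofReal_mul (by positivity)]
    gcongr
    rw [Real.rpow_neg hpos1.le, Real.rpow_neg hpos.le, ← div_eq_mul_inv, inv_eq_one_div,
      div_le_div_iff₀ (by positivity) (by positivity), one_mul, ← Real.mul_rpow hκ.le hpos1.le]
    exact Real.rpow_le_rpow hpos.le hy1 hE0.le
  have h4 : ENNReal.ofReal (ρ ^ (s * p)) *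
      ∫⁻ y in (Metric.ball x₁ ρ)ᶜ, c ^ (p - 1) * ‖y - x₁‖ₑ ^ (-E) ≤
      ENNReal.ofReal C * c ^ (p - 1) := weightedTail_const_le hC hρ c
  unfold weightedTail
  calc _ ≤ ENNReal.ofReal (ρ ^ (s * p)) *
        ((∫⁻ y in (Metric.ball x₁ ρ)ᶜ, c ^ (p - 1) * ‖y - x₁‖ₑ ^ (-E)) +
          ENNReal.ofReal (κ ^ E) *
            ∫⁻ y in (Metric.ball x₀ R)ᶜ, f y ^ (p - 1) * ‖y - x₀‖ₑ ^ (-E)) := by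
        gcongr
        exact h1.trans (add_le_add h2 h3)
    _ ≤ _ := by
        rw [mul_add]
        refine add_le_add h4 (le_of_eq ?_)
        rw [← mul_assoc, ← mul_assoc, ← ENNReal.ofReal_mul (by positivity),
          ← ENNReal.ofReal_mul (by positivity)]
        congr 2
        rw [Real.div_rpow hρ.le hR.le]
        have : R ^ (s * p) ≠ 0 := by positivity
        field_simp

/-- Goes through the maximum instead of convexity, since the exponent `p - 1` of the tails may be
less than 1. -/
theorem ennreal_add_rpow_le {q : ℝ} (hq : 0 ≤ q) (a b : ℝ≥0∞) :
    (a + b) ^ q ≤ ENNReal.ofReal (2 ^ q) * (a ^ q + b ^ q) := by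
  have h2 : ENNReal.ofReal (2 ^ q) = 2 ^ q := by
    rw [← ENNReal.ofReal_rpow_of_pos two_pos]; simp
  rw [h2]
  calc (a + b) ^ q ≤ (2 * max a b) ^ q := by
        gcongr
        rw [two_mul]
        gcongr
        · exact le_max_left _ _
        · exact le_max_right _ _
    _ = 2 ^ q * (max a b) ^ q := ENNReal.mul_rpow_of_nonneg _ _ hq
    _ ≤ _ := by
        gcongr
        rcases le_total a b with h | h
        · rw [max_eq_right h]; exact le_add_self
        · rw [max_eq_left h]; exact le_self_add

theorem weightedTail_add_const_le (hp : 1 < p) {C : ℝ} (hC : IsTailConst n s p C)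
    {f : Rn n → ℝ≥0∞} {x₀ : Rn n} {R : ℝ} (hR : 0 < R) (c : ℝ≥0∞) :
    weightedTail n s p (fun y => f y + c) x₀ R ≤ ENNReal.ofReal (2 ^ (p - 1)) *
      (weightedTail n s p f x₀ R + ENNReal.ofReal C * c ^ (p - 1)) := by
  have h := weightedTail_const_le hC (x₀ := x₀) hR c
  set E : ℝ := (n : ℝ) + s * p with hE
  have hp1 : 0 ≤ p - 1 := by linarith
  calc weightedTail n s p (fun y => f y + c) x₀ R
      ≤ ENNReal.ofReal (R ^ (s * p)) * (ENNReal.ofReal (2 ^ (p - 1)) *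
        ∫⁻ y in (Metric.ball x₀ R)ᶜ, (f y ^ (p - 1) * ‖y - x₀‖ₑ ^ (-E) +
          c ^ (p - 1) * ‖y - x₀‖ₑ ^ (-E))) := by
        unfold weightedTail
        gcongr
        rw [← lintegral_const_mul' _ _ ENNReal.ofReal_ne_top]
        refine lintegral_mono fun y => ?_
        rw [← add_mul, ← mul_assoc]
        gcongr
        exact ennreal_add_rpow_le hp1 _ _
    _ = ENNReal.ofReal (2 ^ (p - 1)) *
        (weightedTail n s p f x₀ R + weightedTail n s p (fun _ => c) x₀ R) := by
        rw [lintegral_add_right _ (by fun_prop)]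
        unfold weightedTail
        ring
    _ ≤ _ := by gcongr

end Tail

/-! ### Elementary inequalities for `p`-th powers. -/

section Real

variable {p : ℝ}

/-- Bernoulli's inequality at `y / x - 1`, multiplied by `x ^ p`. -/
theorem rpow_sub_rpow_le (hp : 1 ≤ p) {x y : ℝ} (hy : 0 ≤ y) (hyx : y ≤ x) :
    x ^ p - y ^ p ≤ p * x ^ (p - 1) * (x - y) := by
  rcases (hy.trans hyx).eq_or_lt with h | hx
  · have : y = 0 := le_antisymm (h ▸ hyx) hy
    simp [← h, this]
  · have h1 := one_add_mul_self_le_rpow_one_add (s := y / x - 1) (p := p)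
      (by have : 0 ≤ y / x := by positivity
          linarith) hp
    rw [add_sub_cancel, Real.div_rpow hy hx.le] at h1
    have h2 : x ^ p = x ^ (p - 1) * x := by
      rw [Real.rpow_sub_one hx.ne']; field_simp
    have hxp : 0 < x ^ p := by positivity
    rw [le_div_iff₀ hxp] at h1
    have h3 : (1 + p * (y / x - 1)) * x ^ p = x ^ p + p * x ^ (p - 1) * (y - x) := by
      rw [h2]; field_simp
    linarith

/-- Points on both sides of a level: the gain in the energy under truncation. -/
theorem add_rpow_gain (hp : 1 < p) {a b h : ℝ} (ha : 0 ≤ a) (hb : 0 ≤ b) (h0 : 0 ≤ h)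
    (h1 : h ≤ 1) : ((1 - h) * a + b) ^ p + h * (a * max a b ^ (p - 1)) ≤ (a + b) ^ p := by
  have hp1 : 0 < p - 1 := by linarith
  have key : ∀ x : ℝ, 0 ≤ x → x ^ p = x * x ^ (p - 1) := fun x hx => by
    rw [← Real.rpow_one_add' hx (by linarith)]; ring_nf
  have hc : 0 ≤ (1 - h) * a + b := by
    have : 0 ≤ 1 - h := by linarith
    positivity
  have hc1 : (1 - h) * a + b ≤ a + b := by nlinarith
  have hm : max a b ≤ a + b := max_le (by linarith) (by linarith)
  have e1 : ((1 - h) * a + b) ^ (p - 1) ≤ (a + b) ^ (p - 1) := by gcongr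
  have e2 : max a b ^ (p - 1) ≤ (a + b) ^ (p - 1) :=
    Real.rpow_le_rpow (ha.trans (le_max_left _ _)) hm hp1.le
  rw [key _ hc, key (a + b) (by positivity)]
  -- Writing each `p`-th power as `t * t ^ (p - 1)`, both factors `t ^ (p - 1)` and `max a b ^ (p -
  -- 1)` are replaced by the largest one, after which the inequality is linear.
  calc _ ≤ ((1 - h) * a + b) * (a + b) ^ (p - 1) + h * (a * (a + b) ^ (p - 1)) := by gcongr
    _ = _ := by ring

/-- The reason for using `ζ ^ p` as cutoff. The difference is at most the convex combination of `|a
- b|` and `t = p b (z - z') / z` with weight `z ^ p` on `t`. Convexity of the power keeps the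
coefficient of `|a - b| ^ p` at most 1, as needed to cancel the energy of `u`, and `z ^ p * t ^ p`
no longer contains a division by `z`. -/
theorem abs_truncation_sub_rpow_le_aux (hp : 1 < p) {a b z z' : ℝ} (hb : 0 ≤ b)
    (hz' : 0 ≤ z') (hzz : z' ≤ z) (hz1 : z ≤ 1) :
    |(1 - z ^ p) * a - (1 - z' ^ p) * b| ^ p ≤ |a - b| ^ p + p ^ p * b ^ p * |z - z'| ^ p := by
  have hp0 : 0 < p := by linarith
  rcases (hz'.trans hzz).eq_or_lt with h | hz
  · have : z' = 0 := le_antisymm (h ▸ hzz) hz'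
    simp [← h, this, Real.zero_rpow hp0.ne']
  have hh1 : z ^ p ≤ 1 := Real.rpow_le_one hz.le hz1 hp0.le
  have hh0 : 0 < z ^ p := by positivity
  have hd : 0 ≤ z - z' := by linarith
  have hber := rpow_sub_rpow_le hp.le hz' hzz
  have hmono : z' ^ p ≤ z ^ p := by gcongr
  set t : ℝ := p * b * (z - z') / z with ht
  have ht0 : 0 ≤ t := by positivity
  have hzt : z ^ p * t = p * z ^ (p - 1) * (z - z') * b := by
    rw [ht, Real.rpow_sub_one hz.ne']; field_simp
  have hztp : z ^ p * t ^ p = p ^ p * b ^ p * |z - z'| ^ p := by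
    rw [ht, Real.div_rpow (by positivity) hz.le, Real.mul_rpow (by positivity) hd,
      Real.mul_rpow hp0.le hb, abs_of_nonneg hd]
    field_simp
  have h1 : |(1 - z ^ p) * a - (1 - z' ^ p) * b| ≤ (1 - z ^ p) * |a - b| + z ^ p * t := by
    calc _ = |(1 - z ^ p) * (a - b) + -((z ^ p - z' ^ p) * b)| := by congr 1; ring
      _ ≤ |(1 - z ^ p) * (a - b)| + |-((z ^ p - z' ^ p) * b)| := abs_add_le _ _
      _ = (1 - z ^ p) * |a - b| + (z ^ p - z' ^ p) * b := by
        rw [abs_mul, abs_neg, abs_mul, abs_of_nonneg (by linarith : 0 ≤ 1 - z ^ p),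
          abs_of_nonneg (by linarith : 0 ≤ z ^ p - z' ^ p), abs_of_nonneg hb]
      _ ≤ _ := by
        rw [hzt]; gcongr
  calc _ ≤ ((1 - z ^ p) * |a - b| + z ^ p * t) ^ p := by gcongr
    _ ≤ (1 - z ^ p) * |a - b| ^ p + z ^ p * t ^ p :=
      (convexOn_rpow hp.le).2 (abs_nonneg (a - b)) ht0 (by linarith) hh0.le (by ring)
    _ ≤ _ := by
      rw [hztp]
      have : 0 ≤ z ^ p * |a - b| ^ p := by positivity
      linarith

/-- Two points above a level, both close to the cutoff. -/
theorem abs_truncation_sub_rpow_le (hp : 1 < p) {a b z z' : ℝ} (ha : 0 ≤ a) (hb : 0 ≤ b)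
    (hz : 0 ≤ z) (hz1 : z ≤ 1) (hz' : 0 ≤ z') (hz1' : z' ≤ 1) :
    |(1 - z ^ p) * a - (1 - z' ^ p) * b| ^ p ≤
      |a - b| ^ p + (p ^ p * a ^ p * |z - z'| ^ p + p ^ p * b ^ p * |z' - z| ^ p) := by
  have hp0 : 0 < p := by linarith
  have e1 : 0 ≤ p ^ p * a ^ p * |z - z'| ^ p := by positivity
  have e2 : 0 ≤ p ^ p * b ^ p * |z' - z| ^ p := by positivity
  rcases le_total z' z with h | h
  · have := abs_truncation_sub_rpow_le_aux hp (a := a) hb hz' h hz1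
    rw [abs_sub_comm z z'] at this
    linarith
  · have := abs_truncation_sub_rpow_le_aux hp (a := b) ha hz h hz1'
    rw [abs_sub_comm z' z, abs_sub_comm, abs_sub_comm b] at this
    linarith

/-- Two points above a level, the second one away from the cutoff. -/
theorem abs_truncation_far_rpow_le (hp : 1 < p) {a b h : ℝ} (ha : 0 ≤ a) (hb : 0 ≤ b) (h0 : 0 ≤ h)
    (h1 : h ≤ 1) : |(1 - h) * a - b| ^ p ≤ |a - b| ^ p + p * (a * b ^ (p - 1)) := by
  have hp0 : 0 < p := by linarith
  have hp1 : 0 < p - 1 := by linarith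
  have he0 : 0 ≤ (1 - h) * a := by
    have : 0 ≤ 1 - h := by linarith
    positivity
  have he1 : (1 - h) * a ≤ a := by nlinarith
  set e := (1 - h) * a
  have e1 : 0 ≤ p * (a * b ^ (p - 1)) := by positivity
  rcases le_total b e with hbe | hbe
  · rw [abs_of_nonneg (by linarith), abs_of_nonneg (by linarith)]
    have : (e - b) ^ p ≤ (a - b) ^ p := by
      have : 0 ≤ e - b := by linarith
      gcongr
    linarith
  · rw [abs_of_nonpos (by linarith), neg_sub]
    -- If `a ≤ b`, the base increases from `b - a` to `b - e`, by at most `a`, and the derivative is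
    -- at most `p b ^ (p - 1)`. If `e ≤ b ≤ a`, already `b ^ p ≤ a * b ^ (p - 1)`.
    rcases le_total a b with hab | hab
    · rw [abs_of_nonpos (by linarith), neg_sub]
      have := rpow_sub_rpow_le hp.le (x := b - e) (y := b - a) (by linarith) (by linarith)
      have e2 : (b - e) ^ (p - 1) ≤ b ^ (p - 1) :=
        Real.rpow_le_rpow (by linarith) (by linarith) hp1.le
      have e3 : p * (b - e) ^ (p - 1) * (b - e - (b - a)) ≤ p * b ^ (p - 1) * a := by
        have : 0 ≤ (b - e) ^ (p - 1) := Real.rpow_nonneg (by linarith) _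
        have : 0 ≤ b - e - (b - a) := by linarith
        have : b - e - (b - a) ≤ a := by linarith
        gcongr
      linarith
    · have e2 : (b - e) ^ p ≤ b ^ p := Real.rpow_le_rpow (by linarith) (by linarith) hp0.le
      have e3 : b ^ p = b * b ^ (p - 1) := by
        rw [← Real.rpow_one_add' hb (by linarith)]; ring_nf
      have e4 : b * b ^ (p - 1) ≤ a * b ^ (p - 1) := by gcongr
      have e5 : a * b ^ (p - 1) ≤ p * (a * b ^ (p - 1)) := le_mul_of_one_le_left (by positivity) hp.le
      have e6 : 0 ≤ |a - b| ^ p := by positivity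
      linarith

end Real

/-! ### Pointwise comparison of the energy densities of `u` and its truncation. -/

section Pointwise

variable {X : Type*} {p : ℝ}

open Classical in
/-- The error in the comparison of the energies of `u` and its truncation. -/
noncomputable def truncationError (p : ℝ) (u ζ : X → ℝ) (k : ℝ) (B₁ B₂ : Set X) (x y : X) : ℝ :=
  (if x ∈ B₂ ∧ y ∈ B₂ then p ^ p * max (u x - k) 0 ^ p * |ζ x - ζ y| ^ p else 0) +
    (if x ∈ B₁ ∧ y ∉ B₂ then p * (max (u x - k) 0 * max (u y - k) 0 ^ (p - 1)) else 0)

open Classical in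
/-- The gain in the comparison of the energies of `u` and its truncation. -/
noncomputable def truncationGain (p : ℝ) (u : X → ℝ) (k : ℝ) (B₀ B₂ : Set X) (x y : X) : ℝ :=
  if x ∈ B₀ ∧ y ∈ B₂ ∧ u y ≤ k then
    max (u x - k) 0 * max (max (u x - k) 0) (max (k - u y) 0) ^ (p - 1) else 0

theorem truncationError_nonneg (hp : 1 < p) (u ζ : X → ℝ) (k : ℝ) (B₁ B₂ : Set X) (x y : X) :
    0 ≤ truncationError p u ζ k B₁ B₂ x y := by
  have hp0 : 0 < p := by linarith
  have h : ∀ x, 0 ≤ max (u x - k) 0 := fun x => le_max_right _ _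
  have h1 := h x
  have h2 := h y
  unfold truncationError
  split_ifs <;> positivity

theorem truncationGain_nonneg (u : X → ℝ) (k : ℝ) (B₀ B₂ : Set X) (x y : X) :
    0 ≤ truncationGain p u k B₀ B₂ x y := by
  have h1 : 0 ≤ max (u x - k) 0 := le_max_right _ _
  unfold truncationGain
  split_ifs <;> positivity

/-- Four cases, by the sides of the level `k` on which the two values lie. Two values below are
unchanged. Values on opposite sides come closer, which gives the gain; it is recorded only for `x`
above and `y` below, and discarded in the mirrored case. Two values above cost an error: the slope
of the cutoff if both points lie in `B₂`, a tail-like product if one lies in `B₁` and the other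
outside `B₂`. -/
theorem truncation_pointwise (hp : 1 < p) {u ζ : X → ℝ} {k : ℝ} {B₀ B₁ B₂ : Set X}
    (h12 : B₁ ⊆ B₂) (hζ0 : ∀ x, 0 ≤ ζ x) (hζ1 : ∀ x, ζ x ≤ 1)
    (hζB₀ : ∀ x ∈ B₀, ζ x = 1) (hζB₁ : ∀ x, x ∉ B₁ → ζ x = 0) (x y : X) :
    |(u x + -(ζ x ^ p * max (u x - k) 0)) - (u y + -(ζ y ^ p * max (u y - k) 0))| ^ p +
        truncationGain p u k B₀ B₂ x y ≤
      |u x - u y| ^ p + (truncationError p u ζ k B₁ B₂ x y + truncationError p u ζ k B₁ B₂ y x) := by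
  have hp0 : 0 < p := by linarith
  have hE1 := truncationError_nonneg hp u ζ k B₁ B₂ x y
  have hE2 := truncationError_nonneg hp u ζ k B₁ B₂ y x
  have hη0 : ∀ x, 0 ≤ ζ x ^ p := fun x => Real.rpow_nonneg (hζ0 x) _
  have hη1 : ∀ x, ζ x ^ p ≤ 1 := fun x => Real.rpow_le_one (hζ0 x) (hζ1 x) hp0.le
  rcases le_or_gt (u x) k with hx | hx <;> rcases le_or_gt (u y) k with hy | hy
  · have ex : max (u x - k) 0 = 0 := max_eq_right (by linarith)
    have ey : max (u y - k) 0 = 0 := max_eq_right (by linarith)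
    have hG : truncationGain p u k B₀ B₂ x y = 0 := by simp [truncationGain, ex]
    rw [hG, ex, ey]
    simp only [mul_zero, neg_zero, add_zero]
    linarith
  · have ex : max (u x - k) 0 = 0 := max_eq_right (by linarith)
    have ey : max (u y - k) 0 = u y - k := max_eq_left (by linarith)
    have hG : truncationGain p u k B₀ B₂ x y = 0 := by simp [truncationGain, ex]
    have key := add_rpow_gain hp (a := u y - k) (b := k - u x) (by linarith) (by linarith)
      (hη0 y) (hη1 y)
    have : 0 ≤ ζ y ^ p * ((u y - k) * max (u y - k) (k - u x) ^ (p - 1)) := by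
      have := hη0 y
      have h3 : 0 ≤ u y - k := by linarith
      have : 0 ≤ max (u y - k) (k - u x) := h3.trans (le_max_left _ _)
      positivity
    rw [hG, ex, ey, abs_sub_comm, abs_sub_comm (u x), abs_of_nonneg (a := u y - u x) (by linarith),
      abs_of_nonneg (by nlinarith [hη1 y])]
    have e1 : u y + -(ζ y ^ p * (u y - k)) - (u x + -(ζ x ^ p * 0)) =
      (1 - ζ y ^ p) * (u y - k) + (k - u x) := by ring
    have e2 : u y - u x = (u y - k) + (k - u x) := by ring
    rw [e1, e2]
    linarith
  · have ex : max (u x - k) 0 = u x - k := max_eq_left (by linarith)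
    have ey : max (u y - k) 0 = 0 := max_eq_right (by linarith)
    have ey' : max (k - u y) 0 = k - u y := max_eq_left (by linarith)
    have key := add_rpow_gain hp (a := u x - k) (b := k - u y) (by linarith) (by linarith)
      (hη0 x) (hη1 x)
    have hpos : 0 ≤ (u x - k) * max (u x - k) (k - u y) ^ (p - 1) := by
      have h3 : 0 ≤ u x - k := by linarith
      have : 0 ≤ max (u x - k) (k - u y) := h3.trans (le_max_left _ _)
      positivity
    have hG : truncationGain p u k B₀ B₂ x y ≤
        ζ x ^ p * ((u x - k) * max (u x - k) (k - u y) ^ (p - 1)) := by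
      unfold truncationGain
      split_ifs with h
      · rw [hζB₀ x h.1, ex, ey', Real.one_rpow, one_mul]
      · exact mul_nonneg (hη0 x) hpos
    rw [ex, ey, abs_of_nonneg (a := u x - u y) (by linarith),
      abs_of_nonneg (by nlinarith [hη1 x])]
    have e1 : u x + -(ζ x ^ p * (u x - k)) - (u y + -(ζ y ^ p * 0)) =
      (1 - ζ x ^ p) * (u x - k) + (k - u y) := by ring
    have e2 : u x - u y = (u x - k) + (k - u y) := by ring
    rw [e1, e2]
    linarith
  · have ex : max (u x - k) 0 = u x - k := max_eq_left (by linarith)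
    have ey : max (u y - k) 0 = u y - k := max_eq_left (by linarith)
    have hax : 0 ≤ u x - k := by linarith
    have hay : 0 ≤ u y - k := by linarith
    have hG : truncationGain p u k B₀ B₂ x y = 0 := by
      simp [truncationGain, hy]
    have e1 : u x + -(ζ x ^ p * (u x - k)) - (u y + -(ζ y ^ p * (u y - k))) =
      (1 - ζ x ^ p) * (u x - k) - (1 - ζ y ^ p) * (u y - k) := by ring
    have e2 : u x - u y = (u x - k) - (u y - k) := by ring
    rw [hG, ex, ey, e1, e2, add_zero]
    by_cases hx2 : x ∈ B₂ <;> by_cases hy2 : y ∈ B₂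
    · have := abs_truncation_sub_rpow_le hp hax hay (hζ0 x) (hζ1 x) (hζ0 y) (hζ1 y)
      simpa [truncationError, hx2, hy2, ex, ey] using this
    · have hζy : ζ y = 0 := hζB₁ y fun h => hy2 (h12 h)
      by_cases hx1 : x ∈ B₁
      · have := abs_truncation_far_rpow_le hp hax hay (hη0 x) (hη1 x)
        simpa [truncationError, hx2, hy2, ex, ey, hx1, hζy, Real.zero_rpow hp0.ne'] using this
      · rw [hζy, hζB₁ x hx1, Real.zero_rpow hp0.ne']
        simp only [sub_zero, one_mul]
        linarith
    · have hζx : ζ x = 0 := hζB₁ x fun h => hx2 (h12 h)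
      by_cases hy1 : y ∈ B₁
      · have := abs_truncation_far_rpow_le hp hay hax (hη0 y) (hη1 y)
        rw [abs_sub_comm, abs_sub_comm (u y - k)] at this
        simpa [truncationError, hx2, hy2, ex, ey, hy1, hζx, Real.zero_rpow hp0.ne'] using this
      · rw [hζx, hζB₁ y hy1, Real.zero_rpow hp0.ne']
        simp only [sub_zero, one_mul]
        linarith
    · rw [hζB₁ x fun h => hx2 (h12 h), hζB₁ y fun h => hy2 (h12 h), Real.zero_rpow hp0.ne']
      simp only [sub_zero, one_mul]
      linarith

end Pointwise

/-! ### Comparison of energies, and kernel bounds. -/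

section Comparison

variable {n : ℕ} {s p Λ : ℝ} {Ω : Set (Rn n)} {K : Rn n → Rn n → ℝ} {F : Rn n → ℝ → ℝ} {F₀ : ℝ}
  {u φ : Rn n → ℝ}

/-- Moves the finite potential terms across the inequality without assuming that either interaction
term is finite: `a = ⊤` forces `b = ⊤`. -/
theorem ereal_add_le_cancel {a b : ℝ≥0∞} {f g t : ℝ} (ht : 0 ≤ t) (hgf : g - f ≤ t)
    (h : (a : EReal) + (f : EReal) ≤ (b : EReal) + (g : EReal)) : a ≤ b + ENNReal.ofReal t := by
  by_cases hb : b = ⊤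
  · simp [hb]
  by_cases ha : a = ⊤
  · exfalso
    lift b to NNReal using hb
    subst ha
    rw [EReal.coe_ennreal_top, EReal.top_add_coe, top_le_iff] at h
    have : ((b : ℝ≥0∞) : EReal) + (g : EReal) = (((b : ℝ) + g : ℝ) : EReal) := by
      rw [EReal.coe_add]; rfl
    rw [this] at h
    exact EReal.coe_ne_top _ h
  lift a to NNReal using ha
  lift b to NNReal using hb
  have h1 : ((a : ℝ≥0∞) : EReal) + (f : EReal) = (((a : ℝ) + f : ℝ) : EReal) := by
    rw [EReal.coe_add]; rfl
  have h2 : ((b : ℝ≥0∞) : EReal) + (g : EReal) = (((b : ℝ) + g : ℝ) : EReal) := by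
    rw [EReal.coe_add]; rfl
  rw [h1, h2, EReal.coe_le_coe_iff] at h
  rw [← ENNReal.ofReal_coe_nnreal, ← ENNReal.ofReal_coe_nnreal,
    ← ENNReal.ofReal_add (by positivity) ht]
  exact ENNReal.ofReal_le_ofReal (by linarith)

theorem integrableOn_potential (hb : Bornology.IsBounded Ω)
    (hF : SuperpositionMeasurable Ω F)
    (hFb : ∀ᵐ x ∂(volume.restrict Ω), ∀ t : ℝ, |F x t| ≤ F₀) (hu : Measurable u) :
    IntegrableOn (fun x => F x (u x)) Ω := by
  refine IntegrableOn.of_bound hb.measure_lt_top (hF u hu).aestronglyMeasurable F₀ ?_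
  filter_upwards [hFb] with x hx
  exact hx _

/-- Comparison of the interaction energies of a minimizer and a competitor. -/
theorem IsMinimizer.interaction_le (hp : 1 < p) (hb : Bornology.IsBounded Ω)
    (hF : SuperpositionMeasurable Ω F) (hF₀ : 0 ≤ F₀)
    (hFb : ∀ᵐ x ∂(volume.restrict Ω), ∀ t : ℝ, |F x t| ≤ F₀) (hu : Measurable u)
    (hmin : IsMinimizer s p K F Ω u) (hφ : Measurable φ) (hsupp : tsupport φ ⊆ Ω)
    {S : Set (Rn n)} (hS : MeasurableSet S) (hSfin : volume S ≠ ∞) (hφS : ∀ x, x ∉ S → φ x = 0) :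
    ∫⁻ z in crossSet Ω, ENNReal.ofReal (|u z.1 - u z.2| ^ p * K z.1 z.2) ≤
      (∫⁻ z in crossSet Ω,
        ENNReal.ofReal (|(u z.1 + φ z.1) - (u z.2 + φ z.2)| ^ p * K z.1 z.2)) +
      ENNReal.ofReal (4 * p * F₀) * volume S := by
  have hp0 : 0 < p := by linarith
  have hf := integrableOn_potential hb hF hFb hu
  have hg : IntegrableOn (fun x => F x (u x + φ x)) Ω :=
    integrableOn_potential hb hF hFb (hu.add hφ)
  -- The integrands agree off `S` and differ by at most `2 F₀` on it; the regularity of `F` in its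
  -- second variable plays no role. Multiplication by `2p` below, which normalizes the interaction
  -- term, turns `2 F₀` into `4 p F₀`.
  have hdiff : (∫ x in Ω, F x (u x + φ x)) - ∫ x in Ω, F x (u x) ≤
      2 * F₀ * (volume S).toReal := by
    rw [← integral_sub hg hf]
    have hSi : Integrable (S.indicator fun _ => 2 * F₀) (volume : Measure (Rn n)) :=
      (integrable_indicator_iff hS).2 (integrableOn_const hSfin)
    calc ∫ x in Ω, (F x (u x + φ x) - F x (u x)) ≤ ∫ x in Ω, S.indicator (fun _ => 2 * F₀) x := by
          refine integral_mono_ae (hg.sub hf) hSi.integrableOn ?_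
          filter_upwards [hFb] with x hx
          by_cases hxS : x ∈ S
          · rw [indicator_of_mem hxS]
            have h1 := abs_le.1 (hx (u x + φ x))
            have h2 := abs_le.1 (hx (u x))
            linarith [h1.2, h2.1]
          · simp [indicator_of_notMem hxS, hφS x hxS]
      _ ≤ ∫ x, S.indicator (fun _ => 2 * F₀) x :=
          setIntegral_le_integral hSi (ae_of_all _ fun x => indicator_nonneg (by intros; positivity) x)
      _ = _ := by
          rw [integral_indicator hS, setIntegral_const, smul_eq_mul, mul_comm, measureReal_def]
  have h1 := ereal_add_le_cancel (by positivity) hdiff (hmin.2 φ hφ.aemeasurable hsupp)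
  have h2 : ∀ a : ℝ≥0∞, ENNReal.ofReal (2 * p) * (ENNReal.ofReal (1 / (2 * p)) * a) = a := by
    intro a
    rw [← mul_assoc, ← ENNReal.ofReal_mul (by positivity), mul_one_div_cancel (by positivity)]
    simp
  calc _ = ENNReal.ofReal (2 * p) * (ENNReal.ofReal (1 / (2 * p)) *
        ∫⁻ z in crossSet Ω, ENNReal.ofReal (|u z.1 - u z.2| ^ p * K z.1 z.2)) := (h2 _).symm
    _ ≤ _ := by
      refine (mul_le_mul' le_rfl h1).trans_eq ?_
      rw [mul_add, h2, ← ENNReal.ofReal_mul (by positivity)]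
      congr 1
      rw [← mul_assoc, ENNReal.ofReal_mul (by positivity), ENNReal.ofReal_toReal hSfin]
      congr 2
      ring

/-- With values in `[0, ∞]` the kernel `‖0‖ₑ ^ (-E)` is infinite on the diagonal, whereas the real
quotient there is 0 by convention; hence the condition that `g` vanish on the diagonal. -/
theorem IsAdmissibleKernel.lower_enorm (hΛ : 1 ≤ Λ) (hK : IsAdmissibleKernel n s p Λ K) :
    ∀ᵐ z : Rn n × Rn n, ∀ g : ℝ, 0 ≤ g → (z.1 = z.2 → g = 0) →
      ENNReal.ofReal (1 / Λ) * (ENNReal.ofReal g * ‖z.1 - z.2‖ₑ ^ (-((n : ℝ) + s * p))) ≤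
        ENNReal.ofReal (g * K z.1 z.2) := by
  filter_upwards [hK.lower] with z hz g hg hzg
  by_cases h : z.1 = z.2
  · simp [hzg h]
  · have hpos : 0 < ‖z.1 - z.2‖ := norm_pos_iff.2 (sub_ne_zero.2 h)
    have hΛ0 : 0 < Λ := by linarith
    rw [enorm_rpow_eq hpos, ← ENNReal.ofReal_mul hg, ← ENNReal.ofReal_mul (by positivity)]
    refine ENNReal.ofReal_le_ofReal ?_
    calc _ = g * (1 / (Λ * ‖z.1 - z.2‖ ^ ((n : ℝ) + s * p))) := by
          rw [Real.rpow_neg hpos.le]; field_simp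
      _ ≤ _ := by gcongr

theorem IsAdmissibleKernel.upper_enorm (hs : 0 < s) (hp : 0 < p) (hΛ : 1 ≤ Λ)
    (hK : IsAdmissibleKernel n s p Λ K) :
    ∀ᵐ z : Rn n × Rn n, ∀ g : ℝ, 0 ≤ g → ENNReal.ofReal (g * K z.1 z.2) ≤
      ENNReal.ofReal Λ * (ENNReal.ofReal g * ‖z.1 - z.2‖ₑ ^ (-((n : ℝ) + s * p))) := by
  filter_upwards [hK.upper] with z hz g hg
  have hE : 0 < (n : ℝ) + s * p := by positivity
  by_cases h : z.1 = z.2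
  · rw [h, sub_self, norm_zero, Real.zero_rpow hE.ne', div_zero, ] at hz
    rw [h, ENNReal.ofReal_of_nonpos (mul_nonpos_of_nonneg_of_nonpos hg hz)]
    exact bot_le
  · have hpos : 0 < ‖z.1 - z.2‖ := norm_pos_iff.2 (sub_ne_zero.2 h)
    have hΛ0 : 0 < Λ := by linarith
    rw [enorm_rpow_eq hpos, ← ENNReal.ofReal_mul hg, ← ENNReal.ofReal_mul (by positivity)]
    refine ENNReal.ofReal_le_ofReal ?_
    calc _ ≤ g * (Λ / ‖z.1 - z.2‖ ^ ((n : ℝ) + s * p)) := by gcongr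
      _ = _ := by
          rw [Real.rpow_neg hpos.le]; field_simp

theorem IsMinimizer.interaction_lt_top (hΛ : 1 ≤ Λ)
    (hK : IsAdmissibleKernel n s p Λ K) (hmin : IsMinimizer s p K F Ω u) :
    ∫⁻ z in crossSet Ω, ENNReal.ofReal (|u z.1 - u z.2| ^ p * K z.1 z.2) < ∞ := by
  have hΛ0 : 0 < Λ := by linarith
  calc _ ≤ ∫⁻ z in crossSet Ω, ENNReal.ofReal Λ *
        ENNReal.ofReal (|u z.1 - u z.2| ^ p / ‖z.1 - z.2‖ ^ ((n : ℝ) + s * p)) := by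
        refine lintegral_mono_ae (ae_restrict_of_ae ?_)
        filter_upwards [hK.upper] with z hz
        rw [← ENNReal.ofReal_mul hΛ0.le]
        refine ENNReal.ofReal_le_ofReal ?_
        calc _ ≤ |u z.1 - u z.2| ^ p * (Λ / ‖z.1 - z.2‖ ^ ((n : ℝ) + s * p)) := by gcongr
          _ = _ := by ring
    _ < ∞ := by
        rw [lintegral_const_mul' _ _ ENNReal.ofReal_ne_top]
        exact ENNReal.mul_lt_top ENNReal.ofReal_lt_top hmin.1.2.2

end Comparison

/-! ### The cutoff function. -/

section Cutoff

variable {n : ℕ}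

/-- A radial Lipschitz cutoff between the balls of radii `r` and `(r + R) / 2`. -/
noncomputable def cutoff (x₀ : Rn n) (r R : ℝ) (x : Rn n) : ℝ :=
  max 0 (min 1 ((r + R - 2 * ‖x - x₀‖) / (R - r)))

theorem cutoff_nonneg (x₀ : Rn n) (r R : ℝ) (x : Rn n) : 0 ≤ cutoff x₀ r R x := le_max_left _ _

theorem cutoff_le_one (x₀ : Rn n) (r R : ℝ) (x : Rn n) : cutoff x₀ r R x ≤ 1 :=
  max_le zero_le_one (min_le_left _ _)

theorem cutoff_eq_one {x₀ : Rn n} {r R : ℝ} (hrR : r < R) {x : Rn n} (hx : x ∈ Metric.ball x₀ r) :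
    cutoff x₀ r R x = 1 := by
  have h : ‖x - x₀‖ < r := by simpa [dist_eq_norm] using hx
  have : 1 ≤ (r + R - 2 * ‖x - x₀‖) / (R - r) := by
    rw [le_div_iff₀ (by linarith)]; linarith
  rw [cutoff, min_eq_left this, max_eq_right zero_le_one]

theorem cutoff_eq_zero {x₀ : Rn n} {r R : ℝ} (hrR : r < R) {x : Rn n}
    (hx : x ∉ Metric.ball x₀ ((r + R) / 2)) : cutoff x₀ r R x = 0 := by
  have h : (r + R) / 2 ≤ ‖x - x₀‖ := by simpa [dist_eq_norm] using hx
  have : (r + R - 2 * ‖x - x₀‖) / (R - r) ≤ 0 :=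
    div_nonpos_of_nonpos_of_nonneg (by linarith) (by linarith)
  rw [cutoff, min_eq_right (by linarith), max_eq_left this]

theorem abs_cutoff_sub_le {x₀ : Rn n} {r R : ℝ} (hrR : r < R) (x y : Rn n) :
    |cutoff x₀ r R x - cutoff x₀ r R y| ≤ 2 / (R - r) * ‖x - y‖ := by
  have hR : 0 < R - r := by linarith
  unfold cutoff
  rw [max_comm 0, max_comm 0]
  refine (abs_max_sub_max_le_abs _ _ _).trans ?_
  rw [min_comm 1, min_comm 1]
  refine (abs_min_sub_min_le_max _ _ _ _).trans ?_
  rw [sub_self, abs_zero, max_eq_left (abs_nonneg _), ← sub_div, abs_div, abs_of_pos hR,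
    div_mul_eq_mul_div]
  gcongr
  have h1 := abs_norm_sub_norm_le (y - x₀) (x - x₀)
  rw [sub_sub_sub_cancel_right, norm_sub_rev y x] at h1
  calc _ = |2 * (‖y - x₀‖ - ‖x - x₀‖)| := by congr 1; ring
    _ = 2 * |‖y - x₀‖ - ‖x - x₀‖| := by rw [abs_mul, abs_two]
    _ ≤ _ := by gcongr

theorem continuous_cutoff (x₀ : Rn n) (r R : ℝ) : Continuous (cutoff x₀ r R) := by
  unfold cutoff
  fun_prop

end Cutoff

/-! ### Integrals of the comparison error. -/

theorem ofReal_max_zero (a : ℝ) : ENNReal.ofReal (max a 0) = ENNReal.ofReal a := by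
  rcases le_total a 0 with h | h
  · rw [max_eq_right h, ENNReal.ofReal_zero, ENNReal.ofReal_of_nonpos h]
  · rw [max_eq_left h]

section ErrorIntegral

variable {n : ℕ} {s p : ℝ}

theorem measurable_truncationError {u ζ : Rn n → ℝ} (hu : Measurable u) (hζ : Measurable ζ) {k : ℝ}
    {B₁ B₂ : Set (Rn n)} (h1 : MeasurableSet B₁) (h2 : MeasurableSet B₂) :
    Measurable fun z : Rn n × Rn n => truncationError p u ζ k B₁ B₂ z.1 z.2 := by
  unfold truncationError
  refine Measurable.add ?_ ?_
  · exact Measurable.ite ((measurable_fst h2).inter (measurable_snd h2)) (by fun_prop)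
      measurable_const
  · exact Measurable.ite ((measurable_fst h1).inter (measurable_snd h2).compl) (by fun_prop)
      measurable_const

theorem measurable_truncationGain {u : Rn n → ℝ} (hu : Measurable u) {k : ℝ}
    {B₀ B₂ : Set (Rn n)} (h0 : MeasurableSet B₀) (h2 : MeasurableSet B₂) :
    Measurable fun z : Rn n × Rn n => truncationGain p u k B₀ B₂ z.1 z.2 := by
  unfold truncationGain
  refine Measurable.ite ?_ (by fun_prop) measurable_const
  exact (measurable_fst h0).inter ((measurable_snd h2).inter
    (measurable_snd (measurableSet_le hu measurable_const)))

/-- The inner integral of the error, at a point of the larger ball. -/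
theorem lintegral_truncationError_le (hs : 0 < s) (hp : 1 < p) {C₁ : ℝ}
    (hC₁ : ∀ (x : Rn n) (ρ : ℝ), 0 < ρ →
      ∫⁻ y in Metric.ball x ρ, ‖y - x‖ₑ ^ (p - ((n : ℝ) + s * p)) ≤
        ENNReal.ofReal (C₁ * ρ ^ (p - s * p)))
    (u : Rn n → ℝ) (k : ℝ) {x₀ : Rn n} {r R : ℝ} (hr : 0 < r) (hrR : r < R)
    {x : Rn n} (hx : x ∈ Metric.ball x₀ R) :
    ∫⁻ y, ENNReal.ofReal (truncationError p u (cutoff x₀ r R) k (Metric.ball x₀ ((r + R) / 2))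
        (Metric.ball x₀ R) x y) * ‖x - y‖ₑ ^ (-((n : ℝ) + s * p)) ≤
      ENNReal.ofReal (p ^ p * (2 / (R - r)) ^ p * (C₁ * (2 * R) ^ (p - s * p))) *
          ENNReal.ofReal (u x - k) ^ p +
        ENNReal.ofReal (p * (2 * R / (R - r)) ^ ((n : ℝ) + s * p) * R ^ (-(s * p))) *
          weightedTail n s p (fun y => ENNReal.ofReal (u y - k)) x₀ R *
          ENNReal.ofReal (u x - k) := by
  have hp0 : 0 < p := by linarith
  have hp1 : 0 < p - 1 := by linarith
  have hR : 0 < R := hr.trans hrR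
  have hRr : 0 < R - r := by linarith
  have hsp : 0 < s * p := by positivity
  have hw : 0 ≤ max (u x - k) 0 := le_max_right _ _
  set E : ℝ := (n : ℝ) + s * p with hE
  have hE0 : 0 < E := by positivity
  rw [← lintegral_add_compl _ (measurableSet_ball (x := x₀) (ε := R))]
  refine add_le_add ?_ ?_
  -- Near pairs: the Lipschitz bound of the cutoff contributes `‖y - x‖ ^ p`, which makes the
  -- singular kernel integrable.
  · calc _ ≤ ∫⁻ y in Metric.ball x₀ R, (ENNReal.ofReal (p ^ p * (2 / (R - r)) ^ p) *
          ENNReal.ofReal (u x - k) ^ p) * ‖y - x‖ₑ ^ (p - E) := by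
          refine setLIntegral_mono' measurableSet_ball fun y hy => ?_
          have he : truncationError p u (cutoff x₀ r R) k (Metric.ball x₀ ((r + R) / 2))
              (Metric.ball x₀ R) x y ≤
              p ^ p * (2 / (R - r)) ^ p * max (u x - k) 0 ^ p * ‖y - x‖ ^ p := by
            have h1 : |cutoff x₀ r R x - cutoff x₀ r R y| ^ p ≤ (2 / (R - r)) ^ p * ‖y - x‖ ^ p := by
              rw [← Real.mul_rpow (by positivity) (norm_nonneg _), norm_sub_rev]
              gcongr
              exact abs_cutoff_sub_le hrR x y
            simp only [truncationError, hx, hy, and_self, if_true, not_true_eq_false, and_false,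
              if_false, add_zero]
            calc _ ≤ p ^ p * max (u x - k) 0 ^ p * ((2 / (R - r)) ^ p * ‖y - x‖ ^ p) := by gcongr
              _ = _ := by ring
          -- At `y = x` the kernel is infinite, but the error vanishes.
          rcases eq_or_ne y x with h | h
          · subst h
            rw [sub_self, norm_zero, Real.zero_rpow hp0.ne', mul_zero] at he
            simp [ENNReal.ofReal_of_nonpos he]
          · have hpos : 0 < ‖y - x‖ := norm_pos_iff.2 (sub_ne_zero.2 h)
            rw [← enorm_sub_rev y x, enorm_rpow_eq hpos, enorm_rpow_eq hpos, ← ofReal_max_zero (u x - k),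
              ENNReal.ofReal_rpow_of_nonneg hw hp0.le,
              ← ENNReal.ofReal_mul (truncationError_nonneg hp _ _ _ _ _ _ _),
              ← ENNReal.ofReal_mul (p := p ^ p * (2 / (R - r)) ^ p) (by positivity),
              ← ENNReal.ofReal_mul (by positivity)]
            refine ENNReal.ofReal_le_ofReal ((mul_le_mul_of_nonneg_right he (by positivity)).trans_eq ?_)
            rw [sub_eq_add_neg p, Real.rpow_add hpos]
            ring
      _ ≤ ∫⁻ y in Metric.ball x (2 * R), (ENNReal.ofReal (p ^ p * (2 / (R - r)) ^ p) *
          ENNReal.ofReal (u x - k) ^ p) * ‖y - x‖ₑ ^ (p - E) := by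
          refine lintegral_mono_set fun y hy => ?_
          rw [Metric.mem_ball] at *
          have := dist_triangle_right y x x₀
          linarith
      _ ≤ _ := by
          rw [lintegral_const_mul _ (by fun_prop)]
          refine (mul_le_mul' le_rfl (hC₁ x (2 * R) (by positivity))).trans_eq ?_
          rw [ENNReal.ofReal_mul (p := p ^ p * (2 / (R - r)) ^ p) (by positivity)]
          ring
  · have htail : ENNReal.ofReal (R ^ (-(s * p))) *
        weightedTail n s p (fun y => ENNReal.ofReal (u y - k)) x₀ R =
        ∫⁻ y in (Metric.ball x₀ R)ᶜ, ENNReal.ofReal (u y - k) ^ (p - 1) * ‖y - x₀‖ₑ ^ (-E) := by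
      rw [weightedTail, ← mul_assoc, ← ENNReal.ofReal_mul (by positivity),
        ← Real.rpow_add hR, neg_add_cancel, Real.rpow_zero, ENNReal.ofReal_one, one_mul]
    calc _ ≤ ∫⁻ y in (Metric.ball x₀ R)ᶜ, (ENNReal.ofReal (p * (2 * R / (R - r)) ^ E) *
          ENNReal.ofReal (u x - k)) * (ENNReal.ofReal (u y - k) ^ (p - 1) * ‖y - x₀‖ₑ ^ (-E)) := by
          refine setLIntegral_mono' measurableSet_ball.compl fun y hy => ?_
          have hy' : y ∉ Metric.ball x₀ R := hy
          have hy0 : R ≤ ‖y - x₀‖ := by simpa [dist_eq_norm] using hy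
          have hpos : 0 < ‖y - x₀‖ := hR.trans_le hy0
          have hwy : 0 ≤ max (u y - k) 0 := le_max_right _ _
          by_cases hx1 : x ∈ Metric.ball x₀ ((r + R) / 2)
          · have hxn : ‖x - x₀‖ < (r + R) / 2 := by simpa [dist_eq_norm] using hx1
            have htri : ‖y - x₀‖ ≤ ‖x - y‖ + ‖x - x₀‖ := by
              have := norm_sub_le (x - x₀) (x - y)
              rw [sub_sub_sub_cancel_left] at this
              linarith
            -- Far pairs: `ζ` vanishes beyond radius `(r + R) / 2`, so `x` stays at distance at
            -- least `(R - r) / 2` from the exterior of the large ball, and the kernel at `x` is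
            -- comparable with the one at the centre.
            have hxy : ‖y - x₀‖ ≤ 2 * R / (R - r) * ‖x - y‖ := by
              rw [div_mul_eq_mul_div, le_div_iff₀ hRr]
              nlinarith
            have hxy0 : 0 < ‖x - y‖ := by linarith
            simp only [truncationError, hx, hy', hx1, and_false, if_false, not_false_eq_true,
              and_self, if_true, zero_add]
            rw [enorm_rpow_eq hpos, enorm_rpow_eq hxy0, ← ofReal_max_zero (u x - k),
              ← ofReal_max_zero (u y - k), ENNReal.ofReal_rpow_of_nonneg hwy hp1.le,
              ← ENNReal.ofReal_mul (by positivity), ← ENNReal.ofReal_mul (by positivity),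
              ← ENNReal.ofReal_mul (by positivity), ← ENNReal.ofReal_mul (by positivity)]
            refine ENNReal.ofReal_le_ofReal ?_
            have hk : ‖x - y‖ ^ (-E) ≤ (2 * R / (R - r)) ^ E * ‖y - x₀‖ ^ (-E) := by
              rw [Real.rpow_neg hxy0.le, Real.rpow_neg hpos.le, ← div_eq_mul_inv, inv_eq_one_div,
                div_le_div_iff₀ (by positivity) (by positivity), one_mul,
                ← Real.mul_rpow (by positivity) hxy0.le]
              exact Real.rpow_le_rpow hpos.le hxy hE0.le
            calc _ ≤ p * (max (u x - k) 0 * max (u y - k) 0 ^ (p - 1)) *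
                  ((2 * R / (R - r)) ^ E * ‖y - x₀‖ ^ (-E)) := by gcongr
              _ = _ := by ring
          · simp [truncationError, hy', hx1]
      _ = _ := by
          rw [lintegral_const_mul' _ _ (ENNReal.mul_ne_top ENNReal.ofReal_ne_top
            ENNReal.ofReal_ne_top), ← htail, ENNReal.ofReal_mul (q := R ^ (-(s * p))) (by positivity)]
          ring

end ErrorIntegral

/-! ### The De Giorgi class and the Caccioppoli inequality for minimizers. -/

/-- The fractional De Giorgi class: Caccioppoli inequalities with tails for the truncations
`(u - k)₊` on all balls in `U`. -/
def IsDeGiorgi (n : ℕ) (s p A F₀ : ℝ) (U : Set (Rn n)) (u : Rn n → ℝ) : Prop :=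
  ∀ (x₀ : Rn n) (r R k : ℝ), 0 < r → r < R → Metric.closedBall x₀ R ⊆ U →
    ∫⁻ x in Metric.ball x₀ r, ∫⁻ y in Metric.ball x₀ R ∩ {y | u y ≤ k},
        ENNReal.ofReal (u x - k) * max (ENNReal.ofReal (u x - k)) (ENNReal.ofReal (k - u y)) ^ (p - 1) *
          ‖x - y‖ₑ ^ (-((n : ℝ) + s * p)) ≤
      ENNReal.ofReal (A * (R / (R - r)) ^ ((n : ℝ) + s * p + p) * R ^ (-(s * p))) *
        ((∫⁻ x in Metric.ball x₀ R, ENNReal.ofReal (u x - k) ^ p) +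
          weightedTail n s p (fun y => ENNReal.ofReal (u y - k)) x₀ R *
            (∫⁻ x in Metric.ball x₀ R, ENNReal.ofReal (u x - k)) +
          ENNReal.ofReal (F₀ * R ^ (s * p)) * volume (Metric.ball x₀ R ∩ {x | k < u x}))

section Caccioppoli

variable {n : ℕ} {s p Λ : ℝ} {Ω : Set (Rn n)} {K : Rn n → Rn n → ℝ} {F : Rn n → ℝ → ℝ} {F₀ : ℝ}
  {u φ : Rn n → ℝ}

theorem lintegral_gain_ge (hp : 1 < p) (hu : Measurable u) (k : ℝ) {x₀ : Rn n} {r R : ℝ} :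
    ∫⁻ x in Metric.ball x₀ r, ∫⁻ y in Metric.ball x₀ R ∩ {y | u y ≤ k},
        ENNReal.ofReal (u x - k) * max (ENNReal.ofReal (u x - k)) (ENNReal.ofReal (k - u y)) ^ (p - 1) *
          ‖x - y‖ₑ ^ (-((n : ℝ) + s * p)) ≤
      ∫⁻ z : Rn n × Rn n, ENNReal.ofReal (truncationGain p u k (Metric.ball x₀ r) (Metric.ball x₀ R)
        z.1 z.2) * ‖z.1 - z.2‖ₑ ^ (-((n : ℝ) + s * p)) := by
  have hp1 : 0 < p - 1 := by linarith
  have hm := measurable_truncationGain (p := p) hu (k := k) (measurableSet_ball (x := x₀) (ε := r))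
    (measurableSet_ball (x := x₀) (ε := R))
  rw [Measure.volume_eq_prod, lintegral_prod _ (by fun_prop)]
  refine le_trans (setLIntegral_mono' measurableSet_ball fun x hx => ?_)
    (setLIntegral_le_lintegral (Metric.ball x₀ r) _)
  refine le_trans (setLIntegral_mono' (measurableSet_ball.inter
    (measurableSet_le hu measurable_const)) fun y hy => ?_) (setLIntegral_le_lintegral _ _)
  have h1 : 0 ≤ max (u x - k) 0 := le_max_right _ _
  have h2 : 0 ≤ max (max (u x - k) 0) (max (k - u y) 0) := h1.trans (le_max_left _ _)
  have hy2 : u y ≤ k := hy.2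
  simp only [truncationGain, hx, hy.1, hy2, and_self, if_true]
  rw [ENNReal.ofReal_mul h1, ← ENNReal.ofReal_rpow_of_nonneg h2 hp1.le,
    ENNReal.ofReal_max (max (u x - k) 0),
    ofReal_max_zero, ofReal_max_zero]

theorem lintegral_error_le (hs : 0 < s) (hp : 1 < p) {C₁ : ℝ}
    (hC₁ : ∀ (x : Rn n) (ρ : ℝ), 0 < ρ →
      ∫⁻ y in Metric.ball x ρ, ‖y - x‖ₑ ^ (p - ((n : ℝ) + s * p)) ≤
        ENNReal.ofReal (C₁ * ρ ^ (p - s * p)))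
    (hu : Measurable u) (k : ℝ) {x₀ : Rn n} {r R : ℝ} (hr : 0 < r) (hrR : r < R) :
    ∫⁻ x, ∫⁻ y, ENNReal.ofReal (truncationError p u (cutoff x₀ r R) k
        (Metric.ball x₀ ((r + R) / 2)) (Metric.ball x₀ R) x y) *
          ‖x - y‖ₑ ^ (-((n : ℝ) + s * p)) ≤
      ENNReal.ofReal (p ^ p * (2 / (R - r)) ^ p * (C₁ * (2 * R) ^ (p - s * p))) *
          (∫⁻ x in Metric.ball x₀ R, ENNReal.ofReal (u x - k) ^ p) +
        ENNReal.ofReal (p * (2 * R / (R - r)) ^ ((n : ℝ) + s * p) * R ^ (-(s * p))) *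
          weightedTail n s p (fun y => ENNReal.ofReal (u y - k)) x₀ R *
          ∫⁻ x in Metric.ball x₀ R, ENNReal.ofReal (u x - k) := by
  have hball : Metric.ball x₀ ((r + R) / 2) ⊆ Metric.ball x₀ R :=
    Metric.ball_subset_ball (by linarith)
  rw [← lintegral_const_mul _ (by fun_prop), ← lintegral_const_mul _ (by fun_prop),
    ← lintegral_add_left (by fun_prop), ← lintegral_indicator measurableSet_ball]
  refine lintegral_mono fun x => ?_
  by_cases hx : x ∈ Metric.ball x₀ R
  · rw [indicator_of_mem hx]
    exact lintegral_truncationError_le hs hp hC₁ u k hr hrR hx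
  · rw [indicator_of_notMem hx]
    have hx1 : x ∉ Metric.ball x₀ ((r + R) / 2) := fun h => hx (hball h)
    simp [truncationError, hx, hx1]

/-- Tonelli in both orders: the error bound is proved with `x` as the outer variable, and the kernel
is symmetric. -/
theorem lintegral_symmetrize {e : Rn n → Rn n → ℝ} (he0 : ∀ x y, 0 ≤ e x y)
    (hm : Measurable fun z : Rn n × Rn n => e z.1 z.2) (a : ℝ) :
    ∫⁻ z : Rn n × Rn n, ENNReal.ofReal (e z.1 z.2 + e z.2 z.1) * ‖z.1 - z.2‖ₑ ^ a =
      2 * ∫⁻ x, ∫⁻ y, ENNReal.ofReal (e x y) * ‖x - y‖ₑ ^ a := by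
  have hm' : Measurable fun z : Rn n × Rn n => e z.2 z.1 := hm.comp measurable_swap
  have h1 : ∀ z : Rn n × Rn n, ENNReal.ofReal (e z.1 z.2 + e z.2 z.1) * ‖z.1 - z.2‖ₑ ^ a =
      ENNReal.ofReal (e z.1 z.2) * ‖z.1 - z.2‖ₑ ^ a +
      ENNReal.ofReal (e z.2 z.1) * ‖z.1 - z.2‖ₑ ^ a := fun z => by
    rw [ENNReal.ofReal_add (he0 _ _) (he0 _ _), add_mul]
  have hn : Measurable fun z : Rn n × Rn n => ‖z.1 - z.2‖ₑ ^ a := by fun_prop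
  have hm1 : Measurable fun z : Rn n × Rn n =>
      ENNReal.ofReal (e z.1 z.2) * ‖z.1 - z.2‖ₑ ^ a := hm.ennreal_ofReal.mul hn
  have hm2 : Measurable fun z : Rn n × Rn n =>
      ENNReal.ofReal (e z.2 z.1) * ‖z.1 - z.2‖ₑ ^ a := hm'.ennreal_ofReal.mul hn
  rw [lintegral_congr h1, lintegral_add_left hm1, Measure.volume_eq_prod,
    lintegral_prod _ hm1.aemeasurable, lintegral_prod_symm _ hm2.aemeasurable, two_mul]
  congr 1
  refine lintegral_congr fun x => lintegral_congr fun y => ?_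
  simp only [enorm_sub_rev]

/-- A minimizer satisfies the Caccioppoli inequality, before simplification of the constants. -/
theorem IsMinimizer.caccioppoli_aux (hs : 0 < s) (hp : 1 < p) (hΛ : 1 ≤ Λ)
    (hb : Bornology.IsBounded Ω) (hΩ : IsOpen Ω) (hK : IsAdmissibleKernel n s p Λ K)
    (hF : SuperpositionMeasurable Ω F) (hF₀ : 0 ≤ F₀)
    (hFb : ∀ᵐ x ∂(volume.restrict Ω), ∀ t : ℝ, |F x t| ≤ F₀) (hu : Measurable u)
    (hmin : IsMinimizer s p K F Ω u) (k : ℝ) {x₀ : Rn n} {r R : ℝ} (hrR : r < R)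
    (hball : Metric.closedBall x₀ R ⊆ Ω) :
    ENNReal.ofReal (1 / Λ) * ∫⁻ z : Rn n × Rn n, ENNReal.ofReal (truncationGain p u k
        (Metric.ball x₀ r) (Metric.ball x₀ R) z.1 z.2) * ‖z.1 - z.2‖ₑ ^ (-((n : ℝ) + s * p)) ≤
      ENNReal.ofReal Λ * (2 * ∫⁻ x, ∫⁻ y, ENNReal.ofReal (truncationError p u (cutoff x₀ r R) k
        (Metric.ball x₀ ((r + R) / 2)) (Metric.ball x₀ R) x y) *
          ‖x - y‖ₑ ^ (-((n : ℝ) + s * p))) +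
      ENNReal.ofReal (4 * p * F₀) * volume (Metric.ball x₀ R ∩ {x | k < u x}) := by
  have hp0 : 0 < p := by linarith
  have hbs : Metric.ball x₀ ((r + R) / 2) ⊆ Metric.ball x₀ R :=
    Metric.ball_subset_ball (by linarith)
  have hζm := (continuous_cutoff x₀ r R).measurable
  set ζ := cutoff x₀ r R with hζ
  set S := Metric.ball x₀ R ∩ {x | k < u x} with hSdef
  have hSm : MeasurableSet S := measurableSet_ball.inter (measurableSet_lt measurable_const hu)
  have hSfin : volume S ≠ ∞ :=
    ((measure_mono inter_subset_left).trans_lt measure_ball_lt_top).ne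
  set φ : Rn n → ℝ := fun x => -(ζ x ^ p * max (u x - k) 0) with hφ
  have hφm : Measurable φ := by fun_prop
  have hφS : ∀ x, x ∉ S → φ x = 0 := by
    intro x hx
    by_cases hxR : x ∈ Metric.ball x₀ R
    · have : u x ≤ k := by
        by_contra h
        exact hx ⟨hxR, not_le.1 h⟩
      simp [hφ, this]
    · have : ζ x = 0 := cutoff_eq_zero hrR fun h => hxR (hbs h)
      simp [hφ, this, Real.zero_rpow hp0.ne']
  have hsupp : tsupport φ ⊆ Ω := by
    refine (closure_minimal ?_ Metric.isClosed_closedBall).trans hball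
    intro x hx
    by_contra h
    exact hx (hφS x fun hxS => h (Metric.ball_subset_closedBall hxS.1))
  have hcmp := hmin.interaction_le hp hb hF hF₀ hFb hu hφm hsupp hSm hSfin hφS
  have hfin := hmin.interaction_lt_top hΛ hK
  have hpt := fun x y => truncation_pointwise hp (u := u) (ζ := ζ) (k := k)
    (B₀ := Metric.ball x₀ r) hbs (cutoff_nonneg x₀ r R) (cutoff_le_one x₀ r R)
    (fun x hx => cutoff_eq_one hrR hx) (fun x hx => cutoff_eq_zero hrR hx) x y
  have hGm := measurable_truncationGain (p := p) hu (k := k)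
    (measurableSet_ball (x := x₀) (ε := r)) (measurableSet_ball (x := x₀) (ε := R))
  have hErm := measurable_truncationError (p := p) hu hζm (k := k)
    (measurableSet_ball (x := x₀) (ε := (r + R) / 2)) (measurableSet_ball (x := x₀) (ε := R))
  set G := truncationGain p u k (Metric.ball x₀ r) (Metric.ball x₀ R) with hG
  set Er := truncationError p u ζ k (Metric.ball x₀ ((r + R) / 2)) (Metric.ball x₀ R) with hEr
  have hEr0 : ∀ x y, 0 ≤ Er x y := truncationError_nonneg hp _ _ _ _ _
  have hG0 : ∀ x y, 0 ≤ G x y := truncationGain_nonneg _ _ _ _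
  have hsymm := lintegral_symmetrize hEr0 hErm (-((n : ℝ) + s * p))
  have hKm := hK.aemeasurable
  have hcross : MeasurableSet (crossSet Ω) :=
    (hΩ.measurableSet.compl.prod hΩ.measurableSet.compl).compl
  -- integrate the pointwise inequality
  have h1 : (∫⁻ z in crossSet Ω,
        ENNReal.ofReal (|(u z.1 + φ z.1) - (u z.2 + φ z.2)| ^ p * K z.1 z.2)) +
      ∫⁻ z in crossSet Ω, ENNReal.ofReal (G z.1 z.2 * K z.1 z.2) ≤
      (∫⁻ z in crossSet Ω, ENNReal.ofReal (|u z.1 - u z.2| ^ p * K z.1 z.2)) +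
      ∫⁻ z in crossSet Ω, ENNReal.ofReal ((Er z.1 z.2 + Er z.2 z.1) * K z.1 z.2) := by
    have hm1 : AEMeasurable (fun z : Rn n × Rn n =>
        ENNReal.ofReal (G z.1 z.2 * K z.1 z.2)) (volume.restrict (crossSet Ω)) :=
      (hGm.aemeasurable.mul hKm).ennreal_ofReal.restrict
    have hm2 : AEMeasurable (fun z : Rn n × Rn n =>
        ENNReal.ofReal (|u z.1 - u z.2| ^ p * K z.1 z.2)) (volume.restrict (crossSet Ω)) := by
      have : Measurable (fun z : Rn n × Rn n => |u z.1 - u z.2| ^ p) := by fun_prop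
      exact (this.aemeasurable.mul hKm).ennreal_ofReal.restrict
    rw [← lintegral_add_right' _ hm1, ← lintegral_add_left' hm2]
    refine lintegral_mono fun z => ?_
    have hK0 := hK.nonneg z.1 z.2
    have e1 := hEr0 z.1 z.2
    have e2 := hEr0 z.2 z.1
    have e3 := hG0 z.1 z.2
    simp only
    rw [← ENNReal.ofReal_add (by positivity) (by positivity),
      ← ENNReal.ofReal_add (by positivity) (by positivity), ← add_mul, ← add_mul]
    exact ENNReal.ofReal_le_ofReal (mul_le_mul_of_nonneg_right (hpt z.1 z.2) hK0)
  have h2 : ∫⁻ z in crossSet Ω, ENNReal.ofReal (G z.1 z.2 * K z.1 z.2) ≤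
      (∫⁻ z in crossSet Ω, ENNReal.ofReal ((Er z.1 z.2 + Er z.2 z.1) * K z.1 z.2)) +
      ENNReal.ofReal (4 * p * F₀) * volume S := by
    -- The interaction energy of `u` appears on both sides; it cancels because it is finite, by `u ∈
    -- 𝕎^{s,p}(Ω)` and the upper kernel bound.
    refine (ENNReal.add_le_add_iff_left hfin.ne).1 ?_
    calc _ ≤ _ := add_le_add hcmp le_rfl
      _ = _ := add_right_comm _ _ _
      _ ≤ _ := add_le_add h1 le_rfl
      _ = _ := add_assoc _ _ _
  have h3 : ENNReal.ofReal (1 / Λ) * ∫⁻ z : Rn n × Rn n, ENNReal.ofReal (G z.1 z.2) *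
      ‖z.1 - z.2‖ₑ ^ (-((n : ℝ) + s * p)) ≤
      ∫⁻ z in crossSet Ω, ENNReal.ofReal (G z.1 z.2 * K z.1 z.2) := by
    rw [← lintegral_add_compl _ hcross]
    -- Off the cross set the first point lies outside `Ω`, hence outside the ball of radius `r`, so
    -- the gain is zero.
    have : ∫⁻ z in (crossSet Ω)ᶜ, ENNReal.ofReal (G z.1 z.2) *
        ‖z.1 - z.2‖ₑ ^ (-((n : ℝ) + s * p)) = 0 := by
      rw [setLIntegral_eq_zero_iff hcross.compl (by fun_prop)]
      refine ae_of_all _ fun z hz => ?_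
      rw [crossSet, compl_compl] at hz
      have hz1 : z.1 ∉ Metric.ball x₀ r := fun h =>
        hz.1 (hball (Metric.ball_subset_closedBall (Metric.ball_subset_ball hrR.le h)))
      simp [hG, truncationGain, hz1]
    rw [this, add_zero, ← lintegral_const_mul' _ _ ENNReal.ofReal_ne_top]
    refine lintegral_mono_ae (ae_restrict_of_ae ?_)
    filter_upwards [hK.lower_enorm hΛ] with z hz
    -- The gain vanishes on the diagonal: there `u ≤ k` at the second point makes the excess at the
    -- first one zero.
    refine hz _ (hG0 _ _) fun h => ?_
    simp only [hG, truncationGain, h]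
    split_ifs with hc
    · rw [max_eq_right (by linarith [hc.2.2] : u z.2 - k ≤ 0), zero_mul]
    · rfl
  have h4 : ∫⁻ z in crossSet Ω, ENNReal.ofReal ((Er z.1 z.2 + Er z.2 z.1) * K z.1 z.2) ≤
      ENNReal.ofReal Λ * ∫⁻ z : Rn n × Rn n, ENNReal.ofReal (Er z.1 z.2 + Er z.2 z.1) *
        ‖z.1 - z.2‖ₑ ^ (-((n : ℝ) + s * p)) := by
    rw [← lintegral_const_mul' _ _ ENNReal.ofReal_ne_top]
    refine (setLIntegral_le_lintegral _ _).trans (lintegral_mono_ae ?_)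
    filter_upwards [hK.upper_enorm hs hp0 hΛ] with z hz
    exact hz _ (add_nonneg (hEr0 _ _) (hEr0 _ _))
  rw [hsymm] at h4
  exact h3.trans (h2.trans (add_le_add h4 le_rfl))

/-- Minimizers belong to a De Giorgi class. -/
theorem IsMinimizer.isDeGiorgi (hs : 0 < s) (hp : 1 < p) (hΛ : 1 ≤ Λ)
    (hb : Bornology.IsBounded Ω) (hΩ : IsOpen Ω) (hK : IsAdmissibleKernel n s p Λ K)
    (hF : SuperpositionMeasurable Ω F) (hF₀ : 0 ≤ F₀)
    (hFb : ∀ᵐ x ∂(volume.restrict Ω), ∀ t : ℝ, |F x t| ≤ F₀) (hu : Measurable u)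
    (hmin : IsMinimizer s p K F Ω u) {C₁ : ℝ} (hC₁0 : 0 < C₁)
    (hC₁ : ∀ (x : Rn n) (ρ : ℝ), 0 < ρ →
      ∫⁻ y in Metric.ball x ρ, ‖y - x‖ₑ ^ (p - ((n : ℝ) + s * p)) ≤
        ENNReal.ofReal (C₁ * ρ ^ (p - s * p))) :
    IsDeGiorgi n s p (Λ * (2 * Λ * (p ^ p * 2 ^ p * C₁ * 2 ^ (p - s * p)) +
      2 * Λ * (p * 2 ^ ((n : ℝ) + s * p)) + 4 * p)) F₀ Ω u := by
  intro x₀ r R k hr hrR hball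
  have hp0 : 0 < p := by linarith
  have hΛ0 : 0 < Λ := by linarith
  have hR : 0 < R := hr.trans hrR
  have hRr : 0 < R - r := by linarith
  have hsp : 0 < s * p := by positivity
  have h1 := hmin.caccioppoli_aux hs hp hΛ hb hΩ hK hF hF₀ hFb hu k hrR hball
  have h2 := lintegral_error_le hs hp hC₁ hu k (x₀ := x₀) hr hrR
  have h3 := lintegral_gain_ge (n := n) (s := s) hp hu k (x₀ := x₀) (r := r) (R := R)
  set E : ℝ := (n : ℝ) + s * p with hE
  have hE0 : 0 < E := by positivity
  set Gn := ∫⁻ x in Metric.ball x₀ r, ∫⁻ y in Metric.ball x₀ R ∩ {y | u y ≤ k},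
        ENNReal.ofReal (u x - k) * max (ENNReal.ofReal (u x - k)) (ENNReal.ofReal (k - u y)) ^ (p - 1) *
          ‖x - y‖ₑ ^ (-E)
  set I := ∫⁻ x in Metric.ball x₀ R, ENNReal.ofReal (u x - k) ^ p
  set I1 := ∫⁻ x in Metric.ball x₀ R, ENNReal.ofReal (u x - k)
  set T := weightedTail n s p (fun y => ENNReal.ofReal (u y - k)) x₀ R
  set V := volume (Metric.ball x₀ R ∩ {x | k < u x})
  set q := R / (R - r) with hq
  have hq0 : 0 < q := by positivity
  have hq1 : 1 ≤ q := by rw [hq, one_le_div hRr]; linarith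
  set D := q ^ (E + p) * R ^ (-(s * p)) with hD
  have hD0 : 0 < D := by positivity
  set c1 := p ^ p * 2 ^ p * C₁ * 2 ^ (p - s * p) with hc1
  set c2 := p * 2 ^ E with hc2
  have hc10 : 0 < c1 := by positivity
  have hc20 : 0 < c2 := by positivity
  -- Since `q ≥ 1`, the single factor `q ^ (E + p)` dominates the power `q ^ p` of the near term,
  -- the power `q ^ E` of the far term and the constant 1 of the potential term.
  have k1 : p ^ p * (2 / (R - r)) ^ p * (C₁ * (2 * R) ^ (p - s * p)) ≤ c1 * D := by
    have e1 : p ^ p * (2 / (R - r)) ^ p * (C₁ * (2 * R) ^ (p - s * p)) =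
        c1 * (q ^ p * R ^ (-(s * p))) := by
      rw [hc1, hq, Real.div_rpow two_pos.le hRr.le, Real.div_rpow hR.le hRr.le,
        Real.mul_rpow two_pos.le hR.le, sub_eq_add_neg p, Real.rpow_add hR]
      ring
    rw [e1, hD]
    have : q ^ p ≤ q ^ (E + p) := Real.rpow_le_rpow_of_exponent_le hq1 (by linarith)
    gcongr
  have k2 : p * (2 * R / (R - r)) ^ E * R ^ (-(s * p)) ≤ c2 * D := by
    have e1 : p * (2 * R / (R - r)) ^ E * R ^ (-(s * p)) = c2 * (q ^ E * R ^ (-(s * p))) := by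
      rw [hc2, mul_div_assoc, Real.mul_rpow two_pos.le hq0.le]
      ring
    rw [e1, hD]
    have : q ^ E ≤ q ^ (E + p) := Real.rpow_le_rpow_of_exponent_le hq1 (by linarith)
    gcongr
  have k3 : 4 * p * F₀ ≤ 4 * p * D * (F₀ * R ^ (s * p)) := by
    have e1 : 4 * p * D * (F₀ * R ^ (s * p)) = 4 * p * F₀ * q ^ (E + p) := by
      rw [hD, Real.rpow_neg hR.le]
      have : R ^ (s * p) ≠ 0 := by positivity
      field_simp
    rw [e1]
    exact le_mul_of_one_le_right (by positivity) (Real.one_le_rpow hq1 (by linarith))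
  have hfinal : ENNReal.ofReal (1 / Λ) * Gn ≤ ENNReal.ofReal ((2 * Λ * c1 + 2 * Λ * c2 + 4 * p) * D) *
      (I + T * I1 + ENNReal.ofReal (F₀ * R ^ (s * p)) * V) := by
    calc ENNReal.ofReal (1 / Λ) * Gn
        ≤ _ := (mul_le_mul' le_rfl h3).trans h1
      _ ≤ ENNReal.ofReal Λ * (2 * (ENNReal.ofReal (c1 * D) * I +
          ENNReal.ofReal (c2 * D) * T * I1)) +
          ENNReal.ofReal (4 * p * D * (F₀ * R ^ (s * p))) * V := by
          refine add_le_add (mul_le_mul' le_rfl (mul_le_mul' le_rfl (h2.trans ?_)))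
            (mul_le_mul' (ENNReal.ofReal_le_ofReal k3) le_rfl)
          gcongr
      _ = ENNReal.ofReal (2 * Λ * c1 * D) * I + ENNReal.ofReal (2 * Λ * c2 * D) * (T * I1) +
          ENNReal.ofReal (4 * p * D) * (ENNReal.ofReal (F₀ * R ^ (s * p)) * V) := by
          have e2 : (2 : ℝ≥0∞) = ENNReal.ofReal 2 := by simp
          rw [e2, ENNReal.ofReal_mul (p := 4 * p * D) (by positivity),
            show 2 * Λ * c1 * D = Λ * (2 * (c1 * D)) by ring,
            show 2 * Λ * c2 * D = Λ * (2 * (c2 * D)) by ring,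
            ENNReal.ofReal_mul hΛ0.le, ENNReal.ofReal_mul hΛ0.le, ENNReal.ofReal_mul two_pos.le,
            ENNReal.ofReal_mul two_pos.le]
          ring
      _ ≤ _ := by
          rw [mul_add, mul_add]
          refine add_le_add (add_le_add ?_ ?_) ?_ <;>
          · refine mul_le_mul' (ENNReal.ofReal_le_ofReal (mul_le_mul_of_nonneg_right ?_ hD0.le)) le_rfl
            have : 0 < 2 * Λ * c1 := by positivity
            have : 0 < 2 * Λ * c2 := by positivity
            linarith
  calc Gn = ENNReal.ofReal Λ * (ENNReal.ofReal (1 / Λ) * Gn) := by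
        rw [← mul_assoc, ← ENNReal.ofReal_mul hΛ0.le, mul_one_div_cancel hΛ0.ne']
        simp
    _ ≤ _ := mul_le_mul' le_rfl hfinal
    _ = _ := by
        rw [← mul_assoc, ← ENNReal.ofReal_mul hΛ0.le]
        congr 2
        rw [hD]
        ring

end Caccioppoli

/-! ### De Giorgi iteration: small excess implies an upper bound. -/

section Iteration

variable {n : ℕ} {s p A F₀ : ℝ} {U : Set (Rn n)} {u : Rn n → ℝ}

theorem ofReal_rpow_neg_le_enorm {x y : Rn n} {ρ E : ℝ} (hρ : 0 < ρ) (hE : 0 < E)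
    (h : ‖x - y‖ ≤ ρ) : ENNReal.ofReal (ρ ^ (-E)) ≤ ‖x - y‖ₑ ^ (-E) := by
  rw [← ENNReal.ofReal_rpow_of_pos hρ, ENNReal.rpow_neg, ENNReal.rpow_neg, ENNReal.inv_le_inv]
  gcongr
  rw [← ofReal_norm]
  exact ENNReal.ofReal_le_ofReal h

theorem ennreal_mul_rpow_sub_one (hp : 1 < p) (a : ℝ≥0∞) : a * a ^ (p - 1) = a ^ p := by
  have := ENNReal.rpow_add_of_nonneg (x := a) 1 (p - 1) zero_le_one (by linarith)
  rw [ENNReal.rpow_one, add_sub_cancel] at this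
  exact this.symm

/-- Chebyshev's inequality for superlevel sets. -/
theorem rpow_mul_volume_superlevel_le (hp : 1 < p) (hu : Measurable u) {B : Set (Rn n)}
    (hB : MeasurableSet B) {k d : ℝ} (hd : 0 < d) :
    ENNReal.ofReal (d ^ p) * volume (B ∩ {x | k + d < u x}) ≤
      ∫⁻ x in B, ENNReal.ofReal (u x - k) ^ p := by
  have hp0 : 0 < p := by linarith
  rw [← setLIntegral_const]
  refine (setLIntegral_mono' (hB.inter (measurableSet_lt measurable_const hu)) fun x hx => ?_).trans
    (lintegral_mono_set inter_subset_left)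
  have hx2 : k + d < u x := hx.2
  rw [ENNReal.ofReal_rpow_of_pos (by linarith)]
  refine ENNReal.ofReal_le_ofReal (Real.rpow_le_rpow hd.le (by linarith) hp0.le)

theorem rpow_mul_lintegral_excess_le (hp : 1 < p) {B : Set (Rn n)} {k d : ℝ} (hd : 0 < d) :
    ENNReal.ofReal (d ^ (p - 1)) * ∫⁻ x in B, ENNReal.ofReal (u x - (k + d)) ≤
      ∫⁻ x in B, ENNReal.ofReal (u x - k) ^ p := by
  have hp1 : 0 < p - 1 := by linarith
  rw [← lintegral_const_mul' _ _ ENNReal.ofReal_ne_top]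
  refine lintegral_mono fun x => ?_
  rcases le_or_gt (u x) (k + d) with h | h
  · rw [ENNReal.ofReal_of_nonpos (by linarith : u x - (k + d) ≤ 0), mul_zero]
    exact bot_le
  · rw [← ennreal_mul_rpow_sub_one hp, mul_comm, ENNReal.ofReal_rpow_of_pos (by linarith)]
    refine mul_le_mul' (ENNReal.ofReal_le_ofReal (by linarith)) (ENNReal.ofReal_le_ofReal ?_)
    exact Real.rpow_le_rpow hd.le (by linarith) hp1.le

/-- Lower bound for the gain: an elementary fractional Faber-Krahn inequality. -/
theorem lintegral_gain_ge_of_volume_le (hs : 0 < s) (hp : 1 < p) {l : ℝ} (hu : Measurable u)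
    {x₀ : Rn n} {r R ρ : ℝ} (hρ : 0 < ρ) (hρR : ρ ≤ R - r)
    (hvol : volume (Metric.ball x₀ R ∩ {x | l < u x}) ≤
      ENNReal.ofReal (ρ ^ (n : ℝ) * (volume (Metric.ball (0 : Rn n) 1)).toReal / 2)) :
    (∫⁻ x in Metric.ball x₀ r, ENNReal.ofReal (u x - l) ^ p) *
      ENNReal.ofReal ((volume (Metric.ball (0 : Rn n) 1)).toReal / 2 * ρ ^ (-(s * p))) ≤
    ∫⁻ x in Metric.ball x₀ r, ∫⁻ y in Metric.ball x₀ R ∩ {y | u y ≤ l},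
        ENNReal.ofReal (u x - l) * max (ENNReal.ofReal (u x - l)) (ENNReal.ofReal (l - u y)) ^ (p - 1) *
          ‖x - y‖ₑ ^ (-((n : ℝ) + s * p)) := by
  have hsp : 0 < s * p := by positivity
  have hp1 : 0 ≤ p - 1 := by linarith
  have hω := unitBall_pos n
  set ω := (volume (Metric.ball (0 : Rn n) 1)).toReal
  set E : ℝ := (n : ℝ) + s * p with hE
  have hE0 : 0 < E := by positivity
  rw [← lintegral_mul_const' _ _ ENNReal.ofReal_ne_top]
  refine setLIntegral_mono' measurableSet_ball fun x hx => ?_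
  have hsub : Metric.ball x ρ ⊆ Metric.ball x₀ R := by
    refine Metric.ball_subset_ball' ?_
    rw [Metric.mem_ball] at hx
    linarith
  have hm : MeasurableSet (Metric.ball x ρ ∩ {y | u y ≤ l}) :=
    measurableSet_ball.inter (measurableSet_le hu measurable_const)
  -- The superlevel set has at most half the measure of a ball of radius `ρ`, so at least half of
  -- `B_ρ(x)` lies below the level. On that part the kernel is at least `ρ ^ (-E)`, and the first
  -- entry of the maximum yields `(u - l)₊ ^ p`.
  have hlow : ENNReal.ofReal (ρ ^ (n : ℝ) * ω / 2) ≤ volume (Metric.ball x ρ ∩ {y | u y ≤ l}) := by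
    have h1 : volume (Metric.ball x ρ) ≤
        volume (Metric.ball x ρ ∩ {y | u y ≤ l}) + volume (Metric.ball x₀ R ∩ {x | l < u x}) := by
      refine (measure_mono fun y hy => ?_).trans (measure_union_le _ _)
      rcases le_or_gt (u y) l with h | h
      · exact Or.inl ⟨hy, h⟩
      · exact Or.inr ⟨hsub hy, h⟩
    rw [volume_ball_eq n x hρ] at h1
    have h2 : ENNReal.ofReal (ρ ^ (n : ℝ) * ω) =
        ENNReal.ofReal (ρ ^ (n : ℝ) * ω / 2) + ENNReal.ofReal (ρ ^ (n : ℝ) * ω / 2) := by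
      rw [← ENNReal.ofReal_add (by positivity) (by positivity), add_halves]
    rw [h2] at h1
    exact (ENNReal.add_le_add_iff_right ENNReal.ofReal_ne_top).1
      (h1.trans (add_le_add le_rfl hvol))
  calc ENNReal.ofReal (u x - l) ^ p * ENNReal.ofReal (ω / 2 * ρ ^ (-(s * p)))
      = ENNReal.ofReal (u x - l) ^ p * ENNReal.ofReal (ρ ^ (-E)) *
        ENNReal.ofReal (ρ ^ (n : ℝ) * ω / 2) := by
        rw [mul_assoc, ← ENNReal.ofReal_mul (by positivity)]
        congr 2
        rw [show -(s * p) = -E + n by rw [hE]; ring, Real.rpow_add hρ]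
        ring
    _ ≤ ENNReal.ofReal (u x - l) ^ p * ENNReal.ofReal (ρ ^ (-E)) *
        volume (Metric.ball x ρ ∩ {y | u y ≤ l}) := by gcongr
    _ = ∫⁻ _ in Metric.ball x ρ ∩ {y | u y ≤ l},
        ENNReal.ofReal (u x - l) ^ p * ENNReal.ofReal (ρ ^ (-E)) := by rw [setLIntegral_const]
    _ ≤ ∫⁻ y in Metric.ball x ρ ∩ {y | u y ≤ l},
        ENNReal.ofReal (u x - l) * max (ENNReal.ofReal (u x - l)) (ENNReal.ofReal (l - u y)) ^ (p - 1) *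
          ‖x - y‖ₑ ^ (-E) := by
        refine setLIntegral_mono' hm fun y hy => ?_
        refine mul_le_mul' ?_ (ofReal_rpow_neg_le_enorm hρ hE0 ?_)
        · rw [← ennreal_mul_rpow_sub_one hp]
          gcongr
          exact le_max_left _ _
        · have := Metric.mem_ball'.1 hy.1
          rw [dist_eq_norm] at this
          exact this.le
    _ ≤ _ := lintegral_mono_set (inter_subset_inter_left _ hsub)

/-- One step of the De Giorgi iteration. -/
theorem IsDeGiorgi.step (hs : 0 < s) (hp : 1 < p) (hA : 0 < A) (hF₀ : 0 ≤ F₀) (hu : Measurable u)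
    (hDG : IsDeGiorgi n s p A F₀ U u) {x₀ : Rn n} {r R ρ k d α t ω : ℝ} (hr : 0 < r)
    (hωd : ω = (volume (Metric.ball (0 : Rn n) 1)).toReal)
    (hρ : 0 < ρ) (hρR : ρ ≤ R - r) (hd : 0 < d) (hball : Metric.closedBall x₀ R ⊆ U)
    (hα0 : 0 ≤ α) (ht0 : 0 ≤ t)
    (hα : ∫⁻ x in Metric.ball x₀ R, ENNReal.ofReal (u x - k) ^ p ≤ ENNReal.ofReal α)
    (hαρ : α ≤ ω / 2 * ρ ^ (n : ℝ) * d ^ p)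
    (ht : weightedTail n s p (fun y => ENNReal.ofReal (u y - (k + d))) x₀ R ≤ ENNReal.ofReal t) :
    ∫⁻ x in Metric.ball x₀ r, ENNReal.ofReal (u x - (k + d)) ^ p ≤
      ENNReal.ofReal (2 / ω * ρ ^ (s * p) *
        (A * (R / (R - r)) ^ ((n : ℝ) + s * p + p) * R ^ (-(s * p))) *
        (1 + t / d ^ (p - 1) + F₀ * R ^ (s * p) / d ^ p) * α) := by
  have hp0 : 0 < p := by linarith
  have hrR : r < R := by linarith
  have hR : 0 < R := hr.trans hrR
  have hRr : 0 < R - r := by linarith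
  have hω := unitBall_pos n
  -- Raising the level by `d` lets the excess `α` over `k` control both the measure of the
  -- superlevel set and the first power of the excess over `k + d`. The hypothesis `hαρ` is the
  -- density condition on balls of radius `ρ`.
  rw [← hωd] at hω
  have hvol1 := (rpow_mul_volume_superlevel_le hp hu (measurableSet_ball (x := x₀) (ε := R))
    (k := k) hd).trans hα
  have hint1 := (rpow_mul_lintegral_excess_le (u := u) hp (B := Metric.ball x₀ R) (k := k) hd).trans hα
  have hdp : 0 < d ^ p := by positivity
  have hdp1 : 0 < d ^ (p - 1) := by positivity
  have cancel : ∀ (c b : ℝ) (X : ℝ≥0∞), 0 < c → ENNReal.ofReal c * X ≤ ENNReal.ofReal b →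
      X ≤ ENNReal.ofReal (b / c) := fun c b X hc h => by
    rw [ENNReal.ofReal_div_of_pos hc, ENNReal.le_div_iff_mul_le (by simp [hc]) (by simp), mul_comm]
    exact h
  have hvol := cancel _ _ _ hdp hvol1
  have hint := cancel _ _ _ hdp1 hint1
  have hgain := lintegral_gain_ge_of_volume_le (n := n) (s := s) (p := p) (l := k + d) hs hp hu
    (x₀ := x₀) hρ hρR (hvol.trans (ENNReal.ofReal_le_ofReal (by
      rw [div_le_iff₀ hdp, ← hωd]
      linarith)))
  have hcac := hDG x₀ r R (k + d) hr hrR hball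
  have hα' : ∫⁻ x in Metric.ball x₀ R, ENNReal.ofReal (u x - (k + d)) ^ p ≤ ENNReal.ofReal α := by
    refine le_trans (lintegral_mono fun x => ?_) hα
    gcongr
    linarith
  rw [← hωd] at hgain
  set Q := A * (R / (R - r)) ^ ((n : ℝ) + s * p + p) * R ^ (-(s * p)) with hQ
  have hQ0 : 0 < Q := by positivity
  have h1 := hgain.trans hcac
  have h2 : (∫⁻ x in Metric.ball x₀ r, ENNReal.ofReal (u x - (k + d)) ^ p) *
      ENNReal.ofReal (ω / 2 * ρ ^ (-(s * p))) ≤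
      ENNReal.ofReal (Q * (α + t * (α / d ^ (p - 1)) + F₀ * R ^ (s * p) * (α / d ^ p))) := by
    refine h1.trans ?_
    rw [ENNReal.ofReal_mul hQ0.le, ENNReal.ofReal_add (by positivity) (by positivity),
      ENNReal.ofReal_add (by positivity) (by positivity), ENNReal.ofReal_mul ht0,
      ENNReal.ofReal_mul (p := F₀ * R ^ (s * p)) (by positivity)]
    gcongr
  rw [mul_comm] at h2
  refine (cancel _ _ _ (by positivity) h2).trans_eq ?_
  congr 1
  rw [Real.rpow_neg hρ.le]
  field_simp

/-- The contraction factor at step `j` is bounded independently of `j`. The narrowing annuli cost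
`(4/e)^(E+p)` and the shrinking level gaps cost `(e/2)^(-p)`, together growing like `2^(j(E+2p))`;
the factor `(τ^j)^(sp)` from the radius `ρ_j = R θ τ^j` compensates this exactly. -/
theorem deGiorgi_step_constant {s p A B E F₀ R M τ θ ω : ℝ} (hsp : 0 < s * p) (hp : 1 < p)
    (hE : 0 < E) (hA : 0 < A) (hB : 0 ≤ B) (hF₀ : 0 ≤ F₀) (hω : 0 < ω) (hR : 0 < R) (hM : 0 < M)
    (hτ0 : 0 < τ) (hθ0 : 0 < θ) (hτsp : τ ^ (s * p) * 2 ^ (E + 2 * p) = 1)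
    (hFM : F₀ * R ^ (s * p) ≤ M ^ p) (j : ℕ) {e : ℝ} (he : e = (1 / 2) ^ j) :
    2 / ω * (R * θ * τ ^ j) ^ (s * p) *
        (A * (R * (1 + e) / (R * (1 + e) - R * (1 + e / 2))) ^ (E + p) *
          (R * (1 + e)) ^ (-(s * p))) *
        (1 + 2 ^ (s * p) * (B * M ^ (p - 1)) / (M * (e / 2)) ^ (p - 1) +
          F₀ * (R * (1 + e)) ^ (s * p) / (M * (e / 2)) ^ p) ≤
      2 / ω * A * 2 ^ (2 * (E + p) + p) * (1 + 2 ^ (s * p) * (B + 1)) * θ ^ (s * p) := by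
  have hp0 : 0 < p := by linarith
  have hp1 : 0 < p - 1 := by linarith
  have he0 : 0 < e := by rw [he]; positivity
  have he1 : e ≤ 1 := by rw [he]; exact pow_le_one₀ (by norm_num) (by norm_num)
  have hRj : R * (1 + e) - R * (1 + e / 2) = R * (e / 2) := by ring
  have hRe : R ≤ R * (1 + e) := by nlinarith
  have hRe2 : R * (1 + e) ≤ 2 * R := by nlinarith
  have hjr : e = 2 ^ (-(j : ℝ)) := by
    rw [he, Real.rpow_neg two_pos.le, Real.rpow_natCast, one_div, inv_pow]
  have hdM : (M * (e / 2)) ^ p = M ^ p * (e / 2) ^ p := Real.mul_rpow hM.le (by positivity)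
  have hdM1 : (M * (e / 2)) ^ (p - 1) = M ^ (p - 1) * (e / 2) ^ (p - 1) :=
    Real.mul_rpow hM.le (by positivity)
  have he21 : e / 2 ≤ 1 := by linarith
  have hep : (0 : ℝ) < (e / 2) ^ p := by positivity
  have hep1 : (e / 2) ^ p ≤ (e / 2) ^ (p - 1) :=
    Real.rpow_le_rpow_of_exponent_ge (by positivity) he21 (by linarith)
  have hep2 : (e / 2) ^ p ≤ 1 := Real.rpow_le_one (by positivity) he21 hp0.le
  have b1 : 1 + 2 ^ (s * p) * (B * M ^ (p - 1)) / (M * (e / 2)) ^ (p - 1) +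
      F₀ * (R * (1 + e)) ^ (s * p) / (M * (e / 2)) ^ p ≤
      (1 + 2 ^ (s * p) * (B + 1)) * ((e / 2) ^ p)⁻¹ := by
    have c1 : 1 ≤ ((e / 2) ^ p)⁻¹ := (one_le_inv₀ hep).2 hep2
    have c2 : 2 ^ (s * p) * (B * M ^ (p - 1)) / (M * (e / 2)) ^ (p - 1) ≤
        2 ^ (s * p) * B * ((e / 2) ^ p)⁻¹ := by
      rw [hdM1]
      have : M ^ (p - 1) ≠ 0 := by positivity
      calc _ = 2 ^ (s * p) * B * ((e / 2) ^ (p - 1))⁻¹ := by field_simp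
        _ ≤ _ := by gcongr
    have c3 : F₀ * (R * (1 + e)) ^ (s * p) / (M * (e / 2)) ^ p ≤
        2 ^ (s * p) * ((e / 2) ^ p)⁻¹ := by
      have d1 : (R * (1 + e)) ^ (s * p) ≤ 2 ^ (s * p) * R ^ (s * p) := by
        rw [← Real.mul_rpow two_pos.le hR.le]
        exact Real.rpow_le_rpow (by positivity) hRe2 hsp.le
      rw [hdM, div_eq_mul_inv, mul_inv]
      have : M ^ p ≠ 0 := by positivity
      calc _ ≤ F₀ * (2 ^ (s * p) * R ^ (s * p)) * ((M ^ p)⁻¹ * ((e / 2) ^ p)⁻¹) := by gcongr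
        _ = (F₀ * R ^ (s * p)) * (2 ^ (s * p) * ((M ^ p)⁻¹ * ((e / 2) ^ p)⁻¹)) := by ring
        _ ≤ M ^ p * (2 ^ (s * p) * ((M ^ p)⁻¹ * ((e / 2) ^ p)⁻¹)) := by gcongr
        _ = _ := by field_simp
    linarith
  have b2 : (R * (1 + e) / (R * (1 + e) - R * (1 + e / 2))) ^ (E + p) ≤
      (4 / e) ^ (E + p) := by
    rw [hRj]
    refine Real.rpow_le_rpow (by positivity) ?_ (by positivity)
    rw [div_le_div_iff₀ (by positivity) he0]
    nlinarith [mul_pos hR he0]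
  have b3 : (R * (1 + e)) ^ (-(s * p)) ≤ R ^ (-(s * p)) :=
    Real.rpow_le_rpow_of_nonpos hR hRe (by linarith)
  have hbr0 : 0 ≤ 1 + 2 ^ (s * p) * (B * M ^ (p - 1)) / (M * (e / 2)) ^ (p - 1) +
      F₀ * (R * (1 + e)) ^ (s * p) / (M * (e / 2)) ^ p := by positivity
  have hq0 : 0 ≤ R * (1 + e) / (R * (1 + e) - R * (1 + e / 2)) := by
    rw [hRj]; positivity
  have hmain : 2 / ω * (R * θ * τ ^ j) ^ (s * p) *
      (A * (4 / e) ^ (E + p) * R ^ (-(s * p))) *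
      ((1 + 2 ^ (s * p) * (B + 1)) * ((e / 2) ^ p)⁻¹) =
      2 / ω * A * 2 ^ (2 * (E + p) + p) * (1 + 2 ^ (s * p) * (B + 1)) * θ ^ (s * p) := by
    have f1 : (R * θ * τ ^ j) ^ (s * p) = R ^ (s * p) * θ ^ (s * p) * (τ ^ (s * p)) ^ j := by
      rw [Real.mul_rpow (by positivity) (by positivity), Real.mul_rpow hR.le hθ0.le,
        ← Real.rpow_natCast, ← Real.rpow_natCast, ← Real.rpow_mul hτ0.le,
        ← Real.rpow_mul hτ0.le, mul_comm (j : ℝ)]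
    have f2 : τ ^ (s * p) = 2 ^ (-(E + 2 * p)) := by
      rw [Real.rpow_neg two_pos.le]
      exact eq_inv_of_mul_eq_one_left hτsp
    have f3 : (4 / e) ^ (E + p) = 2 ^ ((2 + j) * (E + p)) := by
      rw [hjr, show (4 : ℝ) = 2 ^ (2 : ℝ) by norm_num, ← Real.rpow_sub two_pos,
        ← Real.rpow_mul two_pos.le, sub_neg_eq_add]
    have f4 : ((e / 2) ^ p)⁻¹ = 2 ^ ((1 + j) * p) := by
      rw [hjr, ← Real.rpow_sub_one two_ne_zero, ← Real.rpow_mul two_pos.le,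
        ← Real.rpow_neg two_pos.le]
      congr 1; ring
    have f5 : (2 : ℝ) ^ ((2 + j) * (E + p)) * 2 ^ ((1 + j) * p) * (2 ^ (-(E + 2 * p))) ^ j =
        2 ^ (2 * (E + p) + p) := by
      rw [← Real.rpow_natCast, ← Real.rpow_mul two_pos.le, ← Real.rpow_add two_pos,
        ← Real.rpow_add two_pos]
      congr 1; ring
    have f6 : R ^ (s * p) * R ^ (-(s * p)) = 1 := by
      rw [← Real.rpow_add hR, add_neg_cancel, Real.rpow_zero]
    rw [f1, f2, f3, f4, ← f5]
    calc _ = (R ^ (s * p) * R ^ (-(s * p))) * (2 / ω * A * (2 ^ ((2 + j) * (E + p)) *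
          2 ^ ((1 + j) * p) * (2 ^ (-(E + 2 * p))) ^ j) *
          (1 + 2 ^ (s * p) * (B + 1)) * θ ^ (s * p)) := by ring
      _ = _ := by rw [f6, one_mul]
  rw [← hmain]
  gcongr

/-- The excess bound carried by the induction is exactly the largest one for which the density
condition of `IsDeGiorgi.step` holds with `ρ = R θ τ^j` and `d = M e / 2`. -/
theorem deGiorgi_step_excess {n p R M τ θ ω : ℝ} (hR : 0 < R) (hM : 0 < M)
    (hτ0 : 0 < τ) (hθ0 : 0 < θ) (j : ℕ) {e : ℝ} (he : e = (1 / 2) ^ j) :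
    ω / 2 * θ ^ n * 2 ^ (-p) * (τ ^ n * 2 ^ (-p)) ^ j * M ^ p * R ^ n =
      ω / 2 * (R * θ * τ ^ j) ^ n * (M * (e / 2)) ^ p := by
  have he0 : 0 < e := by rw [he]; positivity
  have g1 : (M * (e / 2)) ^ p = M ^ p * ((2 ^ (-p)) ^ j * 2 ^ (-p)) := by
    rw [Real.mul_rpow hM.le (by positivity), he, Real.div_rpow (by positivity) two_pos.le,
      Real.rpow_neg two_pos.le, one_div, inv_pow, Real.inv_rpow (by positivity),
      ← Real.rpow_natCast, ← Real.rpow_mul two_pos.le, inv_pow, ← Real.rpow_natCast (2 ^ p),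
      ← Real.rpow_mul two_pos.le, mul_comm (j : ℝ)]
    ring
  have g2 : (R * θ * τ ^ j) ^ n = R ^ n * θ ^ n * (τ ^ n) ^ j := by
    rw [Real.mul_rpow (by positivity) (by positivity), Real.mul_rpow hR.le hθ0.le,
      ← Real.rpow_natCast τ j, ← Real.rpow_natCast (τ ^ n), ← Real.rpow_mul hτ0.le,
      ← Real.rpow_mul hτ0.le, mul_comm (j : ℝ)]
  rw [g1, g2, mul_pow]
  ring

theorem ae_le_of_lintegral_excess_le (hp : 0 < p) (hu : Measurable u) {S : Set (Rn n)}
    {l σ c : ℝ} (hσ0 : 0 < σ) (hσ1 : σ < 1)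
    (h : ∀ j : ℕ, ∫⁻ x in S, ENNReal.ofReal (u x - l) ^ p ≤ ENNReal.ofReal (c * σ ^ j)) :
    ∀ᵐ x ∂(volume.restrict S), u x ≤ l := by
  have h2 : Filter.Tendsto (fun j : ℕ => ENNReal.ofReal (c * σ ^ j)) Filter.atTop (nhds 0) := by
    rw [← ENNReal.ofReal_zero]
    refine ENNReal.tendsto_ofReal ?_
    simpa using (tendsto_pow_atTop_nhds_zero_of_lt_one hσ0.le hσ1).const_mul c
  have hlim : ∫⁻ x in S, ENNReal.ofReal (u x - l) ^ p = 0 :=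
    le_antisymm (ge_of_tendsto' h2 h) bot_le
  rw [lintegral_eq_zero_iff (by fun_prop)] at hlim
  filter_upwards [hlim] with x hx
  have hx' : ENNReal.ofReal (u x - l) ^ p = 0 := hx
  rw [ENNReal.rpow_eq_zero_iff_of_pos hp, ENNReal.ofReal_eq_zero] at hx'
  linarith

set_option maxHeartbeats 800000 in
/-- **De Giorgi's lemma**: a function in the De Giorgi class with small excess in a ball is bounded
by the level in the half ball. -/
theorem IsDeGiorgi.exists_sup_le (n : ℕ) {s p A B : ℝ} (hs : 0 < s) (hp : 1 < p) (hA : 0 < A)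
    (hB : 0 ≤ B) :
    ∃ ν : ℝ, 0 < ν ∧ ∀ (F₀ : ℝ) (U : Set (Rn n)) (u : Rn n → ℝ), 0 ≤ F₀ → Measurable u →
      IsDeGiorgi n s p A F₀ U u → ∀ (x₀ : Rn n) (R k M : ℝ), 0 < R → 0 < M →
      Metric.closedBall x₀ (2 * R) ⊆ U → F₀ * R ^ (s * p) ≤ M ^ p →
      weightedTail n s p (fun y => ENNReal.ofReal (u y - k)) x₀ R ≤
        ENNReal.ofReal (B * M ^ (p - 1)) →
      ∫⁻ x in Metric.ball x₀ (2 * R), ENNReal.ofReal (u x - k) ^ p ≤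
        ENNReal.ofReal (ν * M ^ p * R ^ (n : ℝ)) →
      ∀ᵐ x ∂(volume.restrict (Metric.ball x₀ R)), u x ≤ k + M := by
  have hp0 : 0 < p := by linarith
  have hp1 : 0 < p - 1 := by linarith
  have hsp : 0 < s * p := by positivity
  obtain ⟨ω, hωd⟩ : ∃ ω, ω = (volume (Metric.ball (0 : Rn n) 1)).toReal := ⟨_, rfl⟩
  have hω : 0 < ω := hωd ▸ unitBall_pos n
  set E : ℝ := (n : ℝ) + s * p with hE
  have hn0 : (0 : ℝ) ≤ n := Nat.cast_nonneg n
  have hE0 : 0 < E := by positivity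
  -- `τ` is the rate at which the auxiliary radii `ρ_j` shrink, fixed by `τ^(sp) = 2^(-(E+2p))`. The
  -- bound `τ ≤ 1/2` keeps `ρ_j` smaller than the width of the annulus at step `j`. The excess then
  -- has to decay at the rate `σ = τ^n 2^(-p)` for the density condition to persist.
  set τ : ℝ := 2 ^ (-((E + 2 * p) / (s * p))) with hτ
  have hτ0 : 0 < τ := by positivity
  have hτsp : τ ^ (s * p) * 2 ^ (E + 2 * p) = 1 := by
    rw [hτ, ← Real.rpow_mul two_pos.le, ← Real.rpow_add two_pos]
    have : -((E + 2 * p) / (s * p)) * (s * p) + (E + 2 * p) = 0 := by field_simp; ring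
    rw [this, Real.rpow_zero]
  have hτ2 : τ ≤ 1 / 2 := by
    have : (1 / 2 : ℝ) = 2 ^ (-1 : ℝ) := by rw [Real.rpow_neg_one]; norm_num
    rw [hτ, this]
    refine Real.rpow_le_rpow_of_exponent_le one_le_two (neg_le_neg ?_)
    rw [one_le_div hsp]
    linarith
  set σ : ℝ := τ ^ (n : ℝ) * 2 ^ (-p) with hσ
  have hσ0 : 0 < σ := by positivity
  have hσ1 : σ < 1 := by
    have h1 : τ ^ (n : ℝ) ≤ 1 := Real.rpow_le_one hτ0.le (by linarith) hn0
    have h2 : (2 : ℝ) ^ (-p) < 1 := Real.rpow_lt_one_of_one_lt_of_neg one_lt_two (by linarith)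
    have h3 : (0 : ℝ) < 2 ^ (-p) := by positivity
    nlinarith
  set Cs : ℝ := 2 / ω * A * 2 ^ (2 * (E + p) + p) * (1 + 2 ^ (s * p) * (B + 1)) with hCs
  have hCs0 : 0 < Cs := by positivity
  -- `θ` is so small that the contraction factor `Cs * θ^(sp)` of a step is at most `σ`: the
  -- recursion is linear, with no superlinear term to exploit.
  set θ : ℝ := min (1 / 2) ((σ / Cs) ^ (1 / (s * p))) with hθ
  have hθ0 : 0 < θ := by positivity
  have hθ2 : θ ≤ 1 / 2 := min_le_left _ _
  have hθC : Cs * θ ^ (s * p) ≤ σ := by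
    have : θ ^ (s * p) ≤ σ / Cs := by
      calc θ ^ (s * p) ≤ ((σ / Cs) ^ (1 / (s * p))) ^ (s * p) :=
            Real.rpow_le_rpow hθ0.le (min_le_right _ _) hsp.le
        _ = σ / Cs := by
            rw [← Real.rpow_mul (by positivity), one_div_mul_cancel hsp.ne', Real.rpow_one]
    rw [le_div_iff₀ hCs0] at this
    linarith
  clear_value θ
  refine ⟨ω / 2 * θ ^ (n : ℝ) * 2 ^ (-p), by positivity, ?_⟩
  intro F₀ U u hF₀ hu hDG x₀ R k M hR hM hball hFM htail hA0
  set ν := ω / 2 * θ ^ (n : ℝ) * 2 ^ (-p) with hν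
  have hν0 : 0 < ν := by positivity
  clear_value ν σ Cs τ
  -- Radii decrease from `2R` to `R` and levels increase from `k` to `k + M`, both with geometric
  -- gaps.
  have hind : ∀ j : ℕ, ∫⁻ x in Metric.ball x₀ (R * (1 + (1 / 2) ^ j)),
      ENNReal.ofReal (u x - (k + M * (1 - (1 / 2) ^ j))) ^ p ≤
        ENNReal.ofReal (ν * σ ^ j * M ^ p * R ^ (n : ℝ)) := by
    intro j
    induction j with
    | zero =>
      simp only [pow_zero, sub_self, mul_zero, add_zero, mul_one]
      rw [show R * (1 + 1) = 2 * R by ring]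
      exact hA0
    | succ j ih =>
      set e : ℝ := (1 / 2) ^ j with he
      have he0 : 0 < e := by positivity
      have he1 : e ≤ 1 := pow_le_one₀ (by norm_num) (by norm_num)
      have hes : (1 / 2 : ℝ) ^ (j + 1) = e / 2 := by rw [pow_succ, he]; ring
      have hd : 0 < M * (e / 2) := by positivity
      have hlev : k + M * (1 - e / 2) = k + M * (1 - e) + M * (e / 2) := by ring
      have hτe : τ ^ j ≤ e := pow_le_pow_left₀ hτ0.le hτ2 j
      clear_value e
      have hRj : R * (1 + e) - R * (1 + e / 2) = R * (e / 2) := by ring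
      have hρ0 : 0 < R * θ * τ ^ j := by positivity
      have hRe : R ≤ R * (1 + e) := by nlinarith
      have hRe2 : R * (1 + e) ≤ 2 * R := by nlinarith
      have ht : weightedTail n s p (fun y => ENNReal.ofReal (u y - (k + M * (1 - e) + M * (e / 2))))
          x₀ (R * (1 + e)) ≤ ENNReal.ofReal (2 ^ (s * p) * (B * M ^ (p - 1))) := by
        rw [ENNReal.ofReal_mul (by positivity)]
        refine le_trans ?_ (mul_le_mul' le_rfl htail)
        unfold weightedTail
        rw [← mul_assoc, ← ENNReal.ofReal_mul (by positivity), ← Real.mul_rpow two_pos.le hR.le]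
        refine mul_le_mul' (ENNReal.ofReal_le_ofReal
          (Real.rpow_le_rpow (by positivity) hRe2 hsp.le)) ?_
        refine (lintegral_mono_set (compl_subset_compl.2 (Metric.ball_subset_ball hRe))).trans ?_
        refine lintegral_mono fun y => ?_
        have : u y - (k + M * (1 - e) + M * (e / 2)) ≤ u y - k := by nlinarith
        simp only
        gcongr
      have key := hDG.step hs hp hA hF₀ hu (x₀ := x₀) (r := R * (1 + e / 2)) (R := R * (1 + e))
        (ρ := R * θ * τ ^ j) (k := k + M * (1 - e)) (d := M * (e / 2))
        (α := ν * σ ^ j * M ^ p * R ^ (n : ℝ)) (t := 2 ^ (s * p) * (B * M ^ (p - 1)))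
        (by positivity) hωd hρ0 (by
          rw [hRj, mul_assoc]
          have : θ * τ ^ j ≤ 1 / 2 * e := mul_le_mul hθ2 hτe (by positivity) (by norm_num)
          gcongr
          linarith) hd
        ((Metric.closedBall_subset_closedBall hRe2).trans hball) (by positivity) (by positivity)
        ih ?_ ht
      · rw [hes, hlev]
        refine key.trans (ENNReal.ofReal_le_ofReal ?_)
        have hc := deGiorgi_step_constant (A := A) (E := E) (ω := ω) hsp hp hE0 hA hB hF₀ hω hR hM
          hτ0 hθ0 hτsp hFM j he
        rw [← hCs] at hc
        have hα0 : 0 ≤ ν * σ ^ j * M ^ p * R ^ (n : ℝ) := by positivity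
        calc _ ≤ σ * (ν * σ ^ j * M ^ p * R ^ (n : ℝ)) :=
              mul_le_mul_of_nonneg_right (hc.trans hθC) hα0
          _ = _ := by ring
      · rw [hν, hσ]
        exact (deGiorgi_step_excess hR hM hτ0 hθ0 j he).le
  refine ae_le_of_lintegral_excess_le hp0 hu hσ0 hσ1 (c := ν * M ^ p * R ^ (n : ℝ)) fun j => ?_
  refine le_trans ?_ ((hind j).trans_eq (congrArg ENNReal.ofReal (by ring)))
  have he0 : (0 : ℝ) < (1 / 2) ^ j := by positivity
  refine (lintegral_mono_set (Metric.ball_subset_ball (by nlinarith))).trans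
    (lintegral_mono fun x => ?_)
  have : M * (1 - (1 / 2) ^ j) ≤ M := by nlinarith
  gcongr

end Iteration

/-! ### Lowering the upper bound when `u` is below the middle level on half of a ball. -/

section Oscillation

variable {n : ℕ} {s p A F₀ : ℝ} {U : Set (Rn n)} {u : Rn n → ℝ}

theorem volume_ball_two_mul_le {x : Rn n} {ρ : ℝ} (hρ : 0 < ρ) :
    volume (Metric.ball x (4 * ρ)) =
      ENNReal.ofReal (2 ^ (n : ℝ)) * volume (Metric.ball x (2 * ρ)) := by
  rw [volume_ball_eq n x (by positivity), volume_ball_eq n x (by positivity),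
    ← ENNReal.ofReal_mul (by positivity), show 4 * ρ = 2 * (2 * ρ) by ring,
    Real.mul_rpow two_pos.le (by positivity)]
  congr 1
  ring

/-- If a function lies below the middle level in half of a ball, then the gain term controls its
excess over a high level. -/
theorem IsDeGiorgi.excess_mul_le (hs : 0 < s) (hp : 1 < p) (hu : Measurable u)
    {x₀ : Rn n} {ρ c ω k : ℝ} (hρ : 0 < ρ) (hω : 0 < ω) (hk : c + ω / 2 ≤ k)
    (hhalf : volume (Metric.ball x₀ (2 * ρ)) ≤
      2 * volume (Metric.ball x₀ (2 * ρ) ∩ {y | u y ≤ c})) :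
    (∫⁻ x in Metric.ball x₀ (2 * ρ), ENNReal.ofReal (u x - k)) *
      (ENNReal.ofReal ((ω / 2) ^ (p - 1) * (4 * ρ) ^ (-((n : ℝ) + s * p)) / 2) *
        volume (Metric.ball x₀ (2 * ρ))) ≤
    ∫⁻ x in Metric.ball x₀ (2 * ρ), ∫⁻ y in Metric.ball x₀ (4 * ρ) ∩ {y | u y ≤ k},
        ENNReal.ofReal (u x - k) * max (ENNReal.ofReal (u x - k)) (ENNReal.ofReal (k - u y)) ^ (p - 1) *
          ‖x - y‖ₑ ^ (-((n : ℝ) + s * p)) := by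
  have hp1 : 0 < p - 1 := by linarith
  have hsp : 0 < s * p := by positivity
  set E : ℝ := (n : ℝ) + s * p with hE
  have hE0 : 0 < E := by positivity
  rw [← lintegral_mul_const _ (by fun_prop)]
  refine setLIntegral_mono' measurableSet_ball fun x hx => ?_
  have hsub : Metric.ball x₀ (2 * ρ) ∩ {y | u y ≤ c} ⊆ Metric.ball x₀ (4 * ρ) ∩ {y | u y ≤ k} := by
    rintro y ⟨h1, h2⟩
    refine ⟨Metric.ball_subset_ball (by linarith) h1, ?_⟩
    simp only [mem_ofPred_eq] at h2 ⊢
    linarith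
  calc _ ≤ ENNReal.ofReal (u x - k) *
        (ENNReal.ofReal ((ω / 2) ^ (p - 1) * (4 * ρ) ^ (-E) / 2) *
          (2 * volume (Metric.ball x₀ (2 * ρ) ∩ {y | u y ≤ c}))) := by gcongr
    _ = ENNReal.ofReal (u x - k) * ENNReal.ofReal ((ω / 2) ^ (p - 1)) *
        ENNReal.ofReal ((4 * ρ) ^ (-E)) *
          volume (Metric.ball x₀ (2 * ρ) ∩ {y | u y ≤ c}) := by
        have e2 : ENNReal.ofReal ((ω / 2) ^ (p - 1) * (4 * ρ) ^ (-E) / 2) * 2 =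
            ENNReal.ofReal ((ω / 2) ^ (p - 1)) * ENNReal.ofReal ((4 * ρ) ^ (-E)) := by
          rw [← ENNReal.ofReal_ofNat 2, ← ENNReal.ofReal_mul (by positivity),
            div_mul_cancel₀ _ two_ne_zero, ENNReal.ofReal_mul (by positivity)]
        rw [← mul_assoc (ENNReal.ofReal ((ω / 2) ^ (p - 1) * (4 * ρ) ^ (-E) / 2)), e2]
        ring
    _ = ∫⁻ _ in Metric.ball x₀ (2 * ρ) ∩ {y | u y ≤ c}, ENNReal.ofReal (u x - k) *
        ENNReal.ofReal ((ω / 2) ^ (p - 1)) * ENNReal.ofReal ((4 * ρ) ^ (-E)) := by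
        rw [setLIntegral_const]
    _ ≤ ∫⁻ y in Metric.ball x₀ (2 * ρ) ∩ {y | u y ≤ c},
        ENNReal.ofReal (u x - k) * max (ENNReal.ofReal (u x - k)) (ENNReal.ofReal (k - u y)) ^ (p - 1) *
          ‖x - y‖ₑ ^ (-E) := by
        refine setLIntegral_mono' (measurableSet_ball.inter (measurableSet_le hu measurable_const))
          fun y hy => ?_
        have hyc : u y ≤ c := hy.2
        refine mul_le_mul' (mul_le_mul' le_rfl ?_)
          (ofReal_rpow_neg_le_enorm (by positivity) hE0 ?_)
        -- Here the second entry of the maximum is used: `k - u(y) ≥ ω / 2` on `{u ≤ c}`.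
        · rw [← ENNReal.ofReal_rpow_of_pos (by positivity)]
          gcongr
          refine le_trans ?_ (le_max_right _ _)
          exact ENNReal.ofReal_le_ofReal (by linarith)
        · have h1 := Metric.mem_ball.1 hx
          have h2 := Metric.mem_ball.1 hy.1
          have h3 := dist_triangle_right x y x₀
          rw [dist_eq_norm] at h3
          linarith
    _ ≤ _ := lintegral_mono_set hsub

/-- Decay of the excess over a high level. -/
theorem IsDeGiorgi.lintegral_excess_le (hs : 0 < s) (hp : 1 < p) (hA : 0 < A)
    (hu : Measurable u) (hDG : IsDeGiorgi n s p A F₀ U u)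
    {x₀ : Rn n} {ρ c ω m D : ℝ} (hρ : 0 < ρ) (hω : 0 < ω) (hm : 0 < m) (hmω : m ≤ ω / 2)
    (hD : 0 ≤ D) (hball : Metric.closedBall x₀ (4 * ρ) ⊆ U)
    (hup : ∀ᵐ x ∂(volume.restrict (Metric.ball x₀ (4 * ρ))), u x ≤ c + ω)
    (htail : weightedTail n s p (fun y => ENNReal.ofReal (u y - (c + ω - m))) x₀ (4 * ρ) ≤
      ENNReal.ofReal (D * m ^ (p - 1)))
    (hFm : F₀ * (4 * ρ) ^ (s * p) ≤ m ^ p)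
    (hhalf : volume (Metric.ball x₀ (2 * ρ)) ≤
      2 * volume (Metric.ball x₀ (2 * ρ) ∩ {y | u y ≤ c})) :
    ∫⁻ x in Metric.ball x₀ (2 * ρ), ENNReal.ofReal (u x - (c + ω - m)) ≤
      ENNReal.ofReal (A * 2 ^ ((n : ℝ) + s * p + p) * (D + 2) * 2 * 8 ^ (n : ℝ) *
        (m ^ p / (ω / 2) ^ (p - 1)) * ρ ^ (n : ℝ)) := by
  have hp0 : 0 < p := by linarith
  have hp1 : 0 < p - 1 := by linarith
  have hsp : 0 < s * p := by positivity
  have h1 := IsDeGiorgi.excess_mul_le (n := n) (s := s) (p := p) hs hp hu (x₀ := x₀) (c := c) (ω := ω)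
    (k := c + ω - m) hρ hω (by linarith) hhalf
  have h2 := hDG x₀ (2 * ρ) (4 * ρ) (c + ω - m) (by positivity) (by linarith) hball
  have hq : 4 * ρ / (4 * ρ - 2 * ρ) = 2 := by
    rw [show 4 * ρ - 2 * ρ = 2 * ρ by ring]; field_simp; norm_num
  rw [hq] at h2
  have hVfin : volume (Metric.ball x₀ (2 * ρ)) ≠ ∞ := measure_ball_lt_top.ne
  have hVpos : volume (Metric.ball x₀ (2 * ρ)) ≠ 0 := (Metric.measure_ball_pos _ _ (by positivity)).ne'
  have hV4 := volume_ball_two_mul_le (x := x₀) hρ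
  set V := volume (Metric.ball x₀ (2 * ρ)) with hV
  set E : ℝ := (n : ℝ) + s * p with hE
  have hE0 : 0 < E := by positivity
  set k := c + ω - m with hk
  have i1 : ∫⁻ x in Metric.ball x₀ (4 * ρ), ENNReal.ofReal (u x - k) ^ p ≤
      ENNReal.ofReal (m ^ p) * (ENNReal.ofReal (2 ^ (n : ℝ)) * V) := by
    rw [← hV4, ← setLIntegral_const]
    refine lintegral_mono_ae ?_
    filter_upwards [hup] with x hx
    rw [← ENNReal.ofReal_rpow_of_pos hm]
    gcongr
    linarith
  have i2 : ∫⁻ x in Metric.ball x₀ (4 * ρ), ENNReal.ofReal (u x - k) ≤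
      ENNReal.ofReal m * (ENNReal.ofReal (2 ^ (n : ℝ)) * V) := by
    rw [← hV4, ← setLIntegral_const]
    refine lintegral_mono_ae ?_
    filter_upwards [hup] with x hx
    gcongr
    linarith
  have i3 : volume (Metric.ball x₀ (4 * ρ) ∩ {x | k < u x}) ≤ ENNReal.ofReal (2 ^ (n : ℝ)) * V := by
    rw [← hV4]
    exact measure_mono inter_subset_left
  set X := ∫⁻ x in Metric.ball x₀ (2 * ρ), ENNReal.ofReal (u x - k)
  set a := (ω / 2) ^ (p - 1) * (4 * ρ) ^ (-E) / 2 with ha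
  have ha0 : 0 < a := by positivity
  set Q := A * 2 ^ (E + p) * (4 * ρ) ^ (-(s * p)) with hQ
  have hQ0 : 0 < Q := by positivity
  have hmm : m ^ (p - 1) * m = m ^ p := by
    rw [Real.rpow_sub_one hm.ne']; field_simp
  -- As `(u - k)₊ ≤ m` in the larger ball, the three terms of the Caccioppoli inequality contribute
  -- `m^p`, `D m^p` and `m^p` times its volume.
  have h3 : X * ENNReal.ofReal a * V ≤ ENNReal.ofReal (Q * ((D + 2) * m ^ p) * 2 ^ (n : ℝ)) * V := by
    rw [mul_assoc]
    refine (h1.trans h2).trans ?_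
    calc _ ≤ ENNReal.ofReal Q * (ENNReal.ofReal (m ^ p) * (ENNReal.ofReal (2 ^ (n : ℝ)) * V) +
          ENNReal.ofReal (D * m ^ (p - 1)) * (ENNReal.ofReal m * (ENNReal.ofReal (2 ^ (n : ℝ)) * V)) +
          ENNReal.ofReal (m ^ p) * (ENNReal.ofReal (2 ^ (n : ℝ)) * V)) := by gcongr
      _ = _ := by
        rw [ENNReal.ofReal_mul (q := 2 ^ (n : ℝ)) (by positivity), ENNReal.ofReal_mul hQ0.le,
          show (D + 2) * m ^ p = m ^ p + D * m ^ (p - 1) * m + m ^ p by rw [mul_assoc D, hmm]; ring,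
          ENNReal.ofReal_add (by positivity) (by positivity),
          ENNReal.ofReal_add (by positivity) (by positivity), ENNReal.ofReal_mul (q := m) (by positivity)]
        ring
  have h4 := (ENNReal.mul_le_mul_iff_left hVpos hVfin).1 h3
  have h5 : X ≤ ENNReal.ofReal (Q * ((D + 2) * m ^ p) * 2 ^ (n : ℝ) / a) := by
    rw [ENNReal.ofReal_div_of_pos ha0, ENNReal.le_div_iff_mul_le (by simp [ha0]) (by simp)]
    exact h4
  refine h5.trans_eq ?_
  congr 1
  have e1 : (4 * ρ) ^ (-(s * p)) = (4 * ρ) ^ (-E) * (4 ^ (n : ℝ) * ρ ^ (n : ℝ)) := by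
    rw [← Real.mul_rpow (by norm_num) hρ.le, ← Real.rpow_add (by positivity)]
    congr 1
    rw [hE]; ring
  have e2 : (8 : ℝ) ^ (n : ℝ) = 4 ^ (n : ℝ) * 2 ^ (n : ℝ) := by
    rw [← Real.mul_rpow (by norm_num) (by norm_num)]; norm_num
  have e3 : (4 * ρ) ^ (-E) ≠ 0 := by positivity
  have e4 : (ω / 2) ^ (p - 1) ≠ 0 := by positivity
  rw [hQ, e1, e2, ha]
  field_simp

/-- The oscillation is reduced from above if the function lies below the middle level in half of a
small ball. -/
theorem IsDeGiorgi.exists_upper_reduction (n : ℕ) {s p A C₀ : ℝ} (hs : 0 < s) (hp : 1 < p)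
    (hA : 0 < A) (hC₀ : IsTailConst n s p C₀) :
    ∃ δ : ℝ, 0 < δ ∧ δ ≤ 1 / 8 ∧ ∀ (F₀ : ℝ) (U : Set (Rn n)) (u : Rn n → ℝ), 0 ≤ F₀ →
      Measurable u → IsDeGiorgi n s p A F₀ U u → ∀ (x₀ : Rn n) (R L B c ω : ℝ), 0 < R → 0 < ω →
      4 ≤ L → 0 ≤ B → B * (4 / L) ^ (s * p) ≤ (4 * δ) ^ (p - 1) → Metric.closedBall x₀ R ⊆ U →
      (∀ᵐ x ∂(volume.restrict (Metric.ball x₀ R)), u x ≤ c + ω) →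
      weightedTail n s p (fun y => ENNReal.ofReal |u y - c|) x₀ R ≤
        ENNReal.ofReal (B * ω ^ (p - 1)) →
      F₀ * R ^ (s * p) ≤ (2 * δ) ^ p * ω ^ p →
      volume (Metric.ball x₀ (2 * (R / L))) ≤
        2 * volume (Metric.ball x₀ (2 * (R / L)) ∩ {y | u y ≤ c}) →
      ∀ᵐ x ∂(volume.restrict (Metric.ball x₀ (R / L))), u x ≤ c + ω - 2 * δ * ω := by
  have hp0 : 0 < p := by linarith
  have hp1 : 0 < p - 1 := by linarith
  have hsp : 0 < s * p := by positivity
  have hC₀0 := hC₀.1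
  obtain ⟨ν, hν0, hν⟩ := IsDeGiorgi.exists_sup_le n (s := s) (p := p) (A := A)
    (B := (C₀ + 1) * 2 ^ (p - 1)) hs hp hA (by positivity)
  obtain ⟨G, hG⟩ : ∃ G, G = A * 2 ^ ((n : ℝ) + s * p + p) * (C₀ + 1 + 2) * 2 * 8 ^ (n : ℝ) := ⟨_, rfl⟩
  have hG0 : 0 < G := by rw [hG]; positivity
  -- the smallness of the density
  obtain ⟨δ, hδ0, hδ8, hδν⟩ : ∃ δ : ℝ, 0 < δ ∧ δ ≤ 1 / 8 ∧
      (4 * δ) ^ (p - 1) * (G * 2 ^ (p - 1)) * 2 ^ p ≤ ν := by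
    have hcont : Filter.Tendsto (fun δ : ℝ => (4 * δ) ^ (p - 1) * (G * 2 ^ (p - 1)) * 2 ^ p)
        (nhdsWithin 0 (Ioi 0)) (nhds 0) := by
      have h0 : Filter.Tendsto (fun δ : ℝ => (4 * δ) ^ (p - 1)) (nhds 0) (nhds 0) := by
        have : Continuous fun δ : ℝ => (4 * δ) ^ (p - 1) := by
          exact (continuous_const.mul continuous_id).rpow_const fun _ => Or.inr hp1.le
        have h := this.tendsto 0
        simpa [Real.zero_rpow hp1.ne'] using h
      have := (h0.mul_const (G * 2 ^ (p - 1))).mul_const ((2 : ℝ) ^ p)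
      simp only [zero_mul] at this
      exact this.mono_left nhdsWithin_le_nhds
    have h1 := hcont.eventually (ge_mem_nhds hν0)
    have h2 : ∀ᶠ δ : ℝ in nhdsWithin 0 (Ioi 0), δ ≤ 1 / 8 :=
      nhdsWithin_le_nhds (ge_mem_nhds (by norm_num))
    obtain ⟨δ, ⟨h1, h2⟩, h3⟩ := ((h1.and h2).and self_mem_nhdsWithin).exists
    exact ⟨δ, h3, h2, h1⟩
  refine ⟨δ, hδ0, hδ8, ?_⟩
  intro F₀ U u hF₀ hu hDG x₀ R L B c ω hR hω hL hB hBL hball hup htail hF hhalf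
  have hL0 : 0 < L := by linarith
  set ρ := R / L with hρdef
  have hρ : 0 < ρ := by positivity
  have hρR : 4 * ρ ≤ R := by
    rw [hρdef, ← mul_div_assoc, div_le_iff₀ hL0]; nlinarith
  set m := 4 * δ * ω with hm
  have hm0 : 0 < m := by positivity
  have hmω : m ≤ ω / 2 := by rw [hm]; nlinarith
  have hmp : m ^ (p - 1) = (4 * δ) ^ (p - 1) * ω ^ (p - 1) := Real.mul_rpow (by positivity) hω.le
  -- In the tail constant, `C₀` accounts for the points of `B_R`, where `(u - k)₊ ≤ m`, and 1 for
  -- those outside, where large `L` makes the contribution small.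
  have htail' : ∀ r : ℝ, 0 < r → r ≤ 4 * ρ →
      weightedTail n s p (fun y => ENNReal.ofReal (u y - (c + ω - m))) x₀ r ≤
        ENNReal.ofReal ((C₀ + 1) * m ^ (p - 1)) := by
    intro r hr0 hr
    have h1 := weightedTail_le_of_le hp hs hC₀ (f := fun y => ENNReal.ofReal (u y - (c + ω - m)))
      (x₀ := x₀) (x₁ := x₀) (R := R) (ρ := r) (κ := 1) (c := ENNReal.ofReal m) hR hr0 one_pos
      (fun y _ _ => (one_mul _).ge) (by
        filter_upwards [hup] with x hx
        exact ENNReal.ofReal_le_ofReal (by linarith))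
    refine h1.trans ?_
    have h2 : weightedTail n s p (fun y => ENNReal.ofReal (u y - (c + ω - m))) x₀ R ≤
        ENNReal.ofReal (B * ω ^ (p - 1)) := by
      refine le_trans (weightedTail_mono hp (ae_of_all _ fun y => ENNReal.ofReal_le_ofReal ?_)) htail
      have := le_abs_self (u y - c)
      linarith
    have h3 : (r / R) ^ (s * p) ≤ (4 / L) ^ (s * p) := by
      refine Real.rpow_le_rpow (by positivity) ?_ hsp.le
      rw [div_le_div_iff₀ hR hL0]
      calc r * L ≤ 4 * ρ * L := by gcongr
        _ = 4 * R := by rw [hρdef]; field_simp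
    rw [Real.one_rpow, one_mul, ENNReal.ofReal_rpow_of_pos hm0, ← ENNReal.ofReal_mul hC₀0.le]
    refine (add_le_add le_rfl (mul_le_mul' (ENNReal.ofReal_le_ofReal h3) h2)).trans ?_
    rw [← ENNReal.ofReal_mul (by positivity), ← ENNReal.ofReal_add (by positivity) (by positivity)]
    refine ENNReal.ofReal_le_ofReal ?_
    have h4 : (4 / L) ^ (s * p) * (B * ω ^ (p - 1)) ≤ m ^ (p - 1) := by
      rw [hmp]
      calc _ = (B * (4 / L) ^ (s * p)) * ω ^ (p - 1) := by ring
        _ ≤ _ := by gcongr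
    linarith
  have hFρ : ∀ r : ℝ, 0 < r → r ≤ 4 * ρ → F₀ * r ^ (s * p) ≤ (2 * δ * ω) ^ p := by
    intro r hr0 hr
    rw [Real.mul_rpow (by positivity) hω.le]
    refine le_trans ?_ hF
    gcongr
    linarith
  have hex := hDG.lintegral_excess_le hs hp hA hu (x₀ := x₀) (c := c) (ω := ω) (m := m)
    (D := C₀ + 1) hρ hω hm0 hmω (by positivity)
    ((Metric.closedBall_subset_closedBall hρR).trans hball)
    (ae_restrict_of_ae_restrict_of_subset (Metric.ball_subset_ball hρR) hup)
    (htail' _ (by positivity) le_rfl)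
    ((hFρ _ (by positivity) le_rfl).trans (Real.rpow_le_rpow (by positivity) (by
      rw [hm]; nlinarith [mul_pos hδ0 hω]) hp0.le)) hhalf
  rw [← hG] at hex
  have hexp : ∫⁻ x in Metric.ball x₀ (2 * ρ), ENNReal.ofReal (u x - (c + ω - m)) ^ p ≤
      ENNReal.ofReal (ν * (2 * δ * ω) ^ p * ρ ^ (n : ℝ)) := by
    calc _ ≤ ∫⁻ x in Metric.ball x₀ (2 * ρ), ENNReal.ofReal (m ^ (p - 1)) *
          ENNReal.ofReal (u x - (c + ω - m)) := by
          refine lintegral_mono_ae ?_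
          filter_upwards [ae_restrict_of_ae_restrict_of_subset
            (Metric.ball_subset_ball (by linarith : 2 * ρ ≤ R)) hup] with x hx
          rw [← ennreal_mul_rpow_sub_one hp, mul_comm, ← ENNReal.ofReal_rpow_of_pos hm0]
          gcongr
          linarith
      _ ≤ ENNReal.ofReal (m ^ (p - 1)) *
          ENNReal.ofReal (G * (m ^ p / (ω / 2) ^ (p - 1)) * ρ ^ (n : ℝ)) := by
          rw [lintegral_const_mul _ (by fun_prop)]
          gcongr
      _ ≤ _ := by
          rw [← ENNReal.ofReal_mul (by positivity)]
          refine ENNReal.ofReal_le_ofReal ?_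
          have e1 : m ^ p = 2 ^ p * (2 * δ * ω) ^ p := by
            rw [← Real.mul_rpow two_pos.le (by positivity), hm]; congr 1; ring
          have e2 : ω ^ (p - 1) / (ω / 2) ^ (p - 1) = 2 ^ (p - 1) := by
            rw [← Real.div_rpow hω.le (by positivity)]; congr 1; field_simp
          calc _ = ((4 * δ) ^ (p - 1) * (G * (ω ^ (p - 1) / (ω / 2) ^ (p - 1))) * 2 ^ p) *
                (2 * δ * ω) ^ p * ρ ^ (n : ℝ) := by rw [e1, hmp]; ring
            _ ≤ _ := by
                rw [e2]
                gcongr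
  -- Height `m / 2` over level `c + ω - m`: the new upper bound is `c + ω - m / 2`.
  have hfin := hν F₀ U u hF₀ hu hDG x₀ ρ (c + ω - m) (2 * δ * ω) hρ (by positivity)
    ((Metric.closedBall_subset_closedBall (by linarith)).trans hball)
    (hFρ ρ hρ (by linarith))
    ((htail' ρ hρ (by linarith)).trans_eq (by
      congr 1
      rw [mul_assoc, ← Real.mul_rpow two_pos.le (by positivity), hm]
      congr 2
      ring)) hexp
  filter_upwards [hfin] with x hx
  rw [hm] at hx
  linarith

end Oscillation

/-! ### Oscillation decay and Hölder decay at a point. -/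

section Holder

variable {n : ℕ} {s p A F₀ : ℝ} {U : Set (Rn n)} {u : Rn n → ℝ}

/-- The state of the oscillation decay at scale `R`: `u` is within `ω` of `c` in the ball of
radius `R`, with matching bounds on the tail and the right-hand side. -/
structure OscBound (n : ℕ) (s p F₀ B ε : ℝ) (u : Rn n → ℝ) (x₀ : Rn n) (R c ω : ℝ) : Prop where
  abs_le : ∀ᵐ x ∂(volume.restrict (Metric.ball x₀ R)), |u x - c| ≤ ω
  tail_le : weightedTail n s p (fun y => ENNReal.ofReal |u y - c|) x₀ R ≤
    ENNReal.ofReal (B * ω ^ (p - 1))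
  potential_le : F₀ * R ^ (s * p) ≤ ε * ω ^ p

theorem weightedTail_recenter_le (hs : 0 < s) (hp : 1 < p) {C₀ : ℝ} (hC₀ : IsTailConst n s p C₀)
    {x₀ : Rn n} {R L B c c' ω : ℝ} (hR : 0 < R) (hL : 1 ≤ L) (hω : 0 < ω) (hB : 0 ≤ B)
    (hcc : |c' - c| ≤ ω)
    (habs : ∀ᵐ x ∂(volume.restrict (Metric.ball x₀ R)), |u x - c| ≤ ω)
    (htail : weightedTail n s p (fun y => ENNReal.ofReal |u y - c|) x₀ R ≤
      ENNReal.ofReal (B * ω ^ (p - 1))) :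
    weightedTail n s p (fun y => ENNReal.ofReal |u y - c'|) x₀ (R / L) ≤
      ENNReal.ofReal (2 ^ (p - 1) * (C₀ + (1 / L) ^ (s * p) * (B + C₀)) * ω ^ (p - 1)) := by
  have hp1 : 0 < p - 1 := by linarith
  have hL0 : 0 < L := by linarith
  have hC₀0 := hC₀.1
  have htri : ∀ y, |u y - c'| ≤ |u y - c| + ω := fun y => by
    have := abs_sub_le (u y) c c'
    rw [abs_sub_comm c c'] at this
    linarith
  have h1 := weightedTail_le_of_le hp hs hC₀ (f := fun y => ENNReal.ofReal |u y - c'|)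
    (x₀ := x₀) (x₁ := x₀) (R := R) (ρ := R / L) (κ := 1) (c := ENNReal.ofReal (2 * ω)) hR
    (by positivity) one_pos (fun y _ _ => (one_mul _).ge) (by
      filter_upwards [habs] with x hx
      exact ENNReal.ofReal_le_ofReal (by linarith [htri x]))
  have h2 : weightedTail n s p (fun y => ENNReal.ofReal |u y - c'|) x₀ R ≤
      ENNReal.ofReal (2 ^ (p - 1) * ((B + C₀) * ω ^ (p - 1))) := by
    calc _ ≤ weightedTail n s p (fun y => ENNReal.ofReal |u y - c| + ENNReal.ofReal ω) x₀ R := by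
          refine weightedTail_mono hp (ae_of_all _ fun y => ?_)
          rw [← ENNReal.ofReal_add (abs_nonneg _) hω.le]
          exact ENNReal.ofReal_le_ofReal (htri y)
      _ ≤ ENNReal.ofReal (2 ^ (p - 1)) * (ENNReal.ofReal (B * ω ^ (p - 1)) +
          ENNReal.ofReal C₀ * ENNReal.ofReal ω ^ (p - 1)) := by
          refine (weightedTail_add_const_le hp hC₀ hR _).trans ?_
          gcongr
      _ = _ := by
          rw [ENNReal.ofReal_rpow_of_pos hω, ← ENNReal.ofReal_mul hC₀0.le,
            ← ENNReal.ofReal_add (by positivity) (by positivity),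
            ← ENNReal.ofReal_mul (by positivity), add_mul]
  refine (h1.trans (add_le_add le_rfl (mul_le_mul' le_rfl h2))).trans_eq ?_
  rw [ENNReal.ofReal_rpow_of_pos (by positivity), ← ENNReal.ofReal_mul hC₀0.le,
    ← ENNReal.ofReal_mul (by positivity), ← ENNReal.ofReal_add (by positivity) (by positivity),
    Real.one_rpow, Real.mul_rpow two_pos.le hω.le, show R / L / R = 1 / L by field_simp]
  congr 1
  ring

theorem exists_scale {e b : ℝ} (he : 0 < e) (hb : 0 < b) :
    ∃ L : ℝ, 4 ≤ L ∧ (1 / L) ^ e ≤ b := by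
  refine ⟨max 4 (b ^ (-(1 / e))), le_max_left _ _, ?_⟩
  have h0 : 0 < b ^ (-(1 / e)) := by positivity
  calc (1 / max 4 (b ^ (-(1 / e)))) ^ e ≤ (1 / (b ^ (-(1 / e)))) ^ e := by
        gcongr
        exact le_max_right _ _
    _ = b := by
        rw [one_div, ← Real.rpow_neg hb.le, neg_neg, ← Real.rpow_mul hb.le,
          one_div_mul_cancel he.ne', Real.rpow_one]

/-- One step of the oscillation decay. -/
theorem IsDeGiorgi.exists_oscBound_step (n : ℕ) {s p A C₀ : ℝ} (hs : 0 < s) (hp : 1 < p)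
    (hA : 0 < A) (hC₀ : IsTailConst n s p C₀) :
    ∃ δ L B ε : ℝ, 0 < δ ∧ δ ≤ 1 / 8 ∧ 4 ≤ L ∧ 0 < B ∧ 0 < ε ∧ C₀ ≤ B ∧ 1 ≤ B ∧
      ∀ (F₀ : ℝ) (U : Set (Rn n)) (u : Rn n → ℝ), 0 ≤ F₀ →
      Measurable u → IsDeGiorgi n s p A F₀ U u → IsDeGiorgi n s p A F₀ U (fun x => -u x) →
      ∀ (x₀ : Rn n) (R c ω : ℝ), 0 < R → 0 < ω → Metric.closedBall x₀ R ⊆ U →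
      OscBound n s p F₀ B ε u x₀ R c ω →
      ∃ c', |c' - c| ≤ δ * ω ∧ OscBound n s p F₀ B ε u x₀ (R / L) c' ((1 - δ) * ω) := by
  have hp0 : 0 < p := by linarith
  have hp1 : 0 < p - 1 := by linarith
  have hsp : 0 < s * p := by positivity
  have hC₀0 := hC₀.1
  obtain ⟨δ, hδ0, hδ8, hδ⟩ := IsDeGiorgi.exists_upper_reduction n hs hp hA hC₀
  -- `B` reproduces itself: recentring costs `2^(p-1)`, passing from `ω` to `(1 - δ) ω ≥ ω / 2`
  -- costs another `2^(p-1)`, and the old tail contributes at most 1 for large `L`.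
  obtain ⟨B, hBd⟩ : ∃ B, B = 4 ^ (p - 1) * (C₀ + 1) := ⟨_, rfl⟩
  have h4 : (1 : ℝ) ≤ 4 ^ (p - 1) := Real.one_le_rpow (by norm_num) hp1.le
  have hB0 : 0 < B := by rw [hBd]; positivity
  have hBC : C₀ + 1 ≤ B := by rw [hBd]; nlinarith
  -- The three bounds serve, in order, the tail condition of the upper reduction, the reproduction
  -- of the tail bound, and that of the potential bound.
  obtain ⟨L, hL4, hLs⟩ := exists_scale hsp
    (b := min (min ((4 * δ) ^ (p - 1) / (B * 4 ^ (s * p))) (1 / (B + C₀))) ((1 / 2) ^ p))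
    (by positivity)
  have hL0 : 0 < L := by linarith
  have hLs1 : (1 / L) ^ (s * p) ≤ (4 * δ) ^ (p - 1) / (B * 4 ^ (s * p)) :=
    hLs.trans ((min_le_left _ _).trans (min_le_left _ _))
  have hLs2 : (1 / L) ^ (s * p) ≤ 1 / (B + C₀) :=
    hLs.trans ((min_le_left _ _).trans (min_le_right _ _))
  have hLs3 : (1 / L) ^ (s * p) ≤ (1 / 2) ^ p := hLs.trans (min_le_right _ _)
  refine ⟨δ, L, B, (2 * δ) ^ p, hδ0, hδ8, hL4, hB0, by positivity, by linarith, by linarith, ?_⟩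
  intro F₀ U u hF₀ hu hDG hDG' x₀ R c ω hR hω hball hosc
  have hBL : B * (4 / L) ^ (s * p) ≤ (4 * δ) ^ (p - 1) := by
    rw [le_div_iff₀ (by positivity)] at hLs1
    rw [show (4 : ℝ) / L = 4 * (1 / L) by ring, Real.mul_rpow (by norm_num) (by positivity)]
    linarith
  have hRL : R / L ≤ R := div_le_self hR.le (by linarith)
  have hδω : (1 - δ) * ω ≥ ω / 2 := by nlinarith
  have hω' : 0 < (1 - δ) * ω := by linarith
  have htailc : ∀ c', |c' - c| ≤ ω →
      weightedTail n s p (fun y => ENNReal.ofReal |u y - c'|) x₀ (R / L) ≤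
        ENNReal.ofReal (B * ((1 - δ) * ω) ^ (p - 1)) := by
    intro c' hc'
    refine (weightedTail_recenter_le hs hp hC₀ hR (by linarith) hω hB0.le hc' hosc.abs_le
      hosc.tail_le).trans (ENNReal.ofReal_le_ofReal ?_)
    have e1 : (ω / 2) ^ (p - 1) ≤ ((1 - δ) * ω) ^ (p - 1) :=
      Real.rpow_le_rpow (by positivity) hδω hp1.le
    have e2 : (1 / L) ^ (s * p) * (B + C₀) ≤ 1 := by
      rwa [le_div_iff₀ (by positivity)] at hLs2
    have e3 : (4 : ℝ) ^ (p - 1) = 2 ^ (p - 1) * 2 ^ (p - 1) := by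
      rw [← Real.mul_rpow two_pos.le two_pos.le]; norm_num
    have e4 : ω ^ (p - 1) = 2 ^ (p - 1) * (ω / 2) ^ (p - 1) := by
      rw [← Real.mul_rpow two_pos.le (by positivity)]; congr 1; ring
    calc _ ≤ 2 ^ (p - 1) * (C₀ + 1) * ω ^ (p - 1) := by gcongr
      _ = B * (ω / 2) ^ (p - 1) := by rw [hBd, e3, e4]; ring
      _ ≤ _ := by gcongr
  have hpot : F₀ * (R / L) ^ (s * p) ≤ (2 * δ) ^ p * ((1 - δ) * ω) ^ p := by
    have e1 : (ω / 2) ^ p ≤ ((1 - δ) * ω) ^ p := Real.rpow_le_rpow (by positivity) hδω hp0.le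
    have e2 : (R / L) ^ (s * p) = R ^ (s * p) * (1 / L) ^ (s * p) := by
      rw [← Real.mul_rpow hR.le (by positivity)]; congr 1; ring
    calc _ = (F₀ * R ^ (s * p)) * (1 / L) ^ (s * p) := by rw [e2]; ring
      _ ≤ ((2 * δ) ^ p * ω ^ p) * (1 / 2) ^ p := by
          exact mul_le_mul hosc.potential_le hLs3 (by positivity) (by positivity)
      _ = (2 * δ) ^ p * (ω / 2) ^ p := by
          rw [mul_assoc, ← Real.mul_rpow hω.le (by norm_num)]; congr 2; ring
      _ ≤ _ := by gcongr
  have hρ : 0 < R / L := by positivity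
  have hsub := ae_restrict_of_ae_restrict_of_subset (Metric.ball_subset_ball hRL) hosc.abs_le
  have hdich : volume (Metric.ball x₀ (2 * (R / L))) ≤
      2 * volume (Metric.ball x₀ (2 * (R / L)) ∩ {y | u y ≤ c}) ∨
      volume (Metric.ball x₀ (2 * (R / L))) ≤
      2 * volume (Metric.ball x₀ (2 * (R / L)) ∩ {y | -u y ≤ -c}) := by
    have h1 : volume (Metric.ball x₀ (2 * (R / L))) ≤
        volume (Metric.ball x₀ (2 * (R / L)) ∩ {y | u y ≤ c}) +
        volume (Metric.ball x₀ (2 * (R / L)) ∩ {y | -u y ≤ -c}) := by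
      refine (measure_mono fun y hy => ?_).trans (measure_union_le _ _)
      rcases le_total (u y) c with h | h
      · exact Or.inl ⟨hy, h⟩
      · exact Or.inr ⟨hy, neg_le_neg h⟩
    rcases le_total (volume (Metric.ball x₀ (2 * (R / L)) ∩ {y | u y ≤ c}))
      (volume (Metric.ball x₀ (2 * (R / L)) ∩ {y | -u y ≤ -c})) with h | h
    · right
      rw [two_mul (volume _)]
      exact h1.trans (add_le_add h le_rfl)
    · left
      rw [two_mul (volume _)]
      exact h1.trans (add_le_add le_rfl h)
  rcases hdich with hhalf | hhalf
  · have hup := hδ F₀ U u hF₀ hu hDG x₀ R L B c ω hR hω hL4 hB0.le hBL hball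
      (hosc.abs_le.mono fun x hx => by linarith [(abs_le.1 hx).2]) hosc.tail_le
      hosc.potential_le hhalf
    -- The interval `[c - ω, c + ω - 2δω]` has centre `c - δω` and half-length `(1 - δ) ω`.
    refine ⟨c - δ * ω, ?_, ?_, htailc _ ?_, hpot⟩
    · rw [sub_sub_cancel_left, abs_neg, abs_of_pos (by positivity)]
    · filter_upwards [hup, hsub] with x h1 h2
      rw [abs_le] at h2 ⊢
      constructor <;> linarith [h2.1]
    · rw [sub_sub_cancel_left, abs_neg, abs_of_pos (by positivity)]
      nlinarith
  · have hup := hδ F₀ U (fun x => -u x) hF₀ hu.neg hDG' x₀ R L B (-c) ω hR hω hL4 hB0.le hBL hball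
      (hosc.abs_le.mono fun x hx => by linarith [(abs_le.1 hx).1])
      (by
        refine le_trans (le_of_eq ?_) hosc.tail_le
        congr 1
        funext y
        rw [abs_sub_comm]
        congr 2
        ring) hosc.potential_le hhalf
    refine ⟨c + δ * ω, ?_, ?_, htailc _ ?_, hpot⟩
    · rw [add_sub_cancel_left, abs_of_pos (by positivity)]
    · filter_upwards [hup, hsub] with x h1 h2
      rw [abs_le] at h2 ⊢
      constructor <;> linarith [h2.2]
    · rw [add_sub_cancel_left, abs_of_pos (by positivity)]
      nlinarith

/-- The remaining steps sum to `δ ω (1 - δ)^j / (1 - (1 - δ)) = ω (1 - δ)^j`. -/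
theorem exists_limit_of_geometric {c : ℕ → ℝ} {δ ω : ℝ} (hδ0 : 0 < δ)
    (h : ∀ j, |c (j + 1) - c j| ≤ δ * (ω * (1 - δ) ^ j)) :
    ∃ l, ∀ j, |c j - l| ≤ ω * (1 - δ) ^ j := by
  have h' : ∀ j, dist (c j) (c (j + 1)) ≤ δ * ω * (1 - δ) ^ j := fun j => by
    rw [dist_comm, Real.dist_eq, mul_assoc]
    exact h j
  have hr : 1 - δ < 1 := by linarith
  obtain ⟨l, hl⟩ := cauchySeq_tendsto_of_complete (cauchySeq_of_le_geometric _ _ hr h')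
  refine ⟨l, fun j => ?_⟩
  have := dist_le_of_le_geometric_of_tendsto _ _ hr h' hl j
  rw [Real.dist_eq, sub_sub_cancel] at this
  refine this.trans_eq ?_
  field_simp

/-- Geometric decay of the oscillation implies a Hölder estimate at a point. -/
theorem IsDeGiorgi.exists_holder_at (n : ℕ) {s p A C₀ : ℝ} (hs : 0 < s) (hp : 1 < p)
    (hA : 0 < A) (hC₀ : IsTailConst n s p C₀) :
    ∃ α C B ε : ℝ, 0 < α ∧ α < 1 ∧ 0 < C ∧ 1 ≤ B ∧ 0 < ε ∧ ∀ (F₀ : ℝ) (U : Set (Rn n))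
      (u : Rn n → ℝ), 0 ≤ F₀ →
      Measurable u → IsDeGiorgi n s p A F₀ U u → IsDeGiorgi n s p A F₀ U (fun x => -u x) →
      ∀ (x₀ : Rn n) (R ω : ℝ), 0 < R → 0 < ω → Metric.closedBall x₀ R ⊆ U →
      OscBound n s p F₀ B ε u x₀ R 0 ω →
      ∃ c, ∀ r, 0 < r → r ≤ R → ∀ᵐ x ∂(volume.restrict (Metric.ball x₀ r)),
        |u x - c| ≤ C * ω * (r / R) ^ α := by
  obtain ⟨δ, L, B, ε, hδ0, hδ8, hL4, hB0, hε0, -, hB1, hstep⟩ :=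
    IsDeGiorgi.exists_oscBound_step n hs hp hA hC₀
  have hL0 : 0 < L := by linarith
  have hL1 : 1 < L := by linarith
  have hlL : 0 < Real.log L := Real.log_pos hL1
  have hδ1 : 0 < 1 - δ := by linarith
  set α := -Real.log (1 - δ) / Real.log L with hα
  have hlδ : Real.log (1 - δ) < 0 := Real.log_neg hδ1 (by linarith)
  have hα0 : 0 < α := div_pos (by linarith) hlL
  -- `α` solves `L^(-α) = 1 - δ`, and `1 / L ≤ 1/4 < 7/8 ≤ 1 - δ`.
  have hα1 : α < 1 := by
    rw [hα, div_lt_one hlL, ← Real.log_inv]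
    refine Real.log_lt_log (by positivity) ?_
    rw [inv_lt_comm₀ hδ1 hL0]
    have : L⁻¹ ≤ 4⁻¹ := inv_anti₀ (by norm_num) hL4
    linarith
  have hLα : (1 / L) ^ α = 1 - δ := by
    rw [one_div, Real.inv_rpow hL0.le, ← Real.rpow_neg hL0.le, Real.rpow_def_of_pos hL0, hα]
    rw [show Real.log L * -(-Real.log (1 - δ) / Real.log L) = Real.log (1 - δ) by field_simp]
    exact Real.exp_log hδ1
  refine ⟨α, 2 * L ^ α, B, ε, hα0, hα1, by positivity, hB1, hε0, ?_⟩
  intro F₀ U u hF₀ hu hDG hDG' x₀ R ω hR hω hball hosc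
  have hω_pos : ∀ j : ℕ, 0 < ω * (1 - δ) ^ j := fun j => by positivity
  have hRj : ∀ j : ℕ, 0 < R / L ^ j := fun j => by positivity
  have hRjle : ∀ j : ℕ, R / L ^ j ≤ R := fun j => div_le_self hR.le (one_le_pow₀ hL1.le)
  -- The state is a premise inside the existential, so that `choose` gives a successor function
  -- defined for all centres.
  have hnext : ∀ (j : ℕ) (c : ℝ), ∃ c', OscBound n s p F₀ B ε u x₀ (R / L ^ j) c (ω * (1 - δ) ^ j) →
      |c' - c| ≤ δ * (ω * (1 - δ) ^ j) ∧
        OscBound n s p F₀ B ε u x₀ (R / L ^ (j + 1)) c' (ω * (1 - δ) ^ (j + 1)) := by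
    intro j c
    by_cases h : OscBound n s p F₀ B ε u x₀ (R / L ^ j) c (ω * (1 - δ) ^ j)
    · obtain ⟨c', h1, h2⟩ := hstep F₀ U u hF₀ hu hDG hDG' x₀ (R / L ^ j) c _ (hRj j) (hω_pos j)
        ((Metric.closedBall_subset_closedBall (hRjle j)).trans hball) h
      refine ⟨c', fun _ => ⟨h1, ?_⟩⟩
      rw [div_div, ← pow_succ] at h2
      convert h2 using 1
      rw [pow_succ]; ring
    · exact ⟨c, fun h' => absurd h' h⟩
  choose f hf using hnext
  set c : ℕ → ℝ := fun j => Nat.rec 0 (fun j c => f j c) j with hc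
  have hosc_j : ∀ j, OscBound n s p F₀ B ε u x₀ (R / L ^ j) (c j) (ω * (1 - δ) ^ j) := by
    intro j
    induction j with
    | zero => simpa [hc] using hosc
    | succ j ih => exact (hf j (c j) ih).2
  obtain ⟨l, hl⟩ := exists_limit_of_geometric (c := c) (ω := ω) hδ0
    fun j => (hf j (c j) (hosc_j j)).1
  refine ⟨l, fun r hr hrR => ?_⟩
  obtain ⟨j, hj1, hj2⟩ := exists_nat_pow_near (x := R / r) (y := L) ((one_le_div hr).2 hrR) hL1
  have hrj : r ≤ R / L ^ j := by
    rw [le_div_iff₀ (by positivity)]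
    rw [le_div_iff₀ hr] at hj1
    linarith
  have hpow : (1 - δ) ^ j ≤ L ^ α * (r / R) ^ α := by
    rw [← hLα, ← Real.rpow_natCast, ← Real.rpow_mul (by positivity), mul_comm α,
      Real.rpow_mul (by positivity), Real.rpow_natCast, ← Real.mul_rpow hL0.le (by positivity)]
    refine Real.rpow_le_rpow (by positivity) ?_ hα0.le
    rw [div_lt_iff₀ hr] at hj2
    rw [one_div, inv_pow, ← mul_div_assoc, le_div_iff₀ hR, inv_mul_le_iff₀ (by positivity)]
    rw [pow_succ] at hj2
    linarith
  filter_upwards [ae_restrict_of_ae_restrict_of_subset (Metric.ball_subset_ball hrj)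
    (hosc_j j).abs_le] with x hx
  calc |u x - l| ≤ |u x - c j| + |c j - l| := abs_sub_le _ _ _
    _ ≤ ω * (1 - δ) ^ j + ω * (1 - δ) ^ j := add_le_add hx (hl j)
    _ = 2 * ω * (1 - δ) ^ j := by ring
    _ ≤ 2 * ω * (L ^ α * (r / R) ^ α) := by gcongr
    _ = _ := by ring

end Holder

/-! ### Local boundedness, and Hölder decay about every point of a ball. -/

section LocalEstimate

variable {n : ℕ} {s p A F₀ : ℝ} {U : Set (Rn n)} {u : Rn n → ℝ}

theorem exists_one_le_rpow_ge (a : ℝ) {q : ℝ} (hq : 0 < q) : ∃ H : ℝ, 1 ≤ H ∧ a ≤ H ^ q := by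
  have h1 : 1 ≤ max 1 a := le_max_left _ _
  refine ⟨(max 1 a) ^ (1 / q), Real.one_le_rpow h1 (by positivity), ?_⟩
  rw [← Real.rpow_mul (by linarith), one_div_mul_cancel hq.ne', Real.rpow_one]
  exact le_max_right _ _

/-- Two-sided version of De Giorgi's lemma at level zero. -/
theorem IsDeGiorgi.exists_abs_le (n : ℕ) {s p A B : ℝ} (hs : 0 < s) (hp : 1 < p) (hA : 0 < A)
    (hB : 0 ≤ B) :
    ∃ H : ℝ, 1 ≤ H ∧ ∀ (F₀ : ℝ) (U : Set (Rn n)) (u : Rn n → ℝ), 0 ≤ F₀ → Measurable u →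
      IsDeGiorgi n s p A F₀ U u → IsDeGiorgi n s p A F₀ U (fun x => -u x) →
      ∀ (x₀ : Rn n) (R M : ℝ), 0 < R → 0 < M →
      Metric.closedBall x₀ (2 * R) ⊆ U → F₀ * R ^ (s * p) ≤ M ^ p →
      weightedTail n s p (fun y => ENNReal.ofReal |u y|) x₀ R ≤
        ENNReal.ofReal (B * M ^ (p - 1)) →
      ∫⁻ x in Metric.ball x₀ (2 * R), ENNReal.ofReal |u x| ^ p ≤
        ENNReal.ofReal (2 ^ (n : ℝ) * M ^ p * R ^ (n : ℝ)) →
      ∀ᵐ x ∂(volume.restrict (Metric.ball x₀ R)), |u x| ≤ H * M := by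
  have hp0 : 0 < p := by linarith
  have hp1 : 0 < p - 1 := by linarith
  obtain ⟨ν, hν0, hν⟩ := IsDeGiorgi.exists_sup_le n (s := s) (p := p) (A := A) (B := B) hs hp hA hB
  -- De Giorgi's lemma is applied at level 0 with height `H M`; a large `H` makes any excess
  -- comparable to `M^p` relatively small.
  obtain ⟨H, hH1, hHν⟩ := exists_one_le_rpow_ge (2 ^ (n : ℝ) / ν) hp0
  refine ⟨H, hH1, ?_⟩
  intro F₀ U u hF₀ hu hDG hDG' x₀ R M hR hM hball hF htail hint
  have hH0 : 0 < H := by linarith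
  have hHM : M ≤ H * M := le_mul_of_one_le_left hM.le hH1
  have key : ∀ v : Rn n → ℝ, Measurable v → IsDeGiorgi n s p A F₀ U v → (∀ x, v x ≤ |u x|) →
      ∀ᵐ x ∂(volume.restrict (Metric.ball x₀ R)), v x ≤ 0 + H * M := by
    intro v hv hvDG hvu
    refine hν F₀ U v hF₀ hv hvDG x₀ R 0 (H * M) hR (by positivity) hball
      (hF.trans (by gcongr)) ?_ ?_
    · refine (weightedTail_mono hp (ae_of_all _ fun y => ?_)).trans (htail.trans ?_)
      · rw [sub_zero]
        exact ENNReal.ofReal_le_ofReal (hvu y)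
      · exact ENNReal.ofReal_le_ofReal (by gcongr)
    · refine le_trans (lintegral_mono fun x => ?_) (hint.trans (ENNReal.ofReal_le_ofReal ?_))
      · rw [sub_zero]
        have := hvu x
        gcongr
      · rw [Real.mul_rpow hH0.le hM.le]
        rw [div_le_iff₀ hν0] at hHν
        calc _ ≤ (H ^ p * ν) * M ^ p * R ^ (n : ℝ) := by gcongr
          _ = _ := by ring
  filter_upwards [key u hu hDG fun x => le_abs_self _,
    key (fun x => -u x) hu.neg hDG' fun x => neg_le_abs _] with x h1 h2
  rw [abs_le]
  constructor <;> linarith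

/-- The local estimate for functions in the De Giorgi class. -/
theorem IsDeGiorgi.exists_local_estimate (n : ℕ) {s p A C₀ : ℝ} (hs : 0 < s) (hp : 1 < p)
    (hA : 0 < A) (hC₀ : IsTailConst n s p C₀) :
    ∃ α C : ℝ, 0 < α ∧ α < 1 ∧ 0 < C ∧ ∀ (F₀ : ℝ) (U : Set (Rn n)) (u : Rn n → ℝ), 0 ≤ F₀ →
      Measurable u → IsDeGiorgi n s p A F₀ U u → IsDeGiorgi n s p A F₀ U (fun x => -u x) →
      ∀ (x₀ : Rn n) (R M : ℝ), 0 < R → 0 < M →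
      Metric.closedBall x₀ (2 * R) ⊆ U → F₀ * R ^ (s * p) ≤ M ^ p →
      weightedTail n s p (fun y => ENNReal.ofReal |u y|) x₀ R ≤ ENNReal.ofReal (M ^ (p - 1)) →
      ∫⁻ x in Metric.ball x₀ (2 * R), ENNReal.ofReal |u x| ^ p ≤
        ENNReal.ofReal (M ^ p * R ^ (n : ℝ)) →
      (∀ᵐ x ∂(volume.restrict (Metric.ball x₀ R)), |u x| ≤ C * M) ∧
      ∀ x₁ ∈ Metric.ball x₀ R, ∃ c, ∀ r, 0 < r → r ≤ R / 2 →
        ∀ᵐ x ∂(volume.restrict (Metric.ball x₁ r)), |u x - c| ≤ C * M * (r / R) ^ α := by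
  have hp0 : 0 < p := by linarith
  have hp1 : 0 < p - 1 := by linarith
  have hsp : 0 < s * p := by positivity
  have hC₀0 := hC₀.1
  obtain ⟨H, hH1, hH⟩ := IsDeGiorgi.exists_abs_le n (B := 1) hs hp hA zero_le_one
  -- `T` bounds the tail about `x₁` at radius `R / 2`: the first summand comes from `B_R(x₀)`, where
  -- `|u| ≤ H M`; the second from outside, where `|y - x₀| ≤ 3 |y - x₁|`.
  obtain ⟨T, hT⟩ : ∃ T, T = C₀ * H ^ (p - 1) + 3 ^ ((n : ℝ) + s * p) * (1 / 2) ^ (s * p) :=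
    ⟨_, rfl⟩
  have hH0 : 0 < H := by linarith
  have hT0 : 0 < T := by rw [hT]; positivity
  obtain ⟨H', hH1', hH'⟩ := IsDeGiorgi.exists_abs_le n (B := T) hs hp hA hT0.le
  obtain ⟨α, C, B, ε, hα0, hα1, hC, hB1, hε0, hhol⟩ := IsDeGiorgi.exists_holder_at n hs hp hA hC₀
  obtain ⟨H₁, hH₁1, hH₁⟩ := exists_one_le_rpow_ge T hp1
  obtain ⟨H₂, hH₂1, hH₂⟩ := exists_one_le_rpow_ge (1 / ε) hp0
  -- `H₃ M` starts the oscillation decay at centre value 0: `H'` serves the supremum bound, `H₁` the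
  -- tail bound and `H₂` the potential bound.
  obtain ⟨H₃, hH₃⟩ : ∃ H₃, H₃ = max H' (max H₁ H₂) := ⟨_, rfl⟩
  have hH3' : H' ≤ H₃ := hH₃ ▸ le_max_left _ _
  have hH31 : H₁ ≤ H₃ := hH₃ ▸ (le_max_left _ _).trans (le_max_right _ _)
  have hH32 : H₂ ≤ H₃ := hH₃ ▸ (le_max_right _ _).trans (le_max_right _ _)
  have hH30 : 0 < H₃ := by linarith
  have hH₁0 : 0 < H₁ := by linarith
  have hH₂0 : 0 < H₂ := by linarith
  refine ⟨α, max H (C * H₃ * 2 ^ α), hα0, hα1, by positivity, ?_⟩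
  intro F₀ U u hF₀ hu hDG hDG' x₀ R M hR hM hball hF htail hint
  have hsup := hH F₀ U u hF₀ hu hDG hDG' x₀ R M hR hM hball hF (by rwa [one_mul])
    (hint.trans (ENNReal.ofReal_le_ofReal (by
      rw [mul_assoc]
      exact le_mul_of_one_le_left (by positivity) (Real.one_le_rpow one_le_two (by positivity)))))
  refine ⟨hsup.mono fun x hx => hx.trans ?_, fun x₁ hx₁ => ?_⟩
  · gcongr
    exact le_max_left _ _
  have hx₁' : dist x₁ x₀ < R := hx₁
  have htail1 : weightedTail n s p (fun y => ENNReal.ofReal |u y|) x₁ (R / 2) ≤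
      ENNReal.ofReal (T * M ^ (p - 1)) := by
    have h1 := weightedTail_le_of_le hp hs hC₀ (f := fun y => ENNReal.ofReal |u y|)
      (x₀ := x₀) (x₁ := x₁) (R := R) (ρ := R / 2) (κ := 3) (c := ENNReal.ofReal (H * M)) hR
      (by positivity) (by norm_num) (fun y _ hy => by
        have := dist_triangle y x₁ x₀
        rw [dist_eq_norm, dist_eq_norm y x₁] at this
        linarith) (by
        filter_upwards [hsup] with x hx
        exact ENNReal.ofReal_le_ofReal hx)
    refine (h1.trans (add_le_add le_rfl (mul_le_mul' le_rfl htail))).trans_eq ?_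
    rw [ENNReal.ofReal_rpow_of_pos (by positivity), ← ENNReal.ofReal_mul hC₀0.le,
      ← ENNReal.ofReal_mul (by positivity), ← ENNReal.ofReal_add (by positivity) (by positivity),
      Real.mul_rpow hH0.le hM.le, show R / 2 / R = 1 / 2 by field_simp, hT]
    congr 1
    ring
  have hR2 : 2 * (R / 2) = R := by ring
  have hF2 : F₀ * (R / 2) ^ (s * p) ≤ M ^ p := by
    refine le_trans ?_ hF
    gcongr
    linarith
  have hball1 : Metric.closedBall x₁ R ⊆ U :=
    (Metric.closedBall_subset_closedBall' (by linarith)).trans hball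
  -- `B_{R/2}(x₁)` may leave `B_R(x₀)`, so boundedness is proved anew about `x₁`, from the integral
  -- over `B_R(x₁) ⊆ B_{2R}(x₀)`. The factor `2^n` in `IsDeGiorgi.exists_abs_le` absorbs the halved
  -- radius.
  have hsup1 := hH' F₀ U u hF₀ hu hDG hDG' x₁ (R / 2) M (by positivity) hM (by rwa [hR2]) hF2
    htail1 (by
      rw [hR2]
      refine (lintegral_mono_set (Metric.ball_subset_ball' (by linarith))).trans (hint.trans_eq ?_)
      rw [Real.div_rpow hR.le two_pos.le]
      congr 1
      have : (2 : ℝ) ^ (n : ℝ) ≠ 0 := by positivity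
      field_simp)
  obtain ⟨c, hc⟩ := hhol F₀ U u hF₀ hu hDG hDG' x₁ (R / 2) (H₃ * M) (by positivity) (by positivity)
    ((Metric.closedBall_subset_closedBall (by linarith)).trans hball1)
    ⟨hsup1.mono fun x hx => by
        rw [sub_zero]
        exact hx.trans (by gcongr), by
        simp only [sub_zero]
        refine htail1.trans (ENNReal.ofReal_le_ofReal ?_)
        rw [Real.mul_rpow hH30.le hM.le]
        have h1 : T ≤ H₃ ^ (p - 1) := hH₁.trans (by gcongr)
        calc T * M ^ (p - 1) ≤ H₃ ^ (p - 1) * M ^ (p - 1) := by gcongr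
          _ ≤ _ := le_mul_of_one_le_left (by positivity) hB1, by
        refine hF2.trans ?_
        rw [Real.mul_rpow hH30.le hM.le, ← mul_assoc]
        refine le_mul_of_one_le_left (by positivity) ?_
        have h1 : 1 / ε ≤ H₃ ^ p := hH₂.trans (by gcongr)
        rw [div_le_iff₀ hε0] at h1
        linarith⟩
  refine ⟨c, fun r hr hrR => ?_⟩
  filter_upwards [hc r hr hrR] with x hx
  refine hx.trans ?_
  have e1 : (r / (R / 2)) ^ α = 2 ^ α * (r / R) ^ α := by
    rw [← Real.mul_rpow two_pos.le (by positivity)]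
    congr 1
    field_simp
  rw [e1]
  calc _ = C * H₃ * 2 ^ α * M * (r / R) ^ α := by ring
    _ ≤ _ := by
      gcongr
      exact le_max_right _ _

end LocalEstimate

/-! ### Invariance of minimizers under null modifications and sign change; finiteness of tails. -/

section Minimizer

variable {n : ℕ} {s p : ℝ} {Ω : Set (Rn n)} {K : Rn n → Rn n → ℝ} {F : Rn n → ℝ → ℝ}
  {u w : Rn n → ℝ}

theorem ae_prod_of_ae {P : Rn n → Prop} (h : ∀ᵐ x, P x) :
    ∀ᵐ z : Rn n × Rn n, P z.1 ∧ P z.2 := by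
  rw [Measure.volume_eq_prod]
  exact (Measure.quasiMeasurePreserving_fst.ae h).and (Measure.quasiMeasurePreserving_snd.ae h)

theorem energy_congr (h : u =ᵐ[volume] w) : energy p K F Ω u = energy p K F Ω w := by
  unfold energy
  congr 1
  · congr 2
    refine lintegral_congr_ae (ae_restrict_of_ae ?_)
    filter_upwards [ae_prod_of_ae h] with z hz
    rw [hz.1, hz.2]
  · congr 1
    refine integral_congr_ae (ae_restrict_of_ae ?_)
    filter_upwards [h] with x hx
    rw [hx]

theorem MemW.congr (h : u =ᵐ[volume] w) (hu : MemW n s p Ω u) : MemW n s p Ω w := by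
  refine ⟨hu.1.congr h, hu.2.1.ae_eq (ae_restrict_of_ae h), lt_of_eq_of_lt ?_ hu.2.2⟩
  refine lintegral_congr_ae (ae_restrict_of_ae ?_)
  filter_upwards [ae_prod_of_ae h] with z hz
  rw [hz.1, hz.2]

theorem IsMinimizer.congr (h : u =ᵐ[volume] w) (hu : IsMinimizer s p K F Ω u) :
    IsMinimizer s p K F Ω w := by
  refine ⟨hu.1.congr h, fun φ hφ hsupp => ?_⟩
  have h' : (fun x => u x + φ x) =ᵐ[volume] fun x => w x + φ x := by
    filter_upwards [h] with x hx
    rw [hx]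
  rw [← energy_congr h, ← energy_congr h']
  exact hu.2 φ hφ hsupp

theorem energy_neg (u : Rn n → ℝ) :
    energy p K (fun x t => F x (-t)) Ω (fun x => -u x) = energy p K F Ω u := by
  unfold energy
  simp only [neg_neg, neg_sub_neg, abs_sub_comm]

/-- Makes the one-sided estimates two-sided: reflecting the integrand in `t` preserves its bound
`F₀`. -/
theorem IsMinimizer.neg (hu : IsMinimizer s p K F Ω u) :
    IsMinimizer s p K (fun x t => F x (-t)) Ω (fun x => -u x) := by
  refine ⟨⟨hu.1.1.neg, hu.1.2.1.neg, ?_⟩, fun φ hφ hsupp => ?_⟩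
  · have := hu.1.2.2
    simpa only [neg_sub_neg, abs_sub_comm] using this
  · have h := hu.2 (fun x => -φ x) hφ.neg (by
      have : (fun x => -φ x) = -φ := rfl
      rw [this, tsupport, Function.support_neg]
      exact hsupp)
    rw [energy_neg]
    refine h.trans_eq ?_
    rw [← energy_neg]
    congr 1
    funext x
    ring

theorem SuperpositionMeasurable.neg (hF : SuperpositionMeasurable Ω F) :
    SuperpositionMeasurable Ω (fun x t => F x (-t)) :=
  fun v hv => hF (fun x => -v x) hv.neg

theorem tail_eq_weightedTail {R : ℝ} (hp : 1 < p) (hR : 0 < R) (u : Rn n → ℝ) (x₀ : Rn n) :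
    tail n s p u x₀ R =
      weightedTail n s p (fun y => ENNReal.ofReal |u y|) x₀ R ^ (1 / (p - 1)) := by
  unfold tail weightedTail
  congr 2
  refine setLIntegral_congr_fun measurableSet_ball.compl fun y hy => ?_
  have hy0 : R ≤ ‖y - x₀‖ := by simpa [dist_eq_norm] using hy
  have hpos : 0 < ‖y - x₀‖ := hR.trans_le hy0
  simp only
  rw [enorm_rpow_eq hpos, ENNReal.ofReal_rpow_of_nonneg (abs_nonneg _) (by linarith),
    ← ENNReal.ofReal_mul (by positivity), Real.rpow_neg hpos.le, div_eq_mul_inv]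

theorem tail_congr (h : u =ᵐ[volume] w) (x₀ : Rn n) (R : ℝ) :
    tail n s p u x₀ R = tail n s p w x₀ R := by
  unfold tail
  congr 2
  refine lintegral_congr_ae (ae_restrict_of_ae ?_)
  filter_upwards [h] with x hx
  rw [hx]

theorem tail_lt_top (hs : 0 < s) (hp : 1 < p) (hu : MemWeightedL n s p u) {x₀ : Rn n} {R : ℝ}
    (hR : 0 < R) : tail n s p u x₀ R < ∞ := by
  have hp0 : 0 < p := by linarith
  have hE : 0 < (n : ℝ) + s * p := by positivity
  set E := (n : ℝ) + s * p
  -- Chosen so that `1 + ‖y‖ ≤ κ ‖y - x₀‖` outside the ball.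
  set κ := (1 + ‖x₀‖) / R + 1 with hκ
  have hκ0 : 0 < κ := by positivity
  refine ENNReal.rpow_lt_top_of_nonneg (one_div_nonneg.2 (by linarith)) ?_
  refine (ENNReal.mul_lt_top ENNReal.ofReal_lt_top ?_).ne
  calc _ ≤ ∫⁻ x in (Metric.ball x₀ R)ᶜ, ENNReal.ofReal (κ ^ E) *
        ENNReal.ofReal (|u x| ^ (p - 1) / (1 + ‖x‖) ^ E) := by
        refine setLIntegral_mono' measurableSet_ball.compl fun y hy => ?_
        have hy0 : R ≤ ‖y - x₀‖ := by simpa [dist_eq_norm] using hy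
        have hpos : 0 < ‖y - x₀‖ := hR.trans_le hy0
        have h1 : 1 + ‖y‖ ≤ κ * ‖y - x₀‖ := by
          have h2 : ‖y‖ ≤ ‖y - x₀‖ + ‖x₀‖ := by
            have := norm_add_le (y - x₀) x₀
            rwa [sub_add_cancel] at this
          have h3 : 1 + ‖x₀‖ ≤ (1 + ‖x₀‖) / R * ‖y - x₀‖ := by
            rw [div_mul_eq_mul_div, le_div_iff₀ hR]
            gcongr
          rw [hκ, add_mul, one_mul]
          linarith
        have h4 : (1 + ‖y‖) ^ E ≤ κ ^ E * ‖y - x₀‖ ^ E := by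
          rw [← Real.mul_rpow hκ0.le hpos.le]
          exact Real.rpow_le_rpow (by positivity) h1 hE.le
        rw [← ENNReal.ofReal_mul (by positivity)]
        refine ENNReal.ofReal_le_ofReal ?_
        rw [← mul_div_assoc, div_le_div_iff₀ (by positivity) (by positivity)]
        calc |u y| ^ (p - 1) * (1 + ‖y‖) ^ E ≤ |u y| ^ (p - 1) * (κ ^ E * ‖y - x₀‖ ^ E) := by
              gcongr
          _ = _ := by ring
    _ ≤ ENNReal.ofReal (κ ^ E) * ∫⁻ x, ENNReal.ofReal (|u x| ^ (p - 1) / (1 + ‖x‖) ^ E) := by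
        rw [lintegral_const_mul' _ _ ENNReal.ofReal_ne_top]
        exact mul_le_mul' le_rfl (setLIntegral_le_lintegral _ _)
    _ < ∞ := ENNReal.mul_lt_top ENNReal.ofReal_lt_top hu.2

end Minimizer

/-! ### The continuous representative. -/

section ApproxValue

variable {n : ℕ} {u : Rn n → ℝ}

/-- `c` is the approximate value of `u` at `x`. -/
def IsApproxValue (u : Rn n → ℝ) (x : Rn n) (c : ℝ) : Prop :=
  ∀ ε : ℝ, 0 < ε → ∃ r : ℝ, 0 < r ∧ ∀ᵐ y ∂(volume.restrict (Metric.ball x r)), |u y - c| ≤ ε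

open Classical in
/-- The representative of `u` by approximate values. -/
noncomputable def approxValue (u : Rn n → ℝ) (x : Rn n) : ℝ :=
  if h : ∃ c, IsApproxValue u x c then h.choose else 0

theorem exists_mem_of_ae {S : Set (Rn n)} (hS : IsOpen S) (hne : S.Nonempty) {P : Rn n → Prop}
    (h : ∀ᵐ y ∂(volume.restrict S), P y) : ∃ y ∈ S, P y := by
  by_contra hcon
  push Not at hcon
  rw [ae_restrict_iff' hS.measurableSet, ae_iff] at h
  have : S ⊆ {a | ¬(a ∈ S → P a)} := fun y hy hP => hcon y hy (hP hy)
  exact (hS.measure_pos volume hne).ne' (measure_mono_null this h)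

/-- Makes the representative independent of the ball from which its value is computed, so that a
single function serves all balls in `Ω`. -/
theorem IsApproxValue.unique {x : Rn n} {c c' : ℝ} (h : IsApproxValue u x c)
    (h' : IsApproxValue u x c') : c = c' := by
  refine eq_of_abs_sub_le_all fun ε hε => ?_
  obtain ⟨r, hr, h1⟩ := h (ε / 2) (by positivity)
  obtain ⟨r', hr', h2⟩ := h' (ε / 2) (by positivity)
  have hm : 0 < min r r' := lt_min hr hr'
  obtain ⟨y, -, hy1, hy2⟩ := exists_mem_of_ae Metric.isOpen_ball (Metric.nonempty_ball.2 hm)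
    ((ae_restrict_of_ae_restrict_of_subset (Metric.ball_subset_ball (min_le_left r r')) h1).and
      (ae_restrict_of_ae_restrict_of_subset (Metric.ball_subset_ball (min_le_right r r')) h2))
  rw [abs_le] at hy1 hy2 ⊢
  constructor <;> linarith [hy1.1, hy1.2, hy2.1, hy2.2]

theorem IsApproxValue.eq {x : Rn n} {c : ℝ} (h : IsApproxValue u x c) : approxValue u x = c := by
  have hex : ∃ c, IsApproxValue u x c := ⟨c, h⟩
  rw [approxValue, dif_pos hex]
  exact hex.choose_spec.unique h

theorem isApproxValue_of_holder {x : Rn n} {c H R α : ℝ} (hα : 0 < α) (hR : 0 < R)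
    (h : ∀ r, 0 < r → r ≤ R / 2 →
      ∀ᵐ y ∂(volume.restrict (Metric.ball x r)), |u y - c| ≤ H * (r / R) ^ α) :
    IsApproxValue u x c := by
  intro ε hε
  have hcont : Filter.Tendsto (fun r : ℝ => H * (r / R) ^ α) (nhdsWithin 0 (Ioi 0)) (nhds 0) := by
    have h0 : Continuous fun r : ℝ => H * (r / R) ^ α :=
      continuous_const.mul ((continuous_id.div_const R).rpow_const fun _ => Or.inr hα.le)
    have h1 := h0.tendsto 0
    rw [zero_div, Real.zero_rpow hα.ne', mul_zero] at h1
    exact h1.mono_left nhdsWithin_le_nhds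
  have h2 : ∀ᶠ r : ℝ in nhdsWithin 0 (Ioi 0), r ≤ R / 2 :=
    nhdsWithin_le_nhds (ge_mem_nhds (by positivity))
  obtain ⟨r, ⟨h1, h2⟩, h3⟩ :=
    (((hcont.eventually (ge_mem_nhds hε)).and h2).and self_mem_nhdsWithin).exists
  exact ⟨r, h3, (h r h3 h2).mono fun y hy => hy.trans h1⟩

/-- The approximate values of a function with Hölder decay at every point are Hölder continuous. -/
theorem abs_approxValue_sub_le {x₀ : Rn n} {R H α : ℝ} (hα : 0 < α) (hα1 : α < 1) (hR : 0 < R)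
    (hH : 0 ≤ H) (hsup : ∀ᵐ x ∂(volume.restrict (Metric.ball x₀ R)), |u x| ≤ H)
    (h : ∀ x₁ ∈ Metric.ball x₀ R, ∃ c, ∀ r, 0 < r → r ≤ R / 2 →
      ∀ᵐ x ∂(volume.restrict (Metric.ball x₁ r)), |u x - c| ≤ H * (r / R) ^ α) :
    (∀ x₁ ∈ Metric.ball x₀ R, IsApproxValue u x₁ (approxValue u x₁)) ∧
    ∀ x ∈ Metric.ball x₀ R, ∀ y ∈ Metric.ball x₀ R,
      |approxValue u x - approxValue u y| ≤ 8 * H * (dist x y / R) ^ α := by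
  have key : ∀ x₁ ∈ Metric.ball x₀ R, ∀ r, 0 < r → r ≤ R / 2 →
      ∀ᵐ x ∂(volume.restrict (Metric.ball x₁ r)), |u x - approxValue u x₁| ≤ H * (r / R) ^ α := by
    intro x₁ hx₁
    obtain ⟨c, hc⟩ := h x₁ hx₁
    rw [(isApproxValue_of_holder hα hR hc).eq]
    exact hc
  have happ : ∀ x₁ ∈ Metric.ball x₀ R, IsApproxValue u x₁ (approxValue u x₁) :=
    fun x₁ hx₁ => isApproxValue_of_holder hα hR (key x₁ hx₁)
  refine ⟨happ, fun x hx y hy => ?_⟩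
  have hbd : ∀ x₁ ∈ Metric.ball x₀ R, |approxValue u x₁| ≤ H := by
    intro x₁ hx₁
    refine le_of_forall_pos_le_add fun ε hε => ?_
    obtain ⟨r, hr, h1⟩ := happ x₁ hx₁ ε hε
    obtain ⟨z, -, hz1, hz2⟩ := exists_mem_of_ae (S := Metric.ball x₁ r ∩ Metric.ball x₀ R)
      (Metric.isOpen_ball.inter Metric.isOpen_ball) ⟨x₁, Metric.mem_ball_self hr, hx₁⟩
      ((ae_restrict_of_ae_restrict_of_subset inter_subset_left h1).and
        (ae_restrict_of_ae_restrict_of_subset inter_subset_right hsup))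
    rw [abs_le] at hz1 hz2 ⊢
    constructor <;> linarith [hz1.1, hz1.2, hz2.1, hz2.2]
  have h2α : (2 : ℝ) ^ α ≤ 2 := by
    calc (2 : ℝ) ^ α ≤ 2 ^ (1 : ℝ) := Real.rpow_le_rpow_of_exponent_le one_le_two hα1.le
      _ = 2 := Real.rpow_one 2
  set d := dist x y with hd
  have hd0 : 0 ≤ d := dist_nonneg
  have hD0 : 0 ≤ (d / R) ^ α := by positivity
  rcases hd0.eq_or_lt with h0 | h0
  · rw [dist_eq_zero.1 (hd.symm.trans h0.symm), sub_self, abs_zero]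
    positivity
  -- Close points are compared through a common point of their balls of radius `2d`. For distant
  -- points `d > R / 4`, and the bound `2H` suffices; this case produces the constant 8.
  rcases le_or_gt (2 * d) (R / 2) with h1 | h1
  · have hx1 := key x hx (2 * d) (by positivity) h1
    have hy1 := key y hy (2 * d) (by positivity) h1
    obtain ⟨z, -, hz1, hz2⟩ := exists_mem_of_ae (S := Metric.ball x d) Metric.isOpen_ball
      (Metric.nonempty_ball.2 h0)
      ((ae_restrict_of_ae_restrict_of_subset (Metric.ball_subset_ball (by linarith)) hx1).and
        (ae_restrict_of_ae_restrict_of_subset (Metric.ball_subset_ball' (by linarith)) hy1))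
    have e1 : (2 * d / R) ^ α = 2 ^ α * (d / R) ^ α := by
      rw [← Real.mul_rpow two_pos.le (by positivity), mul_div_assoc]
    have e2 : H * (2 * d / R) ^ α ≤ 2 * H * (d / R) ^ α := by
      rw [e1]
      have : 2 ^ α * (d / R) ^ α ≤ 2 * (d / R) ^ α := by gcongr
      calc _ ≤ H * (2 * (d / R) ^ α) := by gcongr
        _ = _ := by ring
    have e3 : 0 ≤ H * (d / R) ^ α := by positivity
    rw [abs_le] at hz1 hz2 ⊢
    constructor <;> linarith [hz1.1, hz1.2, hz2.1, hz2.2]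
  · have hx1 := hbd x hx
    have hy1 := hbd y hy
    have e1 : 1 ≤ (4 * (d / R)) ^ α := by
      refine Real.one_le_rpow ?_ hα.le
      rw [← mul_div_assoc, one_le_div hR]
      linarith
    have e2 : (4 : ℝ) ^ α ≤ 4 := by
      calc (4 : ℝ) ^ α ≤ 4 ^ (1 : ℝ) := Real.rpow_le_rpow_of_exponent_le (by norm_num) hα1.le
        _ = 4 := Real.rpow_one 4
    rw [Real.mul_rpow (by norm_num) (by positivity)] at e1
    have e3 : 1 ≤ 4 * (d / R) ^ α := e1.trans (by gcongr)
    have e4 : 2 * H ≤ 8 * H * (d / R) ^ α := by nlinarith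
    rw [abs_le] at hx1 hy1 ⊢
    constructor <;> linarith [hx1.1, hx1.2, hy1.1, hy1.2]

theorem approxValue_ae_eq {Ω : Set (Rn n)} (hΩ : MeasurableSet Ω)
    (h : ∀ x ∈ Ω, IsApproxValue u x (approxValue u x) ∧ ContinuousAt (approxValue u) x) :
    ∀ᵐ x ∂(volume.restrict Ω), approxValue u x = u x := by
  have key : ∀ k : ℕ, volume {x ∈ Ω | 1 / ((k : ℝ) + 1) < |approxValue u x - u x|} = 0 := by
    intro k
    have hk : (0 : ℝ) < 1 / ((k : ℝ) + 1) := by positivity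
    -- Near `x` both `u`, almost everywhere, and the representative, by continuity, are close to the
    -- same value. Lebesgue differentiation is not needed.
    refine measure_null_of_locally_null _ fun x hx => ?_
    obtain ⟨h1, h2⟩ := h x hx.1
    obtain ⟨r, hr, h3⟩ := h1 _ (half_pos hk)
    obtain ⟨r', hr', h4⟩ := Metric.continuousAt_iff.1 h2 _ (half_pos hk)
    refine ⟨_, inter_mem_nhdsWithin _ (Metric.ball_mem_nhds x (lt_min hr hr')), ?_⟩
    rw [ae_restrict_iff' measurableSet_ball, ae_iff] at h3
    refine measure_mono_null (fun y hy => ?_) h3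
    intro hcon
    have h5 := hcon (Metric.ball_subset_ball (min_le_left r r') hy.2)
    have h6 := h4 (lt_of_lt_of_le (Metric.mem_ball.1 hy.2) (min_le_right r r'))
    rw [Real.dist_eq] at h6
    have h7 : 1 / ((k : ℝ) + 1) < |approxValue u y - u y| := hy.1.2
    have h8 := abs_sub_le (approxValue u y) (approxValue u x) (u y)
    rw [abs_sub_comm (approxValue u x) (u y)] at h8
    linarith
  have hall : volume (⋃ k : ℕ, {x ∈ Ω | 1 / ((k : ℝ) + 1) < |approxValue u x - u x|}) = 0 :=
    measure_iUnion_null key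
  rw [ae_restrict_iff' hΩ, ae_iff]
  refine measure_mono_null (fun x hx => ?_) hall
  simp only [mem_ofPred_eq, Classical.not_imp] at hx
  obtain ⟨k, hk⟩ := exists_nat_one_div_lt (abs_pos.2 (sub_ne_zero.2 hx.2))
  exact mem_iUnion.2 ⟨k, hx.1, hk⟩

end ApproxValue

/-! ### Hölder seminorms, from local to compact. -/

section HolderSeminorm

variable {n : ℕ} {v : Rn n → ℝ} {α : ℝ}

theorem holderSeminorm_le {S : Set (Rn n)} {C : ℝ≥0∞}
    (h : ∀ x ∈ S, ∀ y ∈ S, edist (v x) (v y) ≤ C * edist x y ^ α) : holderSeminorm α v S ≤ C :=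
  iSup₂_le fun x hx => iSup₂_le fun y hy => ENNReal.div_le_of_le_mul (h x hx y hy)

theorem edist_le_of_abs_sub_le {x y : Rn n} {C R : ℝ} (hα : 0 < α) (hC : 0 ≤ C) (hR : 0 < R)
    (h : |v x - v y| ≤ C * (dist x y / R) ^ α) :
    edist (v x) (v y) ≤ ENNReal.ofReal (C * R ^ (-α)) * edist x y ^ α := by
  rw [edist_dist, edist_dist, ENNReal.ofReal_rpow_of_nonneg dist_nonneg hα.le,
    ← ENNReal.ofReal_mul (by positivity), Real.dist_eq]
  refine ENNReal.ofReal_le_ofReal (h.trans_eq ?_)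
  rw [Real.div_rpow dist_nonneg hR.le, Real.rpow_neg hR.le]
  ring

/-- Local Hölder continuity at every point implies Hölder continuity on compact sets. -/
theorem memHolderLoc_of_local {Ω : Set (Rn n)} (hα : 0 < α)
    (h : ∀ x ∈ Ω, ∃ R : ℝ, 0 < R ∧ ∃ C : ℝ≥0∞, C ≠ ∞ ∧ ∀ a ∈ Metric.ball x R,
      ∀ b ∈ Metric.ball x R, edist (v a) (v b) ≤ C * edist a b ^ α) :
    MemHolderLoc α v Ω := by
  intro Q hQ hQΩ
  have hcomp : ∃ C : ℝ≥0∞, C ≠ ∞ ∧ ∀ z ∈ Q ×ˢ Q, edist (v z.1) (v z.2) ≤ C * edist z.1 z.2 ^ α := by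
    refine (hQ.prod hQ).induction_on
      (p := fun S => ∃ C : ℝ≥0∞, C ≠ ∞ ∧ ∀ z ∈ S, edist (v z.1) (v z.2) ≤ C * edist z.1 z.2 ^ α)
      ⟨0, by simp, by simp⟩ ?_ ?_ ?_
    · rintro S T hST ⟨C, hC, h1⟩
      exact ⟨C, hC, fun z hz => h1 z (hST hz)⟩
    · rintro S T ⟨C, hC, h1⟩ ⟨D, hD, h2⟩
      refine ⟨max C D, (max_lt hC.lt_top hD.lt_top).ne, ?_⟩
      rintro z (hz | hz)
      · exact (h1 z hz).trans (by gcongr; exact le_max_left _ _)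
      · exact (h2 z hz).trans (by gcongr; exact le_max_right _ _)
    · rintro ⟨x, y⟩ ⟨hx, hy⟩
      obtain ⟨R₁, hR₁, C₁, hC₁, h1⟩ := h x (hQΩ hx)
      obtain ⟨R₂, hR₂, C₂, hC₂, h2⟩ := h y (hQΩ hy)
      -- Compactness of `Q ×ˢ Q` reduces to neighbourhoods of pairs. On the diagonal the local
      -- estimate applies; off it the points stay at distance at least `d / 2`, so bounded
      -- differences are enough.
      rcases eq_or_ne x y with hxy | hxy
      · subst hxy
        refine ⟨Metric.ball x R₁ ×ˢ Metric.ball x R₁, mem_nhdsWithin_of_mem_nhds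
          (prod_mem_nhds (Metric.ball_mem_nhds x hR₁) (Metric.ball_mem_nhds x hR₁)), C₁, hC₁, ?_⟩
        rintro ⟨a, b⟩ ⟨ha, hb⟩
        exact h1 a ha b hb
      · have hd : 0 < dist x y := dist_pos.2 hxy
        obtain ⟨d, hdd⟩ : ∃ d, d = dist x y := ⟨_, rfl⟩
        rw [← hdd] at hd
        obtain ⟨r, hrd⟩ : ∃ r, r = min (min R₁ R₂) (d / 4) := ⟨_, rfl⟩
        have hr : 0 < r := by rw [hrd]; positivity
        have hrR₁ : r ≤ R₁ := hrd ▸ (min_le_left _ _).trans (min_le_left _ _)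
        have hrR₂ : r ≤ R₂ := hrd ▸ (min_le_left _ _).trans (min_le_right _ _)
        have hr4 : r ≤ d / 4 := hrd ▸ min_le_right _ _
        set D := C₁ * ENNReal.ofReal r ^ α + edist (v x) (v y) + C₂ * ENNReal.ofReal r ^ α with hD
        have hDtop : D ≠ ∞ := by
          have e : ENNReal.ofReal r ^ α ≠ ∞ :=
            ENNReal.rpow_ne_top_of_nonneg hα.le ENNReal.ofReal_ne_top
          exact ENNReal.add_ne_top.2 ⟨ENNReal.add_ne_top.2 ⟨ENNReal.mul_ne_top hC₁ e,
            edist_ne_top _ _⟩, ENNReal.mul_ne_top hC₂ e⟩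
        have hd2 : 0 < (d / 2) ^ α := by positivity
        refine ⟨Metric.ball x r ×ˢ Metric.ball y r, mem_nhdsWithin_of_mem_nhds
          (prod_mem_nhds (Metric.ball_mem_nhds x hr) (Metric.ball_mem_nhds y hr)),
          D / ENNReal.ofReal ((d / 2) ^ α), ENNReal.div_ne_top hDtop (by simpa using hd2), ?_⟩
        rintro ⟨a, b⟩ ⟨ha, hb⟩
        simp only at ha hb ⊢
        have e1 : edist (v a) (v x) ≤ C₁ * ENNReal.ofReal r ^ α := by
          refine (h1 a (Metric.ball_subset_ball hrR₁ ha) x (Metric.mem_ball_self hR₁)).trans ?_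
          gcongr
          rw [edist_dist]
          exact ENNReal.ofReal_le_ofReal (Metric.mem_ball.1 ha).le
        have e2 : edist (v y) (v b) ≤ C₂ * ENNReal.ofReal r ^ α := by
          refine (h2 y (Metric.mem_ball_self hR₂) b (Metric.ball_subset_ball hrR₂ hb)).trans ?_
          gcongr
          rw [edist_dist, dist_comm]
          exact ENNReal.ofReal_le_ofReal (Metric.mem_ball.1 hb).le
        have e3 : ENNReal.ofReal ((d / 2) ^ α) ≤ edist a b ^ α := by
          rw [edist_dist, ENNReal.ofReal_rpow_of_nonneg dist_nonneg hα.le]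
          refine ENNReal.ofReal_le_ofReal (Real.rpow_le_rpow (by positivity) ?_ hα.le)
          have f1 := dist_triangle x a y
          have f2 := dist_triangle a b y
          have f3 := Metric.mem_ball'.1 ha
          have f4 := Metric.mem_ball.1 hb
          linarith
        calc edist (v a) (v b) ≤ edist (v a) (v x) + edist (v x) (v y) + edist (v y) (v b) :=
              edist_triangle4 _ _ _ _
          _ ≤ D := add_le_add (add_le_add e1 le_rfl) e2
          _ = D / ENNReal.ofReal ((d / 2) ^ α) * ENNReal.ofReal ((d / 2) ^ α) := by
              rw [ENNReal.div_mul_cancel (by simpa using hd2) ENNReal.ofReal_ne_top]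
          _ ≤ _ := by gcongr
  obtain ⟨C, hC, h1⟩ := hcomp
  exact (holderSeminorm_le fun x hx y hy => h1 (x, y) ⟨hx, hy⟩).trans_lt hC.lt_top

end HolderSeminorm

/-! ### Assembly of the theorem. -/

theorem closedBall_subset_of_lt_infDist {n : ℕ} {Ω : Set (Rn n)} (hΩ : IsOpen Ω) {x₀ : Rn n}
    (hx₀ : x₀ ∈ Ω) {r : ℝ} (hr : 0 < r) (h : r < Metric.infDist x₀ (frontier Ω)) :
    Metric.closedBall x₀ r ⊆ Ω := by
  -- A connected set that meets `Ω` and misses its frontier stays in `Ω`.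
  refine ((convex_closedBall x₀ r).isPreconnected).subset_of_closure_inter_subset hΩ
    ⟨x₀, Metric.mem_closedBall_self hr.le, hx₀⟩ ?_
  rintro z ⟨hz1, hz2⟩
  by_contra hz
  have hzf : z ∈ frontier Ω := by
    rw [hΩ.frontier_eq]
    exact ⟨hz1, hz⟩
  have h1 := Metric.infDist_le_dist_of_mem (x := x₀) hzf
  have h2 := Metric.mem_closedBall'.1 hz2
  linarith

section Final

variable {n : ℕ} {s p : ℝ} {F₀ : ℝ} {u : Rn n → ℝ}

/-- The quantity on the right-hand side of the Hölder estimate. -/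
noncomputable def localSize (n : ℕ) (s p F₀ : ℝ) (u : Rn n → ℝ) (x₀ : Rn n) (R : ℝ) : ℝ≥0∞ :=
  eLpNorm u (ENNReal.ofReal p) (volume.restrict (Metric.ball x₀ (2 * R))) /
      ENNReal.ofReal (R ^ ((n : ℝ) / p)) +
    tail n s p u x₀ R + ENNReal.ofReal (R ^ s * F₀ ^ (1 / p))

/-- Each summand of the local size is at most `M`; these are the three normalized hypotheses of
`IsDeGiorgi.exists_local_estimate`. -/
theorem bounds_of_localSize_le (hp : 1 < p) (hF₀ : 0 ≤ F₀) {x₀ : Rn n} {R M : ℝ}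
    (hR : 0 < R) (hM : 0 < M) (h : localSize n s p F₀ u x₀ R ≤ ENNReal.ofReal M) :
    F₀ * R ^ (s * p) ≤ M ^ p ∧
    weightedTail n s p (fun y => ENNReal.ofReal |u y|) x₀ R ≤ ENNReal.ofReal (M ^ (p - 1)) ∧
    ∫⁻ x in Metric.ball x₀ (2 * R), ENNReal.ofReal |u x| ^ p ≤
      ENNReal.ofReal (M ^ p * R ^ (n : ℝ)) := by
  have hp0 : 0 < p := by linarith
  have hp1 : 0 < p - 1 := by linarith
  have h1 := (le_self_add.trans le_self_add).trans h
  have h2 := (le_add_self.trans le_self_add).trans h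
  have h3 := le_add_self.trans h
  refine ⟨?_, ?_, ?_⟩
  · have h4 := (ENNReal.ofReal_le_ofReal_iff hM.le).1 h3
    calc F₀ * R ^ (s * p) = (R ^ s * F₀ ^ (1 / p)) ^ p := by
          rw [Real.mul_rpow (by positivity) (by positivity), ← Real.rpow_mul hR.le,
            ← Real.rpow_mul hF₀, one_div_mul_cancel hp0.ne', Real.rpow_one, mul_comm]
      _ ≤ M ^ p := by gcongr
  · rw [tail_eq_weightedTail hp hR] at h2
    have h4 := ENNReal.rpow_le_rpow h2 hp1.le
    rwa [← ENNReal.rpow_mul, one_div_mul_cancel hp1.ne', ENNReal.rpow_one,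
      ENNReal.ofReal_rpow_of_pos hM] at h4
  · have hRn : 0 < R ^ ((n : ℝ) / p) := by positivity
    rw [ENNReal.div_le_iff (by simpa using hRn) ENNReal.ofReal_ne_top,
      ← ENNReal.ofReal_mul hM.le, eLpNorm_eq_lintegral_rpow_enorm_toReal (by simpa using hp0)
        ENNReal.ofReal_ne_top, ENNReal.toReal_ofReal hp0.le] at h1
    have h4 := ENNReal.rpow_le_rpow h1 hp0.le
    rw [← ENNReal.rpow_mul, one_div_mul_cancel hp0.ne', ENNReal.rpow_one,
      ENNReal.ofReal_rpow_of_pos (by positivity), Real.mul_rpow hM.le hRn.le,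
      ← Real.rpow_mul hR.le, div_mul_cancel₀ _ hp0.ne'] at h4
    refine le_trans (le_of_eq (lintegral_congr fun x => ?_)) h4
    rw [← ofReal_norm, Real.norm_eq_abs]

theorem localSize_lt_top (hs : 0 < s) (hp : 1 < p) {Ω : Set (Rn n)} (hu : MemWeightedL n s p u)
    (huW : MemW n s p Ω u) {x₀ : Rn n} {R : ℝ} (hR : 0 < R)
    (hball : Metric.closedBall x₀ (2 * R) ⊆ Ω) : localSize n s p F₀ u x₀ R < ∞ := by
  have hRn : 0 < R ^ ((n : ℝ) / p) := by positivity
  have h1 : eLpNorm u (ENNReal.ofReal p) (volume.restrict (Metric.ball x₀ (2 * R))) < ∞ :=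
    (eLpNorm_mono_measure _ (Measure.restrict_mono
      (Metric.ball_subset_closedBall.trans hball) le_rfl)).trans_lt huW.2.1.2
  exact ENNReal.add_lt_top.2 ⟨ENNReal.add_lt_top.2
    ⟨ENNReal.div_lt_top h1.ne (by simpa using hRn), tail_lt_top hs hp hu hR⟩,
    ENNReal.ofReal_lt_top⟩

theorem le_mul_of_forall_lt_ofReal {X N : ℝ≥0∞} {C : ℝ} (hC : 0 < C)
    (h : ∀ M : ℝ, 0 < M → N ≤ ENNReal.ofReal M → X ≤ ENNReal.ofReal (C * M)) :
    X ≤ ENNReal.ofReal C * N := by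
  by_cases hN : N = ∞
  · rw [hN, ENNReal.mul_top (by simpa using hC)]
    exact le_top
  refine ENNReal.le_of_forall_pos_le_add fun ε hε _ => ?_
  have hε' : (0 : ℝ) < ε := hε
  -- The estimates require `M > 0`, while `N` may vanish; hence the extra `ε / C`.
  have hM : 0 < N.toReal + ε / C := by positivity
  have h1 := h _ hM (by
    rw [← ENNReal.ofReal_toReal hN]
    exact ENNReal.ofReal_le_ofReal (by
      rw [ENNReal.toReal_ofReal ENNReal.toReal_nonneg]
      have : 0 < ε / C := by positivity
      linarith))
  refine h1.trans_eq ?_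
  rw [mul_add, mul_div_cancel₀ _ hC.ne', ENNReal.ofReal_add (by positivity) hε'.le,
    ENNReal.ofReal_mul hC.le, ENNReal.ofReal_toReal hN, ENNReal.ofReal_coe_nnreal]

end Final

/-- The regularity theorem for functions that are measurable and belong to a De Giorgi class
together with their negatives. -/
theorem IsDeGiorgi.exists_regularity (n : ℕ) {s p A C₀ : ℝ} (hs : 0 < s) (hp : 1 < p)
    (hA : 0 < A) (hC₀ : IsTailConst n s p C₀) :
    ∃ α C : ℝ, 0 < α ∧ α < 1 ∧ 0 < C ∧ ∀ (F₀ : ℝ) (Ω : Set (Rn n)) (u : Rn n → ℝ), 0 ≤ F₀ →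
      IsOpen Ω → Measurable u → MemWeightedL n s p u → MemW n s p Ω u →
      IsDeGiorgi n s p A F₀ Ω u → IsDeGiorgi n s p A F₀ Ω (fun x => -u x) →
      approxValue u =ᵐ[volume.restrict Ω] u ∧ MemHolderLoc α (approxValue u) Ω ∧
      ∀ (x₀ : Rn n) (R : ℝ), 0 < R → Metric.closedBall x₀ (2 * R) ⊆ Ω →
        eLpNorm (approxValue u) ∞ (volume.restrict (Metric.ball x₀ R)) +
            ENNReal.ofReal (R ^ α) * holderSeminorm α (approxValue u) (Metric.ball x₀ R) ≤
          ENNReal.ofReal C * localSize n s p F₀ u x₀ R := by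
  obtain ⟨α, C, hα0, hα1, hC0, hloc⟩ := IsDeGiorgi.exists_local_estimate n hs hp hA hC₀
  refine ⟨α, 9 * C, hα0, hα1, by positivity, ?_⟩
  intro F₀ Ω u hF₀ hΩ hu huL huW hDG hDG'
  have key : ∀ (x₀ : Rn n) (R M : ℝ), 0 < R → 0 < M → Metric.closedBall x₀ (2 * R) ⊆ Ω →
      localSize n s p F₀ u x₀ R ≤ ENNReal.ofReal M →
      (∀ᵐ x ∂(volume.restrict (Metric.ball x₀ R)), |u x| ≤ C * M) ∧
      (∀ x₁ ∈ Metric.ball x₀ R, IsApproxValue u x₁ (approxValue u x₁)) ∧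
      ∀ x ∈ Metric.ball x₀ R, ∀ y ∈ Metric.ball x₀ R, edist (approxValue u x) (approxValue u y) ≤
        ENNReal.ofReal (8 * (C * M) * R ^ (-α)) * edist x y ^ α := by
    intro x₀ R M hR hM hball hN
    obtain ⟨h1, h2, h3⟩ := bounds_of_localSize_le hp hF₀ hR hM hN
    obtain ⟨h4, h5⟩ := hloc F₀ Ω u hF₀ hu hDG hDG' x₀ R M hR hM hball h1 h2 h3
    obtain ⟨h6, h7⟩ := abs_approxValue_sub_le hα0 hα1 hR (by positivity) h4 h5
    exact ⟨h4, h6, fun x hx y hy => edist_le_of_abs_sub_le hα0 (by positivity) hR (h7 x hx y hy)⟩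
  have hexists : ∀ x₀ ∈ Ω, ∃ R M : ℝ, 0 < R ∧ 0 < M ∧ Metric.closedBall x₀ (2 * R) ⊆ Ω ∧
      localSize n s p F₀ u x₀ R ≤ ENNReal.ofReal M := by
    intro x₀ hx₀
    obtain ⟨r, hr, hball⟩ := Metric.nhds_basis_closedBall.mem_iff.1 (hΩ.mem_nhds hx₀)
    have hball' : Metric.closedBall x₀ (2 * (r / 2)) ⊆ Ω := by
      rwa [mul_div_cancel₀ _ two_ne_zero]
    have hfin := localSize_lt_top (F₀ := F₀) hs hp huL huW (half_pos hr) hball'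
    refine ⟨r / 2, (localSize n s p F₀ u x₀ (r / 2)).toReal + 1, half_pos hr, by positivity,
      hball', ?_⟩
    calc _ = ENNReal.ofReal (localSize n s p F₀ u x₀ (r / 2)).toReal :=
          (ENNReal.ofReal_toReal hfin.ne).symm
      _ ≤ _ := ENNReal.ofReal_le_ofReal (by linarith)
  have hlocal : ∀ x ∈ Ω, ∃ R : ℝ, 0 < R ∧ ∃ D : ℝ≥0∞, D ≠ ∞ ∧ ∀ a ∈ Metric.ball x R,
      ∀ b ∈ Metric.ball x R,
        edist (approxValue u a) (approxValue u b) ≤ D * edist a b ^ α := by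
    intro x hx
    obtain ⟨R, M, hR, hM, hball, hN⟩ := hexists x hx
    exact ⟨R, hR, _, ENNReal.ofReal_ne_top, (key x R M hR hM hball hN).2.2⟩
  have hae : ∀ᵐ x ∂(volume.restrict Ω), approxValue u x = u x := by
    refine approxValue_ae_eq hΩ.measurableSet fun x hx => ⟨?_, ?_⟩
    · obtain ⟨R, M, hR, hM, hball, hN⟩ := hexists x hx
      exact (key x R M hR hM hball hN).2.1 x (Metric.mem_ball_self hR)
    · obtain ⟨R, hR, D, hD, h⟩ := hlocal x hx
      rw [ContinuousAt, tendsto_iff_edist_tendsto_0]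
      have h1 : Filter.Tendsto (fun a => D * edist a x ^ α) (nhds x) (nhds 0) := by
        have h2 : Filter.Tendsto (fun a => edist a x) (nhds x) (nhds 0) :=
          tendsto_iff_edist_tendsto_0.1 Filter.tendsto_id
        have h3 := (ENNReal.continuous_rpow_const (y := α)).tendsto 0
        rw [ENNReal.zero_rpow_of_pos hα0] at h3
        have h4 := ENNReal.Tendsto.const_mul (h3.comp h2) (Or.inr hD)
        rwa [mul_zero] at h4
      refine tendsto_of_tendsto_of_tendsto_of_le_of_le' tendsto_const_nhds h1
        (Filter.Eventually.of_forall fun _ => bot_le) ?_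
      filter_upwards [Metric.ball_mem_nhds x hR] with a ha
      exact h a ha x (Metric.mem_ball_self hR)
  refine ⟨hae, memHolderLoc_of_local hα0 hlocal, fun x₀ R hR hball => ?_⟩
  refine le_mul_of_forall_lt_ofReal (by positivity) fun M hM hN => ?_
  obtain ⟨h1, -, h3⟩ := key x₀ R M hR hM hball hN
  have e1 : eLpNorm (approxValue u) ∞ (volume.restrict (Metric.ball x₀ R)) ≤
      ENNReal.ofReal (C * M) := by
    rw [eLpNorm_exponent_top]
    refine eLpNormEssSup_le_of_ae_bound ?_
    have hsub : Metric.ball x₀ R ⊆ Ω :=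
      ((Metric.ball_subset_ball (by linarith)).trans Metric.ball_subset_closedBall).trans hball
    filter_upwards [h1, ae_restrict_of_ae_restrict_of_subset hsub hae] with x hx1 hx2
    rw [Real.norm_eq_abs, hx2]
    exact hx1
  calc _ ≤ ENNReal.ofReal (C * M) +
        ENNReal.ofReal (R ^ α) * ENNReal.ofReal (8 * (C * M) * R ^ (-α)) :=
        add_le_add e1 (mul_le_mul' le_rfl (holderSeminorm_le h3))
    _ = _ := by
        rw [ofReal_rpow_mul_ofReal_rpow_neg hR, ← ENNReal.ofReal_add (by positivity) (by positivity)]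
        congr 1
        ring

end NonlocalEnergy

theorem corollary3p3 (n : ℕ) (hn : 1 ≤ n) (s p Λ : ℝ) (hs : s ∈ Set.Ioo (0 : ℝ) 1) (hp : 1 < p)
    (hΛ : 1 ≤ Λ) :
    ∃ α ∈ Set.Ioo (0 : ℝ) 1, ∃ C : ℝ, 1 ≤ C ∧
      ∀ (Ω : Set (Rn n)) (K : Rn n → Rn n → ℝ) (F : Rn n → ℝ → ℝ) (F₀ : ℝ) (u : Rn n → ℝ),
        IsOpen Ω → Bornology.IsBounded Ω →
        NonlocalEnergy.IsAdmissibleKernel n s p Λ K →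
        NonlocalEnergy.SuperpositionMeasurable Ω F →
        0 ≤ F₀ → (∀ᵐ x ∂(volume.restrict Ω), ∀ t : ℝ, |F x t| ≤ F₀) →
        NonlocalEnergy.MemWeightedL n s p u →
        NonlocalEnergy.IsMinimizer s p K F Ω u →
        -- `v` is the Hölder continuous representative of `u` in `Ω`
        ∃ v : Rn n → ℝ, v =ᵐ[volume.restrict Ω] u ∧
          NonlocalEnergy.MemHolderLoc α v Ω ∧
          ∀ x₀ ∈ Ω, ∀ R : ℝ, 0 < R → R < Metric.infDist x₀ (frontier Ω) / 2 →
            eLpNorm v ∞ (volume.restrict (Metric.ball x₀ R)) +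
                ENNReal.ofReal (R ^ α) * NonlocalEnergy.holderSeminorm α v (Metric.ball x₀ R) ≤
              ENNReal.ofReal C *
                (eLpNorm u (ENNReal.ofReal p) (volume.restrict (Metric.ball x₀ (2 * R))) /
                    ENNReal.ofReal (R ^ ((n : ℝ) / p)) +
                  NonlocalEnergy.tail n s p u x₀ R +
                  ENNReal.ofReal (R ^ s * F₀ ^ (1 / p))) := by
  open NonlocalEnergy in
  have hs0 : 0 < s := hs.1
  have hp0 : 0 < p := by linarith
  have hΛ0 : 0 < Λ := by linarith
  obtain ⟨C₀, hC₀⟩ : ∃ C₀, IsTailConst n s p C₀ := exists_lintegral_compl_ball_le n hs0 hp0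
  -- Here `s < 1` enters: it makes `|y - x|^(p-n-sp)` integrable near `x`.
  have hps : 0 < p - s * p := by nlinarith [hs.2]
  obtain ⟨C₁, hC₁0, hC₁⟩ := exists_lintegral_ball_le n hn (a := p - ((n : ℝ) + s * p))
    (by linarith)
  rw [show p - ((n : ℝ) + s * p) + n = p - s * p by ring] at hC₁
  obtain ⟨α, C, hα0, hα1, hC0, hreg⟩ := IsDeGiorgi.exists_regularity n
    (A := Λ * (2 * Λ * (p ^ p * 2 ^ p * C₁ * 2 ^ (p - s * p)) +
      2 * Λ * (p * 2 ^ ((n : ℝ) + s * p)) + 4 * p)) hs0 hp (by positivity) hC₀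
  refine ⟨α, ⟨hα0, hα1⟩, max 1 C, le_max_left _ _, ?_⟩
  intro Ω K F F₀ u hΩ hb hK hF hF₀ hFb huL hmin
  -- `u` is only Lebesgue measurable; a Borel representative is used throughout.
  obtain ⟨w, hw, huw⟩ : ∃ w, Measurable w ∧ u =ᵐ[volume] w :=
    ⟨huL.1.mk u, huL.1.measurable_mk, huL.1.ae_eq_mk⟩
  have hminw := hmin.congr huw
  have hwL : MemWeightedL n s p w := by
    refine ⟨hw.aemeasurable, lt_of_eq_of_lt ?_ huL.2⟩
    refine lintegral_congr_ae ?_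
    filter_upwards [huw] with x hx
    rw [hx]
  have hDG := hminw.isDeGiorgi hs0 hp hΛ hb hΩ hK hF hF₀ hFb hw hC₁0 hC₁
  have hDG' := hminw.neg.isDeGiorgi hs0 hp hΛ hb hΩ hK hF.neg hF₀
    (hFb.mono fun x hx t => hx (-t)) hw.neg hC₁0 hC₁
  obtain ⟨h1, h2, h3⟩ := hreg F₀ Ω w hF₀ hΩ hw hwL hminw.1 hDG hDG'
  refine ⟨approxValue w, h1.trans (ae_restrict_of_ae huw.symm), h2, fun x₀ hx₀ R hR hRd => ?_⟩
  refine (h3 x₀ R hR (closedBall_subset_of_lt_infDist hΩ hx₀ (by positivity) (by linarith))).trans ?_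
  rw [localSize, ← tail_congr huw, ← eLpNorm_congr_ae (ae_restrict_of_ae huw)]
  exact mul_le_mul' (ENNReal.ofReal_le_ofReal (le_max_right _ _)) le_rfl
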